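/- Let $k$ be a field, and let $\Delta_\infty$ be the quiver with vertex set $\mathbb Z$ and one arrow $i\to i+1$ for every $i\in\mathbb Z$. Finite dimensional representations of $\Delta_\infty$ over $k$ are classified by multisegments $\mathbf m=\sum_{i\in\mathbb Z,\,l\ge1}m_{i,l}[i,l]$ (finitely many $m_{i,l}\in\mathbb N$ non-zero): $M(\mathbf m)=\bigoplus m_{i,l}S_i[l]$, where $S_i[l]$ is the indecomposable representation of length $l$ with top $S_i$. Let $\mathfrak M_\infty$ be the set of multisegments. Write $\mathbf m\le_{\deg}\mathbf m'$ if $\mathbf{dim}\,M(\mathbf m)=\mathbf{dim}\,M(\mathbf m')$ and $\dim\mathrm{Hom}(M(\mathbf m),X)\ge\dim\mathrm{Hom}(M(\mathbf m'),X)$ for all finite dimensional representations $X$; write $\mathbf m<_{\deg}\mathbf m'$ if moreover $\mathbf m\neq\mathbf m'$. Let $\mathcal Z=\mathbb Z[v,v^{-1}]$. The Ringel–Hall algebra $\mathcal H$ is the free $\mathcal Z$-module with basis $u_{\mathbf m}$, $\mathbf m\in\mathfrak M_\infty$, and multiplication $$u_{\mathbf m}u_{\mathbf m'}=v^{\langle\mathbf{dim}\,M(\mathbf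 m),\mathbf{dim}\,M(\mathbf m')\rangle}\sum_{\mathbf p}\varphi^{\mathbf p}_{\mathbf m,\mathbf m'}(v^2)\,u_{\mathbf p},$$ where $\langle\mathbf d,\mathbf e\rangle=\sum_i d_ie_i-\sum_i d_ie_{i+1}$ is the Euler form and $\varphi^{\mathbf p}_{\mathbf m,\mathbf m'}\in\mathbb Z[q]$ is the Hall polynomial: for every finite field $F$, $\varphi^{\mathbf p}_{\mathbf m,\mathbf m'}(|F|)$ is the number of subrepresentations $U$ of $M_F(\mathbf p)$ with $M_F(\mathbf p)/U\cong M_F(\mathbf m)$ and $U\cong M_F(\mathbf m')$. Put $\tilde u_{\mathbf m}=v^{\dim\mathrm{End}\,M(\mathbf m)-\dim M(\mathbf m)}u_{\mathbf m}$. The bar involution of $\mathcal H$ is the ring involution that is semilinear with respect to $v\mapsto v^{-1}$ and fixes $\tilde u_{\mathbf m}$ for every $\mathbf m$ such that $M(\mathbf m)$ is semisimple. The canonical basis element $b_{\mathbf m}$ is the unique bar-invariant element of $\tilde u_{\mathbf m}+\sum_{\mathbf p<_{\deg}\mathbf m}v^{-1}\mathbb Z[v^{-1}]\tilde u_{\mathbf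 p}$. Let $\mathcal D(\infty)^-=(\mathcal H\otimes_{\mathcal Z}\mathbb Q(v))^{\mathrm{op}}$, and write $x^-\in\mathcal D(\infty)^-$ for the image of $x\in\mathcal H$. Let $\bigwedge^\infty$ be the $\mathbb Q(v)$-vector space with basis $|\lambda\rangle$, $\lambda$ running over the set $\Pi$ of all partitions. It is a left $\mathcal D(\infty)^-$-module, in exactly one way such that for all $i\in\mathbb Z$ and $\lambda\in\Pi$, $u^-_{[i,1]}\cdot|\lambda\rangle=|\mu\rangle$ if the diagram of $\mu\in\Pi$ arises from that of $\lambda$ by adding a box of color $i$ (the box in row $r$ and column $s$ has color $s-r$), and $u^-_{[i,1]}\cdot|\lambda\rangle=0$ if there is no such $\mu$. For $\lambda=(\lambda_1\ge\dots\ge\lambda_t\ge1)\in\Pi$ put $\mathbf m_\lambda=\sum_{s=1}^t[1-s,\lambda_s]$. **Proposition.** (1) For each $\mathbf m\in\mathfrak M_\infty$, either $\tilde u^-_{\mathbf m}\cdot|\emptyset\rangle=0$, or $\tilde u^-_{\mathbf m}\cdot|\emptyset\rangle\in\mathcal Z\,|\lambda\rangle$ for some $\lambda\in\Pi$ with $\mathbf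 m_\lambda\le_{\deg}\mathbf m$. (2) For each $\lambda\in\Pi$, $\tilde u^-_{\mathbf m_\lambda}\cdot|\emptyset\rangle=|\lambda\rangle$ and $b^-_{\mathbf m_\lambda}\cdot|\emptyset\rangle=|\lambda\rangle$. -/

import Mathlib

universe u

namespace FockHall

noncomputable section

/-! ## Representations of the linear quiver -/

/-- A representation over `k` of the quiver of type `A_∞^∞` with vertex set `ℤ` and one arrow
`i → i + 1` for every `i`. -/
structure QRep (k : Type u) [Field k] where
  V : ℤ → Type u
  [addCommGroup : ∀ i, AddCommGroup (V i)]
  [module : ∀ i, Module k (V i)]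
  f : ∀ i, V i →ₗ[k] V (i + 1)

attribute [instance] QRep.addCommGroup QRep.module

namespace QRep

variable {k : Type u} [Field k]

/-- The total space `⨁ V i` is finite dimensional. -/
def IsFiniteDim (M : QRep k) : Prop :=
  (∀ i, FiniteDimensional k (M.V i)) ∧ {i | Nontrivial (M.V i)}.Finite

/-- The space of homomorphisms of representations. -/
def Hom (M N : QRep k) : Submodule k (∀ i, M.V i →ₗ[k] N.V i) where
  carrier := {g | ∀ i, g (i + 1) ∘ₗ M.f i = N.f i ∘ₗ g i}
  add_mem' := by
    intro a b ha hb i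
    simp only [Set.mem_ofPred_eq] at ha hb
    simp [LinearMap.add_comp, LinearMap.comp_add, ha i, hb i]
  zero_mem' := by
    intro i
    simp
  smul_mem' := by
    intro c a ha i
    simp only [Set.mem_ofPred_eq] at ha
    simp [LinearMap.smul_comp, LinearMap.comp_smul, ha i]

/-- Isomorphism of representations. -/
def Iso (M N : QRep k) : Prop :=
  ∃ e : ∀ i, M.V i ≃ₗ[k] N.V i, ∀ i x, e (i + 1) (M.f i x) = N.f i (e i x)

/-- The degeneration order `M ≤_deg N`: the dimension vectors agree and
`dim Hom(M, X) ≥ dim Hom(N, X)` for all finite dimensional representations `X`. -/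
def DegLE (M N : QRep k) : Prop :=
  (∀ i, Module.finrank k (M.V i) = Module.finrank k (N.V i)) ∧
    ∀ X : QRep k, X.IsFiniteDim → Module.finrank k (Hom N X) ≤ Module.finrank k (Hom M X)

/-- Subrepresentations. -/
structure Sub (M : QRep k) where
  carrier : ∀ i, Submodule k (M.V i)
  map_mem : ∀ i, ∀ x ∈ carrier i, M.f i x ∈ carrier (i + 1)

/-- A subrepresentation, as a representation. -/
def Sub.toRep {M : QRep k} (U : Sub M) : QRep k where
  V i := U.carrier i
  f i := (M.f i).restrict (U.map_mem i)

/-- The quotient of a representation by a subrepresentation. -/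
def Sub.quotient {M : QRep k} (U : Sub M) : QRep k where
  V i := M.V i ⧸ U.carrier i
  f i := (U.carrier i).mapQ (U.carrier (i + 1)) (M.f i) (U.map_mem i)

/-- Direct sums of representations. -/
def directSum {ι : Type} (M : ι → QRep k) : QRep k where
  V j := DirectSum ι fun x => (M x).V j
  f j := DirectSum.lmap fun x => (M x).f j

/-- The indecomposable representation `S_i[l]` with top `S_i` and length `l`: it is `k` at the
vertices `i, i + 1, …, i + l - 1` (functions on a one-point set) and zero at all other vertices
(functions on the empty set); the maps between neighbouring copies of `k` are identities. -/
def segment (k : Type u) [Field k] (i : ℤ) (l : ℕ+) : QRep k where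
  V j := {_x : Unit // i ≤ j ∧ j < i + (l : ℕ)} → k
  f j :=
    { toFun := fun a _ => if h : i ≤ j ∧ j < i + (l : ℕ) then a ⟨(), h⟩ else 0
      map_add' := by
        intro a b
        ext x
        by_cases h : i ≤ j ∧ j < i + (l : ℕ) <;> simp [h]
      map_smul' := by
        intro c a
        ext x
        by_cases h : i ≤ j ∧ j < i + (l : ℕ) <;> simp [h] }

end QRep

/-! ## Multisegments -/

/-- Multisegments `∑ m_{i,l} [i, l]` with `i ∈ ℤ`, `l ≥ 1`. -/
abbrev Multisegment : Type := (ℤ × ℕ+) →₀ ℕ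

/-- The multisegment `[i, l]`. -/
def seg (i : ℤ) (l : ℕ+) : Multisegment := Finsupp.single (i, l) 1

/-- `M(m) = ⨁ m_{i,l} S_i[l]`. -/
def repOf (k : Type u) [Field k] (m : Multisegment) : QRep k :=
  QRep.directSum fun x : (Σ p : ℤ × ℕ+, Fin (m p)) => QRep.segment k x.1.1 x.1.2

/-- The dimension vector of `M(m)`; the segment `[i, l]` contributes `ε_i + ⋯ + ε_{i+l-1}`. -/
def dimVec (m : Multisegment) : ℤ →₀ ℕ :=
  m.sum fun p c => c • ∑ r ∈ Finset.range (p.2 : ℕ), Finsupp.single (p.1 + (r : ℤ)) 1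

/-- The total dimension of `M(m)`. -/
def totalDim (m : Multisegment) : ℕ := m.sum fun p c => c * (p.2 : ℕ)

/-- The multisegment of the semisimple representation `S_d = ⨁ d_i S_i`. -/
def semisimple (d : ℤ →₀ ℕ) : Multisegment := d.sum fun i c => c • seg i 1

/-- The Euler form of the quiver,
`⟨d, e⟩ = ∑ d_i e_i - ∑ d_i e_{i+1} = dim Hom(M, N) - dim Ext¹(M, N)` for `dim M = d`,
`dim N = e`. -/
def eulerForm (d e : ℤ →₀ ℕ) : ℤ :=
  d.sum fun i a => (a : ℤ) * ((e i : ℤ) - (e (i + 1) : ℤ))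

/-- `m ≤_deg m'`, i.e. `M(m) ≤_deg M(m')`. -/
def DegLE (k : Type u) [Field k] (m m' : Multisegment) : Prop :=
  (repOf k m).DegLE (repOf k m')

/-- `m <_deg m'`. -/
def DegLT (k : Type u) [Field k] (m m' : Multisegment) : Prop :=
  DegLE k m m' ∧ m ≠ m'

/-! ## The Ringel–Hall algebra -/

/-- The number of submodules `U` of `M(p)` with `M(p) / U ≅ M(m)` and `U ≅ M(m')`. -/
def hallNumber (k : Type u) [Field k] (m m' p : Multisegment) : ℕ :=
  {U : (repOf k p).Sub |
    U.quotient.Iso (repOf k m) ∧ U.toRep.Iso (repOf k m')}.ncard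

/-- `P` is a Hall polynomial: its value at `|k|` is the Hall number over `k`, for every finite
field `k`. -/
def IsHallPoly (m m' p : Multisegment) (P : Polynomial ℤ) : Prop :=
  ∀ (k : Type) [Field k] [Finite k], P.eval (Nat.card k : ℤ) = (hallNumber k m m' p : ℤ)

open Classical in
/-- The Hall polynomial `φ_{m,m'}^p ∈ ℤ[q]`. There is at most one, since there are infinitely
many orders of finite fields. -/
def hallPoly (m m' p : Multisegment) : Polynomial ℤ :=
  if h : ∃ P, IsHallPoly m m' p P then h.choose else 0

/-- The ring `𝒵 = ℤ[v, v⁻¹]`. -/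
abbrev Z : Type := LaurentPolynomial ℤ

/-- The field `ℚ(v)`. -/
abbrev K : Type := RatFunc ℚ

/-- The indeterminate `v` of `𝒵`. -/
def vZ : Zˣ where
  val := LaurentPolynomial.T 1
  inv := LaurentPolynomial.T (-1)
  val_inv := by rw [← LaurentPolynomial.T_add]; simp
  inv_val := by rw [← LaurentPolynomial.T_add]; simp

/-- The indeterminate `v` of `ℚ(v)`. -/
def vK : Kˣ := Units.mk0 RatFunc.X RatFunc.X_ne_zero

/-- The inclusion of `𝒵` in `ℚ(v)`. -/
def toK : Z →+* K := LaurentPolynomial.eval₂ (Int.castRingHom K) vK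

/-- The underlying module of the Ringel–Hall algebra with coefficients in `R`: it is free with
basis `u_m`, `m` a multisegment. -/
abbrev Hall (R : Type) [CommRing R] : Type := Multisegment →₀ R

/-- The basis element `u_m`. -/
def uBasis (R : Type) [CommRing R] (m : Multisegment) : Hall R := Finsupp.single m 1

/-- The (twisted, generic) multiplication of the Ringel–Hall algebra,
`u_m u_{m'} = v^{⟨dim M(m), dim M(m')⟩} ∑_p φ_{m,m'}^p(v²) u_p`. Only finitely many `p`
contribute, because of their dimension vector. -/
def hallMul (R : Type) [CommRing R] (v : Rˣ) : Hall R →ₗ[R] Hall R →ₗ[R] Hall R :=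
  Finsupp.linearCombination R fun m => Finsupp.linearCombination R fun m' =>
    ((v ^ eulerForm (dimVec m) (dimVec m') : Rˣ) : R) •
      ∑ᶠ p : Multisegment, Polynomial.aeval ((v : R) ^ 2) (hallPoly m m' p) • uBasis R p

/-- `ũ_m = v^{dim End M(m) - dim M(m)} u_m`, in the Ringel–Hall algebra over `𝒵`. -/
def uTilde (k : Type u) [Field k] (m : Multisegment) : Hall Z :=
  ((vZ ^ ((Module.finrank k (QRep.Hom (repOf k m) (repOf k m)) : ℤ) - (totalDim m : ℤ)) : Zˣ) : Z)
    • uBasis Z m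

/-! ## The canonical basis -/

/-- The bar involution: a ring involution of the Ringel–Hall algebra over `𝒵` which is semilinear
with respect to `v ↦ v⁻¹` and fixes `ũ_d = ũ_{[S_d]}` for every dimension vector `d` (in
particular the unit element `u_0`). -/
structure IsBarInvolution (k : Type u) [Field k] (bar : Hall Z →+ Hall Z) : Prop where
  map_smul : ∀ (a : Z) (x : Hall Z), bar (a • x) = LaurentPolynomial.invert a • bar x
  map_mul : ∀ x y : Hall Z, bar (hallMul Z vZ x y) = hallMul Z vZ (bar x) (bar y)
  involutive : ∀ x : Hall Z, bar (bar x) = x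
  map_semisimple : ∀ d : ℤ →₀ ℕ, bar (uTilde k (semisimple d)) = uTilde k (semisimple d)

open Classical in
/-- The bar involution; it is unique since the `ũ_d` generate the Ringel–Hall algebra. -/
def barInvolution (k : Type u) [Field k] : Hall Z →+ Hall Z :=
  if h : ∃ bar, IsBarInvolution k bar then h.choose else 0

/-- The subset `v⁻¹ ℤ[v⁻¹]` of `𝒵`. -/
def negPart : Set Z :=
  {a | ∃ P : Polynomial ℤ,
    a = LaurentPolynomial.T (-1) * Polynomial.aeval (LaurentPolynomial.T (-1) : Z) P}

/-- The characterization of the canonical basis element `b_m`: it is fixed by the bar involution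
and lies in `ũ_m + ∑_{p <_deg m} v⁻¹ ℤ[v⁻¹] ũ_p`. -/
def IsCanonical (k : Type u) [Field k] (m : Multisegment) (b : Hall Z) : Prop :=
  barInvolution k b = b ∧
    ∃ c : Multisegment →₀ Z, (∀ p ∈ c.support, DegLT k p m ∧ c p ∈ negPart) ∧
      b = uTilde k m + c.sum fun p a => a • uTilde k p

open Classical in
/-- The canonical basis element `b_m`. -/
def canonicalBasis (k : Type u) [Field k] (m : Multisegment) : Hall Z :=
  if h : ∃ b, IsCanonical k m b then h.choose else 0

/-! ## The negative part of the double Ringel–Hall algebra and the Fock space -/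

/-- The multiplication of the negative part `𝒟(∞)⁻ = (ℋ ⊗ ℚ(v))ᵒᵖ` of the double Ringel–Hall
algebra; its basis elements `u_m⁻` are `uBasis K m`, and
`u_m⁻ u_{m'}⁻ = v^{⟨dim M(m'), dim M(m)⟩} ∑_p φ_{m',m}^p(v²) u_p⁻`. -/
def minusMul (x y : Hall K) : Hall K := hallMul K vK y x

/-- The map `x = ∑ x_m u_m ↦ x⁻ = ∑ x_m u_m⁻`. -/
def minus (x : Hall Z) : Hall K := x.mapRange toK (map_zero toK)

/-- The Fock space: the `ℚ(v)`-vector space with basis `|λ⟩`, `λ` a partition (given by its Young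
diagram). -/
abbrev Fock : Type := YoungDiagram →₀ K

/-- The basis vector `|λ⟩`. -/
def ket (lam : YoungDiagram) : Fock := Finsupp.single lam 1

/-- `μ` arises from `λ` by adding one box of color `i`; the box in row `r` and column `s` has
color `s - r`. -/
def AddsBox (i : ℤ) (lam mu : YoungDiagram) : Prop :=
  lam ≤ mu ∧ ∃ c : ℕ × ℕ, mu.cells \ lam.cells = {c} ∧ (c.2 : ℤ) - (c.1 : ℤ) = i

open Classical in
/-- The operator `F_i`: it maps `|λ⟩` to `|μ⟩`, where `μ` is `λ` with a box of color `i` added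
(there is at most one such `μ`), and to `0` if there is no such `μ`. -/
def fockF (i : ℤ) : Fock →ₗ[K] Fock :=
  Finsupp.linearCombination K fun lam =>
    if h : ∃ mu, AddsBox i lam mu then ket h.choose else 0

/-- `ρ` is a left `𝒟(∞)⁻`-module structure on the Fock space for which `u_i⁻` acts as `F_i`. -/
structure IsFockAction (ρ : Hall K →ₗ[K] Module.End K Fock) : Prop where
  map_one : ρ (uBasis K 0) = 1
  map_mul : ∀ x y : Hall K, ρ (minusMul x y) = ρ x * ρ y
  map_gen : ∀ i : ℤ, ρ (uBasis K (seg i 1)) = fockF i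

open Classical in
/-- The action of `𝒟(∞)⁻` on the Fock space; it is unique since the `u_i⁻` generate `𝒟(∞)⁻`. -/
def fockAction : Hall K →ₗ[K] Module.End K Fock :=
  if h : ∃ ρ, IsFockAction ρ then h.choose else 0

/-- The multisegment `m_λ = ∑_s [1 - s, λ_s]` of a partition `λ = (λ_1, …, λ_t)`. Rows are counted
from zero here, and all `λ.colLen 0` rows in the sum have positive length. -/
def partSeg (lam : YoungDiagram) : Multisegment :=
  ∑ s ∈ Finset.range (lam.colLen 0), seg (-(s : ℤ)) (Nat.toPNat' (lam.rowLen s))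

end

end FockHall

/-!
The proof makes the Hall algebra computable through left multiplication by the simple generators
`u_i`, for which everything can be written down, and then evaluates an explicit formula for the
action on the Fock space at the vacuum vector.

*Hall algebra.* A representation is determined up to isomorphism by the ranks of its maps
`V i → V j` (`iso_repOf_iff`), and the degeneration order compares these ranks (`degLE_iff`). Hall
numbers are associative (`hallNumber_assoc`), and those with a simple quotient `S_i` are found by
counting functionals on `V i` (`hallNumber_simple_red`): up to a power of `q` and a quantum integer,
multiplication by `u_i` lengthens a segment `[i + 1, n]` to `[i, n + 1]`. By triangularity with
respect to the degeneration order, the `u_i` generate everything up to quantum integers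
(`exists_smul_uBasis_mem`). This yields the Hall polynomials (`exists_isHallPoly`) and the identity
`u_i (x y) = (u_i x) y` in the generic Hall algebra (`hallMul_lmul`). The divided powers `ũ_{a S_i}`
act unitriangularly, so they generate without denominators (`eq_top_of_divMul_mem`).

*Bar involution.* The bar involution should conjugate the coefficients of linear combinations of
words in the `u_i`. This is well defined because the relations between words form the radical of
twisted derivations `E_i` (`wordHall_eq_zero_iff`), and this radical does not change if `v` is
replaced by `v⁻¹` (`radical_inv`). Monomials in the divided powers are bar invariant with leading
term `ũ_m`, and correcting the lower terms gives the canonical basis (`isCanonical_canonicalBasis`).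

*Fock space.* A partition is a set of beads at the positions `λ_r - r`, and `u_i⁻` moves a bead from
`i` to `i + 1`. In general `u_m⁻` moves, for every segment of `m`, the bead at the start of the
segment along its length; each vacant position jumped over contributes a factor `v`, and reordering
the beads contributes a sign (`segAct`). Compatibility with multiplication by `u_i`
(`fockRep_lmul`) shows that this is the action, as the `u_i` generate (`fockAction_eq`).

*Vacuum vector.* The vacuum has a bead at every nonpositive position. If `u_m⁻` moves these beads to
those of `λ`, then counting beads beyond given positions bounds the ranks of `M(m_λ)` by those of
`M(m)`, which is part (1) (`rkLE_partSeg`). For `m = m_λ` the beads stay in order, and the power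
of `v` from the vacant positions cancels the normalization of `ũ` (`endDim_add_holes_partSeg`). The
lower terms of the canonical basis element `b_{m_λ}` annihilate the vacuum: by part (1) they could
only contribute some `|μ⟩` with `m_μ < m_λ`, but dimension vectors determine partitions
(`segAct_bot_eq_zero`).
-/

namespace FockHall

noncomputable section

/-! ### Statistics of multisegments -/

/-- The additive statistic of multisegments with value `g (i, l)` on the segment `[i, l]`. -/
def wt (g : ℤ × ℕ+ → ℕ) (m : Multisegment) : ℕ := m.sum fun p c => c * g p

@[simp] theorem wt_zero (g : ℤ × ℕ+ → ℕ) : wt g 0 = 0 := by simp [wt]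

@[simp] theorem wt_add (g : ℤ × ℕ+ → ℕ) (m n : Multisegment) : wt g (m + n) = wt g m + wt g n := by
  unfold wt
  rw [Finsupp.sum_add_index'] <;> simp [add_mul]

@[simp] theorem wt_single (g : ℤ × ℕ+ → ℕ) (p : ℤ × ℕ+) (c : ℕ) :
    wt g (Finsupp.single p c) = c * g p := by
  simp [wt, Finsupp.sum_single_index]

@[simp] theorem wt_seg (g : ℤ × ℕ+ → ℕ) (i : ℤ) (l : ℕ+) : wt g (seg i l) = g (i, l) := by
  simp [seg]

theorem wt_fun_add (g h : ℤ × ℕ+ → ℕ) (m : Multisegment) :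
    wt (fun p => g p + h p) m = wt g m + wt h m := by
  simp [wt, mul_add, Finsupp.sum_add]

theorem wt_mono_fun {g h : ℤ × ℕ+ → ℕ} (H : ∀ p, g p ≤ h p) (m : Multisegment) :
    wt g m ≤ wt h m :=
  Finset.sum_le_sum fun p _ => Nat.mul_le_mul_left _ (H p)

theorem wt_mono (g : ℤ × ℕ+ → ℕ) {m n : Multisegment} (h : m ≤ n) : wt g m ≤ wt g n := by
  obtain ⟨c, rfl⟩ := exists_add_of_le h
  simp

theorem le_wt (g : ℤ × ℕ+ → ℕ) (m : Multisegment) (p : ℤ × ℕ+) (hp : m p ≠ 0) : g p ≤ wt g m := by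
  have : Finsupp.single p 1 ≤ m := by
    rw [Finsupp.single_le_iff]; omega
  simpa using wt_mono g this

theorem wt_eq_zero_iff (g : ℤ × ℕ+ → ℕ) (m : Multisegment) :
    wt g m = 0 ↔ ∀ p, m p ≠ 0 → g p = 0 := by
  unfold wt Finsupp.sum
  rw [Finset.sum_eq_zero_iff]
  refine forall_congr' fun p => ?_
  simp only [Finsupp.mem_support_iff, mul_eq_zero]
  tauto

open Classical in
theorem wt_indicator (m : Multisegment) (p : ℤ × ℕ+) :
    wt (fun x => if x = p then 1 else 0) m = m p := by
  unfold wt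
  simp only [mul_ite, mul_one, mul_zero]
  rw [Finsupp.sum_ite_eq']
  simp only [Finsupp.mem_support_iff, ite_not]
  split_ifs <;> simp_all

theorem wt_finsetSum {ι : Type*} (g : ℤ × ℕ+ → ℕ) (s : Finset ι) (f : ι → Multisegment) :
    wt g (∑ x ∈ s, f x) = ∑ x ∈ s, wt g (f x) := by
  classical
  induction s using Finset.induction_on with
  | empty => simp
  | insert a s ha ih => rw [Finset.sum_insert ha, Finset.sum_insert ha, wt_add, ih]

/-- The number of segments of `m` which contain `i, …, j`; for `i ≤ j` this is the rank of the
map `V i → V j` of `M(m)`. -/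
def rk (m : Multisegment) (i j : ℤ) : ℕ :=
  wt (fun p => if p.1 ≤ i ∧ j < p.1 + (p.2 : ℕ) then 1 else 0) m

/-- The number of segments `[i, l]` of `m` with `l > n`. -/
def cg (m : Multisegment) (i : ℤ) (n : ℕ) : ℕ :=
  wt (fun p => if p.1 = i ∧ n < (p.2 : ℕ) then 1 else 0) m

/-- The multiplicity of `[i, n + 1]` in `m`. -/
def mu (m : Multisegment) (i : ℤ) (n : ℕ) : ℕ := m (i, n.succPNat)

theorem cg_succ (m : Multisegment) (i : ℤ) (n : ℕ) : cg m i n = mu m i n + cg m i (n + 1) := by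
  classical
  unfold cg mu
  rw [← wt_indicator, ← wt_fun_add]
  congr 1
  funext p
  obtain ⟨a, l⟩ := p
  have h : ((a, l) = (i, n.succPNat)) ↔ a = i ∧ (l : ℕ) = n + 1 := by
    rw [Prod.mk.injEq, ← PNat.coe_inj, Nat.succPNat_coe]
  simp only [h]
  split_ifs <;> omega

theorem rk_eq_add_cg (m : Multisegment) (i : ℤ) (n : ℕ) :
    rk m i (i + n) = rk m (i - 1) (i + n) + cg m i n := by
  unfold cg rk
  rw [← wt_fun_add]
  congr 1
  funext p
  split_ifs <;> omega

theorem totalDim_eq_wt (m : Multisegment) : totalDim m = wt (fun p => (p.2 : ℕ)) m := rfl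

theorem length_le_totalDim {m : Multisegment} {p : ℤ × ℕ+} (hp : m p ≠ 0) :
    (p.2 : ℕ) ≤ totalDim m := le_wt (fun p => (p.2 : ℕ)) m p hp

theorem cg_eq_zero_of_le {m : Multisegment} {i : ℤ} {n : ℕ} (h : totalDim m ≤ n) :
    cg m i n = 0 := by
  unfold cg
  rw [wt_eq_zero_iff]
  intro p hp
  have := length_le_totalDim hp
  rw [if_neg]; omega

theorem cg_antitone (m : Multisegment) (i : ℤ) : Antitone (cg m i) :=
  antitone_nat_of_succ_le fun n => by have := cg_succ m i n; omega

theorem dimVec_apply (m : Multisegment) (i : ℤ) : dimVec m i = rk m i i := by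
  unfold dimVec rk wt
  rw [Finsupp.sum_apply]
  refine Finset.sum_congr rfl fun p _ => ?_
  simp only [Finsupp.smul_apply, Finsupp.finsetSum_apply, smul_eq_mul]
  congr 1
  split_ifs with h
  · rw [Finset.sum_eq_single (i - p.1).toNat]
    · rw [Finsupp.single_apply, if_pos (by omega)]
    · intro b _ hb
      rw [Finsupp.single_apply, if_neg (by omega)]
    · intro hb
      rw [Finset.mem_range] at hb
      omega
  · refine Finset.sum_eq_zero fun r hr => ?_
    rw [Finset.mem_range] at hr
    rw [Finsupp.single_apply, if_neg (by omega)]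

@[simp] theorem dimVec_add (m n : Multisegment) : dimVec (m + n) = dimVec m + dimVec n := by
  ext i
  simp [dimVec_apply, rk]

theorem eq_of_rk_eq {m m' : Multisegment} (h : ∀ i j, i ≤ j → rk m i j = rk m' i j) : m = m' := by
  have hc : ∀ i n, cg m i n = cg m' i n := fun i n => by
    have h1 := rk_eq_add_cg m i n
    have h2 := rk_eq_add_cg m' i n
    have h3 := h i (i + n) (by omega)
    have h4 := h (i - 1) (i + n) (by omega)
    omega
  ext ⟨i, l⟩
  have h1 := cg_succ m i (l.natPred)
  have h2 := cg_succ m' i (l.natPred)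
  rw [hc, hc] at h1
  unfold mu at h1 h2
  rw [PNat.succPNat_natPred] at h1 h2
  omega

theorem finite_dimVec_eq (d : ℤ →₀ ℕ) : {m : Multisegment | dimVec m = d}.Finite := by
  classical
  set N := d.sum fun _ c => c with hN
  let B : Multisegment := ∑ i ∈ d.support, ∑ l ∈ Finset.range N, Finsupp.single (i, l.succPNat) N
  refine (Set.finite_Iic B).subset fun m hm => ?_
  have hm : dimVec m = d := hm
  rw [Set.mem_Iic]
  have hd : ∀ i, rk m i i = d i := fun i => by rw [← dimVec_apply, hm]
  have hle : ∀ i, d i ≤ N := fun i => by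
    by_cases hi : d i = 0
    · omega
    · exact Finset.single_le_sum (f := fun i => d i) (fun _ _ => Nat.zero_le _)
        (Finsupp.mem_support_iff.mpr hi)
  have hle2 : ∀ s : Finset ℤ, ∑ i ∈ s, d i ≤ N := fun s => by
    rw [hN, Finsupp.sum_of_support_subset d (Finset.subset_union_right (s₁ := s)) _ (by simp)]
    exact Finset.sum_le_sum_of_subset Finset.subset_union_left
  have key : ∀ p, m p ≠ 0 → m p ≤ rk m p.1 p.1 := fun p hp => by
    have : Finsupp.single p (m p) ≤ m := by rw [Finsupp.single_le_iff]
    have := wt_mono (fun q => if q.1 ≤ p.1 ∧ p.1 < q.1 + (q.2 : ℕ) then 1 else 0) this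
    rw [wt_single, if_pos ⟨le_rfl, by have := p.2.pos; omega⟩] at this
    simpa [rk] using this
  intro p
  by_cases hp : m p = 0
  · omega
  obtain ⟨i, l⟩ := p
  have h1 : m (i, l) ≤ d i := by rw [← hd]; exact key _ hp
  have hi : i ∈ d.support := by rw [Finsupp.mem_support_iff]; omega
  have hl : (l : ℕ) ≤ N := by
    refine le_trans ?_ (hle2 ((Finset.range l).image fun r : ℕ => i + (r : ℤ)))
    rw [Finset.sum_image (by intro a _ b _ h; simpa using h)]
    calc (l : ℕ) = ∑ _x ∈ Finset.range l, 1 := by simp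
      _ ≤ _ := Finset.sum_le_sum fun r hr => ?_
    rw [Finset.mem_range] at hr
    rw [← hd]
    refine le_trans ?_ (le_wt _ m (i, l) hp)
    simp only
    rw [if_pos]
    omega
  have : (Finsupp.single (i, l) N : Multisegment) ≤ B := by
    have h2 : (Finsupp.single (i, l) N : Multisegment) =
        Finsupp.single (i, l.natPred.succPNat) N := by rw [PNat.succPNat_natPred]
    rw [h2]
    refine le_trans ?_ (Finset.single_le_sum (f := fun i => ∑ l ∈ Finset.range N,
      (Finsupp.single (i, l.succPNat) N : Multisegment)) (fun _ _ => zero_le) hi)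
    refine Finset.single_le_sum (f := fun l : ℕ =>
      (Finsupp.single (i, l.succPNat) N : Multisegment)) (fun _ _ => zero_le) ?_
    rw [Finset.mem_range]
    have := PNat.natPred_add_one l
    omega
  refine le_trans (le_trans h1 (hle i)) ?_
  simpa using this (i, l)

/-! ### Lengthening and shortening a segment at its top -/

/-- The segment `[i, n]` for a natural number `n`; it is empty for `n = 0`. -/
def segN (i : ℤ) : ℕ → Multisegment
  | 0 => 0
  | n + 1 => seg i n.succPNat

@[simp] theorem segN_zero (i : ℤ) : segN i 0 = 0 := rfl

theorem segN_succ (i : ℤ) (n : ℕ) : segN i (n + 1) = Finsupp.single (i, n.succPNat) 1 := rfl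

theorem segN_one (i : ℤ) : segN i 1 = seg i 1 := segN_succ i 0

/-- Shorten a segment `[i, n + 1]` of `p` to `[i + 1, n]`. -/
def red (p : Multisegment) (i : ℤ) (n : ℕ) : Multisegment := p - segN i (n + 1) + segN (i + 1) n

/-- Lengthen a segment `[i + 1, n]` of `m` to `[i, n + 1]`. -/
def ext (m : Multisegment) (i : ℤ) (n : ℕ) : Multisegment := m - segN (i + 1) n + segN i (n + 1)

theorem segN_le_iff {p : Multisegment} {i : ℤ} {n : ℕ} : segN i (n + 1) ≤ p ↔ mu p i n ≠ 0 := by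
  rw [segN_succ, Finsupp.single_le_iff, mu]; omega

theorem ext_red {p : Multisegment} {i : ℤ} {n : ℕ} (h : segN i (n + 1) ≤ p) :
    ext (red p i n) i n = p := by
  rw [ext, red, add_tsub_cancel_right, tsub_add_cancel_of_le h]

theorem red_ext {m : Multisegment} {i : ℤ} {n : ℕ} (h : segN (i + 1) n ≤ m) :
    red (ext m i n) i n = m := by
  rw [ext, red, add_tsub_cancel_right, tsub_add_cancel_of_le h]

theorem segN_le_red (p : Multisegment) (i : ℤ) (n : ℕ) : segN (i + 1) n ≤ red p i n :=
  le_add_of_nonneg_left (zero_le)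

theorem segN_le_ext (p : Multisegment) (i : ℤ) (n : ℕ) : segN i (n + 1) ≤ ext p i n :=
  le_add_of_nonneg_left (zero_le)

theorem wt_red (g : ℤ × ℕ+ → ℕ) {p : Multisegment} {i : ℤ} {n : ℕ} (h : segN i (n + 1) ≤ p) :
    wt g (red p i n) + wt g (segN i (n + 1)) = wt g p + wt g (segN (i + 1) n) := by
  obtain ⟨c, rfl⟩ := exists_add_of_le h
  rw [red, add_tsub_cancel_left, wt_add, wt_add]
  omega

theorem wt_ext (g : ℤ × ℕ+ → ℕ) {m : Multisegment} {i : ℤ} {n : ℕ} (h : segN (i + 1) n ≤ m) :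
    wt g (ext m i n) + wt g (segN (i + 1) n) = wt g m + wt g (segN i (n + 1)) := by
  obtain ⟨c, rfl⟩ := exists_add_of_le h
  rw [ext, add_tsub_cancel_left, wt_add, wt_add]
  omega

theorem wt_segN (g : ℤ × ℕ+ → ℕ) (i : ℤ) (n : ℕ) (G : ℤ → ℕ → ℕ)
    (hG : ∀ i (l : ℕ+), G i l = g (i, l)) (h0 : G i 0 = 0) : wt g (segN i n) = G i n := by
  cases n with
  | zero => simp [h0]
  | succ n => rw [segN, wt_seg, ← hG, Nat.succPNat_coe]

theorem rk_segN (i : ℤ) (n : ℕ) {a b : ℤ} (hab : a ≤ b) :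
    rk (segN i n) a b = if i ≤ a ∧ b < i + n then 1 else 0 :=
  wt_segN _ i n (fun i n => if i ≤ a ∧ b < i + n then 1 else 0) (fun _ _ => rfl) (by
    rw [if_neg]; push_cast; omega)

theorem cg_segN (i : ℤ) (n : ℕ) (a : ℤ) (b : ℕ) :
    cg (segN i n) a b = if i = a ∧ b < n then 1 else 0 :=
  wt_segN _ i n (fun i n => if i = a ∧ b < n then 1 else 0) (fun _ _ => rfl) (by
    rw [if_neg]; omega)

theorem totalDim_segN (i : ℤ) (n : ℕ) : totalDim (segN i n) = n :=
  wt_segN _ i n (fun _ n => n) (fun _ _ => rfl) rfl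

theorem rk_add (m n : Multisegment) (i j : ℤ) : rk (m + n) i j = rk m i j + rk n i j := wt_add _ _ _

theorem cg_add (m n : Multisegment) (i : ℤ) (j : ℕ) : cg (m + n) i j = cg m i j + cg n i j :=
  wt_add _ _ _

theorem rk_red {p : Multisegment} {i : ℤ} {n : ℕ} (h : segN i (n + 1) ≤ p) {a b : ℤ}
    (hab : a ≤ b) :
    rk (red p i n) a b + (if a = i ∧ b < i + (n + 1) then 1 else 0) = rk p a b := by
  have := wt_red (fun p => if p.1 ≤ a ∧ b < p.1 + (p.2 : ℕ) then 1 else 0) h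
  change rk _ a b + rk _ a b = rk _ a b + rk _ a b at this
  rw [rk_segN _ _ hab, rk_segN _ _ hab] at this
  push_cast at this
  split_ifs at * <;> omega

theorem cg_red {p : Multisegment} {i : ℤ} {n : ℕ} (h : segN i (n + 1) ≤ p) (a : ℤ) (b : ℕ) :
    cg (red p i n) a b + (if i = a ∧ b < n + 1 then 1 else 0) =
      cg p a b + (if i + 1 = a ∧ b < n then 1 else 0) := by
  have := wt_red (fun p => if p.1 = a ∧ b < (p.2 : ℕ) then 1 else 0) h
  change cg _ a b + cg _ a b = cg _ a b + cg _ a b at this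
  rwa [cg_segN, cg_segN] at this

theorem cg_ext {m : Multisegment} {i : ℤ} {n : ℕ} (h : segN (i + 1) n ≤ m) (a : ℤ) (b : ℕ) :
    cg (ext m i n) a b + (if i + 1 = a ∧ b < n then 1 else 0) =
      cg m a b + (if i = a ∧ b < n + 1 then 1 else 0) := by
  have := wt_ext (fun p => if p.1 = a ∧ b < (p.2 : ℕ) then 1 else 0) h
  change cg _ a b + cg _ a b = cg _ a b + cg _ a b at this
  rwa [cg_segN, cg_segN] at this

theorem totalDim_red {p : Multisegment} {i : ℤ} {n : ℕ} (h : segN i (n + 1) ≤ p) :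
    totalDim (red p i n) + 1 = totalDim p := by
  have := wt_red (fun p => (p.2 : ℕ)) h
  change totalDim _ + totalDim _ = totalDim _ + totalDim _ at this
  rw [totalDim_segN, totalDim_segN] at this
  omega

theorem totalDim_ext {m : Multisegment} {i : ℤ} {n : ℕ} (h : segN (i + 1) n ≤ m) :
    totalDim (ext m i n) = totalDim m + 1 := by
  have := totalDim_red (segN_le_ext m i n)
  rw [red_ext h] at this
  omega

theorem dimVec_red {p : Multisegment} {i : ℤ} {n : ℕ} (h : segN i (n + 1) ≤ p) :
    dimVec (red p i n) + Finsupp.single i 1 = dimVec p := by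
  ext a
  have := rk_red h (le_refl a)
  rw [Finsupp.add_apply, dimVec_apply, dimVec_apply, ← this, Finsupp.single_apply]
  congr 1
  split_ifs <;> omega

theorem dimVec_ext {m : Multisegment} {i : ℤ} {n : ℕ} (h : segN (i + 1) n ≤ m) :
    dimVec (ext m i n) = dimVec m + Finsupp.single i 1 := by
  rw [← dimVec_red (segN_le_ext m i n), red_ext h]

theorem dimVec_zero : dimVec 0 = 0 := by simp [dimVec]

theorem dimVec_seg_one (i : ℤ) : dimVec (seg i 1) = Finsupp.single i 1 := by
  have := dimVec_ext (m := 0) (i := i) (n := 0) (by simp)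
  rw [dimVec_zero, zero_add] at this
  rw [← this, ext]
  simp [segN_one]

/-- Different ways of shortening a segment at `i` give different multisegments. -/
theorem red_injective {p : Multisegment} {i : ℤ} {n n' : ℕ} (h : segN i (n + 1) ≤ p)
    (h' : segN i (n' + 1) ≤ p) (e : red p i n = red p i n') : n = n' := by
  wlog hlt : n < n' generalizing n n'
  · rcases lt_trichotomy n n' with h1 | h1 | h1
    · exact absurd h1 hlt
    · exact h1
    · exact (this h' h e.symm h1).symm
  have h1 := cg_red h i n'
  have h2 := cg_red h' i n'
  rw [e] at h1
  split_ifs at h1 h2 <;> omega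

theorem ext_injective {m : Multisegment} {i : ℤ} {n n' : ℕ} (h : segN (i + 1) n ≤ m)
    (h' : segN (i + 1) n' ≤ m) (e : ext m i n = ext m i n') : n = n' := by
  wlog hlt : n < n' generalizing n n'
  · rcases lt_trichotomy n n' with h1 | h1 | h1
    · exact absurd h1 hlt
    · exact h1
    · exact (this h' h e.symm h1).symm
  have h1 := cg_ext h i n'
  have h2 := cg_ext h' i n'
  rw [e] at h1
  split_ifs at h1 h2 <;> omega

section Representations

variable {k : Type u} [Field k]

/-! ### Transport maps and ranks of representations -/

/-- The dimension formula for a linear map on a subspace. -/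
theorem finrank_map_add_finrank_inf_ker {k V W : Type*} [Field k] [AddCommGroup V] [Module k V]
    [AddCommGroup W] [Module k W] (g : V →ₗ[k] W) (X : Submodule k V) [FiniteDimensional k X] :
    Module.finrank k (X.map g) + Module.finrank k (X ⊓ LinearMap.ker g : Submodule k V) =
      Module.finrank k X := by
  have h := LinearMap.finrank_range_add_finrank_ker (g.domRestrict X)
  rw [LinearMap.range_domRestrict, LinearMap.ker_domRestrict] at h
  rw [← h]
  congr 1
  rw [← Submodule.finrank_map_subtype_eq, Submodule.map_comap_subtype]

namespace QRep

/-- The identification of the spaces at two equal vertices. -/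
def castV (M : QRep k) {i j : ℤ} (h : i = j) : M.V i →ₗ[k] M.V j := h ▸ LinearMap.id

/-- The composite map `V i → V (i + n)`. -/
def trNat (M : QRep k) (i : ℤ) : ∀ n : ℕ, M.V i →ₗ[k] M.V (i + n)
  | 0 => M.castV (by simp)
  | n + 1 => M.castV (by push_cast; ring) ∘ₗ M.f (i + n) ∘ₗ M.trNat i n

/-- The composite map `V i → V j` for `i ≤ j`, extended by zero to all pairs of vertices. -/
def tr (M : QRep k) (i j : ℤ) : M.V i →ₗ[k] M.V j :=
  if h : i ≤ j then M.castV (by omega : i + ((j - i).toNat : ℤ) = j) ∘ₗ M.trNat i (j - i).toNat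
  else 0

theorem tr_of_lt (M : QRep k) {i j : ℤ} (h : j < i) : M.tr i j = 0 := by
  rw [tr, dif_neg (by omega)]

theorem tr_eq_trNat (M : QRep k) {i j : ℤ} (n : ℕ) (h : i + (n : ℤ) = j) :
    M.tr i j = M.castV h ∘ₗ M.trNat i n := by
  have hn : n = (j - i).toNat := by omega
  subst hn
  rw [tr, dif_pos (by omega)]

@[simp] theorem tr_self (M : QRep k) (i : ℤ) : M.tr i i = LinearMap.id := by
  rw [tr_eq_trNat M 0 (by simp), trNat]
  have : ∀ j (h : i = j) (h' : j = i), M.castV h' ∘ₗ M.castV h = LinearMap.id := by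
    rintro j rfl h'; rfl
  exact this _ _ _

theorem tr_succ (M : QRep k) {i j : ℤ} (h : i ≤ j) : M.tr i (j + 1) = M.f j ∘ₗ M.tr i j := by
  obtain ⟨n, rfl⟩ := Int.le.dest h
  rw [tr_eq_trNat M (n + 1) (by push_cast; ring), tr_eq_trNat M n rfl, trNat]
  have : ∀ a b (h : a = b) (h' : b = a) (g : M.V i →ₗ[k] M.V a),
      M.castV h' ∘ₗ M.castV h ∘ₗ g = g := by
    rintro a b rfl h' g; rfl
  exact this _ _ _ _ _

theorem f_eq_tr (M : QRep k) (i : ℤ) : M.f i = M.tr i (i + 1) := by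
  rw [tr_succ M le_rfl, tr_self, LinearMap.comp_id]

theorem tr_comp (M : QRep k) {a b c : ℤ} (hab : a ≤ b) (hbc : b ≤ c) :
    M.tr b c ∘ₗ M.tr a b = M.tr a c := by
  induction c, hbc using Int.leInduction with
  | base => rw [tr_self, LinearMap.id_comp]
  | succ c hbc ih => rw [tr_succ M hbc, tr_succ M (hab.trans hbc), LinearMap.comp_assoc, ih]

theorem tr_tr (M : QRep k) {a b c : ℤ} (hab : a ≤ b) (hbc : b ≤ c) (x : M.V a) :
    M.tr b c (M.tr a b x) = M.tr a c x := LinearMap.congr_fun (M.tr_comp hab hbc) x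

theorem tr_pred (M : QRep k) {i j : ℤ} (h : i + 1 ≤ j) (x : M.V i) :
    M.tr (i + 1) j (M.f i x) = M.tr i j x := by
  rw [f_eq_tr, tr_tr M (by omega) h]

theorem tr_succ_apply (M : QRep k) {i j : ℤ} (h : i ≤ j) (x : M.V i) :
    M.tr i (j + 1) x = M.f j (M.tr i j x) := by rw [tr_succ M h]; rfl

theorem map_tr {M N : QRep k} (g : ∀ i, M.V i →ₗ[k] N.V i)
    (hg : ∀ i x, g (i + 1) (M.f i x) = N.f i (g i x)) (i j : ℤ) (x : M.V i) :
    g j (M.tr i j x) = N.tr i j (g i x) := by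
  by_cases h : i ≤ j
  · induction j, h using Int.leInduction with
    | base => simp
    | succ j h ih => rw [tr_succ_apply M h, tr_succ_apply N h, hg, ih]
  · rw [tr_of_lt M (by omega), tr_of_lt N (by omega)]; simp

/-- The rank of the map `V i → V j`. -/
def rank (M : QRep k) (i j : ℤ) : ℕ := Module.finrank k (LinearMap.range (M.tr i j))

theorem rank_self (M : QRep k) (i : ℤ) : M.rank i i = Module.finrank k (M.V i) := by
  rw [rank, tr_self, LinearMap.range_id, finrank_top]

/-! ### Isomorphisms -/

theorem Iso.refl (M : QRep k) : M.Iso M := ⟨fun _ => LinearEquiv.refl _ _, fun _ _ => rfl⟩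

theorem Iso.symm {M N : QRep k} (h : M.Iso N) : N.Iso M := by
  obtain ⟨e, he⟩ := h
  refine ⟨fun i => (e i).symm, fun i x => ?_⟩
  rw [LinearEquiv.symm_apply_eq, he, LinearEquiv.apply_symm_apply]

theorem Iso.trans {M N P : QRep k} (h : M.Iso N) (h' : N.Iso P) : M.Iso P := by
  obtain ⟨e, he⟩ := h
  obtain ⟨e', he'⟩ := h'
  refine ⟨fun i => (e i).trans (e' i), fun i x => ?_⟩
  simp [he, he']

theorem Iso.rank_eq {M N : QRep k} (h : M.Iso N) (i j : ℤ) : M.rank i j = N.rank i j := by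
  obtain ⟨e, he⟩ := h
  have h1 : (e j : M.V j →ₗ[k] N.V j) ∘ₗ M.tr i j = N.tr i j ∘ₗ (e i : M.V i →ₗ[k] N.V i) := by
    ext x
    exact map_tr (fun i => (e i : M.V i →ₗ[k] N.V i)) he i j x
  have h2 : (LinearMap.range (M.tr i j)).map (e j : M.V j →ₗ[k] N.V j) =
      LinearMap.range (N.tr i j) := by
    rw [← LinearMap.range_comp, h1, LinearMap.range_comp_of_range_eq_top]
    exact LinearEquiv.range _
  rw [rank, rank, ← h2]
  exact (LinearEquiv.finrank_map_eq (e j) _).symm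

/-! ### Subrepresentations and quotients -/

theorem Sub.ext {M : QRep k} {U U' : Sub M} (h : ∀ i, U.carrier i = U'.carrier i) :
    U = U' := by
  cases U; cases U'
  congr
  exact funext h

/-- The inclusion of a subrepresentation. -/
def Sub.incl {M : QRep k} (U : Sub M) (i : ℤ) : U.toRep.V i →ₗ[k] M.V i := (U.carrier i).subtype

theorem Sub.incl_injective {M : QRep k} (U : Sub M) (i : ℤ) : Function.Injective (U.incl i) :=
  Subtype.val_injective

theorem Sub.range_incl {M : QRep k} (U : Sub M) (i : ℤ) :
    LinearMap.range (U.incl i) = U.carrier i :=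
  Submodule.range_subtype _

/-- The projection onto the quotient by a subrepresentation. -/
def Sub.proj {M : QRep k} (U : Sub M) (i : ℤ) : M.V i →ₗ[k] U.quotient.V i := (U.carrier i).mkQ

theorem Sub.proj_surjective {M : QRep k} (U : Sub M) (i : ℤ) : Function.Surjective (U.proj i) :=
  Submodule.mkQ_surjective _

theorem Sub.ker_proj {M : QRep k} (U : Sub M) (i : ℤ) :
    LinearMap.ker (U.proj i) = U.carrier i :=
  Submodule.ker_mkQ _

theorem Sub.incl_tr {M : QRep k} (U : Sub M) (i j : ℤ) (x : U.toRep.V i) :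
    U.incl j (U.toRep.tr i j x) = M.tr i j (U.incl i x) :=
  map_tr U.incl (fun _ _ => rfl) i j x

theorem Sub.proj_tr {M : QRep k} (U : Sub M) (i j : ℤ) (x : M.V i) :
    U.proj j (M.tr i j x) = U.quotient.tr i j (U.proj i x) :=
  map_tr U.proj (fun _ _ => rfl) i j x

theorem Sub.map_incl_range_tr {M : QRep k} (U : Sub M) (i j : ℤ) :
    (LinearMap.range (U.toRep.tr i j)).map (U.incl j) = (U.carrier i).map (M.tr i j) := by
  rw [← LinearMap.range_comp, ← U.range_incl i, ← LinearMap.range_comp]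
  congr 1
  ext x
  exact U.incl_tr i j x

theorem Sub.map_proj_range_tr {M : QRep k} (U : Sub M) (i j : ℤ) :
    (LinearMap.range (M.tr i j)).map (U.proj j) = LinearMap.range (U.quotient.tr i j) := by
  have : U.proj j ∘ₗ M.tr i j = U.quotient.tr i j ∘ₗ U.proj i := by
    ext x
    exact U.proj_tr i j x
  rw [← LinearMap.range_comp, this, LinearMap.range_comp_of_range_eq_top]
  exact LinearMap.range_eq_top.mpr (U.proj_surjective i)

theorem Sub.tr_mem {M : QRep k} (U : Sub M) (i j : ℤ) {x : M.V i} (hx : x ∈ U.carrier i) :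
    M.tr i j x ∈ U.carrier j := by
  rw [← U.range_incl] at hx ⊢
  obtain ⟨x, rfl⟩ := hx
  exact ⟨_, U.incl_tr i j x⟩

theorem Sub.rank_toRep {M : QRep k} (U : Sub M) (i j : ℤ) :
    U.toRep.rank i j = Module.finrank k ((U.carrier i).map (M.tr i j)) := by
  rw [rank, ← U.map_incl_range_tr]
  exact (Submodule.equivMapOfInjective _ (U.incl_injective j) _).finrank_eq

theorem Sub.rank_quotient {M : QRep k} (U : Sub M) (i j : ℤ) [FiniteDimensional k (M.V j)] :
    U.quotient.rank i j + Module.finrank k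
      (LinearMap.range (M.tr i j) ⊓ U.carrier j : Submodule k (M.V j)) = M.rank i j := by
  rw [rank, rank, ← finrank_map_add_finrank_inf_ker (U.proj j) (LinearMap.range (M.tr i j)),
    U.ker_proj, U.map_proj_range_tr]

theorem Sub.isFiniteDim_toRep {M : QRep k} (U : Sub M) (hM : M.IsFiniteDim) :
    U.toRep.IsFiniteDim := by
  refine ⟨fun i => ?_, hM.2.subset fun i hi => ?_⟩
  · have := hM.1 i
    exact inferInstanceAs (FiniteDimensional k (U.carrier i))
  · have : Nontrivial (U.carrier i) := hi
    exact (U.carrier i).subtype_injective.nontrivial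

theorem Sub.isFiniteDim_quotient {M : QRep k} (U : Sub M) (hM : M.IsFiniteDim) :
    U.quotient.IsFiniteDim := by
  refine ⟨fun i => ?_, hM.2.subset fun i hi => ?_⟩
  · have := hM.1 i
    exact inferInstanceAs (FiniteDimensional k (M.V i ⧸ U.carrier i))
  · have : Nontrivial (M.V i ⧸ U.carrier i) := hi
    exact (U.carrier i).mkQ_surjective.nontrivial

/-! ### Direct sums of segments -/

/-- The projections of a direct sum. -/
def component {ι : Type} (M : ι → QRep k) (x : ι) (i : ℤ) : (directSum M).V i →ₗ[k] (M x).V i :=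
  DirectSum.component k ι (fun x => (M x).V i) x

theorem component_ext {ι : Type} {M : ι → QRep k} {i : ℤ} {a b : (directSum M).V i}
    (h : ∀ x, component M x i a = component M x i b) : a = b :=
  DFinsupp.ext h

theorem component_tr {ι : Type} (M : ι → QRep k) (i j : ℤ) (a : (directSum M).V i) (x : ι) :
    component M x j ((directSum M).tr i j a) = (M x).tr i j (component M x i a) :=
  map_tr (component M x) (fun _ _ => rfl) i j a

theorem _root_.FockHall.finrank_range_lmap {ι : Type} [Fintype ι] {A B : ι → Type u}
    [∀ x, AddCommGroup (A x)] [∀ x, Module k (A x)] [∀ x, AddCommGroup (B x)]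
    [∀ x, Module k (B x)] [∀ x, FiniteDimensional k (B x)] (g : ∀ x, A x →ₗ[k] B x) :
    Module.finrank k (LinearMap.range (DirectSum.lmap g)) =
      ∑ x, Module.finrank k (LinearMap.range (g x)) := by
  have h1 : DirectSum.lmap g = DirectSum.lmap (fun x => (LinearMap.range (g x)).subtype) ∘ₗ
      DirectSum.lmap (fun x => (g x).rangeRestrict) := by
    rw [← DirectSum.lmap_comp]; rfl
  rw [h1, LinearMap.range_comp_of_range_eq_top, LinearMap.finrank_range_of_inj,
    Module.finrank_directSum]
  · rw [DirectSum.lmap_injective]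
    exact fun x => Subtype.val_injective
  · rw [LinearMap.range_eq_top, DirectSum.lmap_surjective]
    exact fun x => LinearMap.surjective_rangeRestrict _

theorem rank_directSum {ι : Type} [Fintype ι] (M : ι → QRep k) (i j : ℤ)
    [∀ x, FiniteDimensional k ((M x).V j)] :
    (directSum M).rank i j = ∑ x, (M x).rank i j := by
  have : (directSum M).tr i j = DirectSum.lmap fun x => (M x).tr i j := by
    refine LinearMap.ext fun a => component_ext fun x => ?_
    exact component_tr M i j a x
  unfold rank
  rw [this]
  exact finrank_range_lmap (fun x => (M x).tr i j)

/-- The coordinate of a vector of `S_i[l]` at the vertex `a`. -/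
def segCoord (i : ℤ) (l : ℕ+) (a : ℤ) : (segment k i l).V a →ₗ[k] k where
  toFun := fun x : {_x : Unit // i ≤ a ∧ a < i + (l : ℕ)} → k =>
    if h : i ≤ a ∧ a < i + (l : ℕ) then x ⟨(), h⟩ else 0
  map_add' x y := by
    split_ifs
    · rfl
    · simp
  map_smul' c x := by
    split_ifs
    · rfl
    · simp

/-- The vector of `S_i[l]` at the vertex `a` with a given coordinate. -/
def segVec (i : ℤ) (l : ℕ+) (a : ℤ) : k →ₗ[k] (segment k i l).V a :=
  (LinearMap.pi fun _ => LinearMap.id : k →ₗ[k] ({_x : Unit // i ≤ a ∧ a < i + (l : ℕ)} → k))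

theorem segCoord_segVec (i : ℤ) (l : ℕ+) (a : ℤ) (c : k) :
    segCoord i l a (segVec i l a c) = if i ≤ a ∧ a < i + (l : ℕ) then c else 0 := rfl

theorem segCoord_injective (i : ℤ) (l : ℕ+) (a : ℤ) :
    Function.Injective (segCoord (k := k) i l a) := by
  intro x y h
  refine funext fun z => ?_
  have hz := z.2
  change (if h : i ≤ a ∧ a < i + (l : ℕ) then _ else _) =
    (if h : i ≤ a ∧ a < i + (l : ℕ) then _ else _) at h
  rwa [dif_pos hz, dif_pos hz] at h

theorem segCoord_of_not {i : ℤ} {l : ℕ+} {a : ℤ} (h : ¬ (i ≤ a ∧ a < i + (l : ℕ)))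
    (x : (segment k i l).V a) : segCoord i l a x = 0 := dif_neg h

theorem segCoord_tr (i : ℤ) (l : ℕ+) {a b : ℤ} (hab : a ≤ b) (x : (segment k i l).V a) :
    segCoord i l b ((segment k i l).tr a b x) =
      if b < i + (l : ℕ) then segCoord i l a x else 0 := by
  induction b, hab using Int.leInduction with
  | base =>
    rw [tr_self]
    split_ifs with h
    · rfl
    · rw [LinearMap.id_apply, segCoord_of_not (by omega)]
  | succ b hab ih =>
    rw [tr_succ_apply _ hab]
    have : ∀ y : (segment k i l).V b, segCoord i l (b + 1) ((segment k i l).f b y) =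
        if i ≤ b + 1 ∧ b + 1 < i + (l : ℕ) then segCoord i l b y else 0 := fun _ => rfl
    rw [this, ih]
    by_cases h1 : b + 1 < i + (l : ℕ)
    · rw [if_pos h1, if_pos (show b < i + (l : ℕ) by omega)]
      by_cases h2 : i ≤ a
      · rw [if_pos (by omega)]
      · rw [segCoord_of_not (by omega)]
        simp
    · rw [if_neg h1, if_neg (by omega)]

instance (i : ℤ) (l : ℕ+) (a : ℤ) : FiniteDimensional k ((segment k i l).V a) :=
  inferInstanceAs (FiniteDimensional k ({_x : Unit // i ≤ a ∧ a < i + (l : ℕ)} → k))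

theorem rank_segment (i : ℤ) (l : ℕ+) {a b : ℤ} (hab : a ≤ b) :
    (segment k i l).rank a b = if i ≤ a ∧ b < i + (l : ℕ) then 1 else 0 := by
  have hr : (segment k i l).rank a b = Module.finrank k
      (LinearMap.range (segCoord i l b ∘ₗ (segment k i l).tr a b)) := by
    rw [LinearMap.range_comp]
    exact (Submodule.equivMapOfInjective _ (segCoord_injective i l b) _).finrank_eq
  rw [hr]
  split_ifs with h
  · have : LinearMap.range (segCoord (k := k) i l b ∘ₗ (segment k i l).tr a b) = ⊤ := by
      rw [LinearMap.range_eq_top]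
      intro c
      refine ⟨segVec i l a c, ?_⟩
      rw [LinearMap.comp_apply, segCoord_tr i l hab, segCoord_segVec, if_pos h.2,
        if_pos (by omega)]
    rw [this, finrank_top, Module.finrank_self]
  · have : segCoord (k := k) i l b ∘ₗ (segment k i l).tr a b = 0 := by
      refine LinearMap.ext fun x => ?_
      rw [LinearMap.comp_apply, segCoord_tr i l hab, LinearMap.zero_apply]
      split_ifs
      · exact segCoord_of_not (by omega) x
      · rfl
    rw [this, LinearMap.range_zero, finrank_bot]

end QRep

open QRep

instance sigmaFintype (m : Multisegment) : Fintype (Σ p : ℤ × ℕ+, Fin (m p)) :=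
  ⟨m.support.sigma fun _ => Finset.univ, fun x => by
    have := x.2.pos
    simp
    omega⟩

theorem sum_sigma_eq_wt (m : Multisegment) (g : ℤ × ℕ+ → ℕ) :
    ∑ x : (Σ p : ℤ × ℕ+, Fin (m p)), g x.1 = wt g m := by
  change ∑ x ∈ m.support.sigma fun _ => Finset.univ, g x.1 = _
  rw [Finset.sum_sigma]
  simp [wt, Finsupp.sum]

theorem rank_repOf (m : Multisegment) {i j : ℤ} (hij : i ≤ j) :
    (repOf k m).rank i j = rk m i j := by
  rw [repOf, QRep.rank_directSum]
  simp_rw [rank_segment _ _ hij]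
  exact sum_sigma_eq_wt m fun p => if p.1 ≤ i ∧ j < p.1 + (p.2 : ℕ) then 1 else 0

theorem finrank_repOf (m : Multisegment) (i : ℤ) :
    Module.finrank k ((repOf k m).V i) = rk m i i := by
  rw [← rank_repOf (k := k) m le_rfl, rank_self]

instance finiteDimensional_repOf (m : Multisegment) (i : ℤ) :
    FiniteDimensional k ((repOf k m).V i) :=
  inferInstanceAs (FiniteDimensional k (DirectSum (Σ p : ℤ × ℕ+, Fin (m p))
    fun x => (segment k x.1.1 x.1.2).V i))

theorem isFiniteDim_repOf (m : Multisegment) : (repOf k m).IsFiniteDim := by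
  refine ⟨fun i => inferInstance, (dimVec m).support.finite_toSet.subset fun i hi => ?_⟩
  have : Nontrivial ((repOf k m).V i) := hi
  rw [Finset.mem_coe, Finsupp.mem_support_iff, dimVec_apply, ← finrank_repOf (k := k)]
  exact Module.finrank_pos.ne'

/-- A multisegment is determined by the isomorphism class of its representation. -/
theorem eq_of_iso_repOf {m m' : Multisegment} (h : (repOf k m).Iso (repOf k m')) : m = m' :=
  eq_of_rk_eq fun i j hij => by
    rw [← rank_repOf (k := k) m hij, h.rank_eq, rank_repOf _ hij]

open QRep

/-! ### Classification of the finite dimensional representations -/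

namespace QRep

theorem directSum_reindex {ι κ : Type} (e : ι ≃ κ) (M : ι → QRep k) :
    (directSum M).Iso (directSum fun y => M (e.symm y)) :=
  ⟨fun i => DirectSum.lequivCongrLeft k (M := fun x => (M x).V i) e,
    fun _ _ => DFinsupp.ext fun _ => rfl⟩

/-- A representation with a splitting `V j = k ⊕ C j` along a segment is a direct sum. -/
theorem iso_directSum_option {ι : Type} {M C : QRep k} (s : Option ι → ℤ × ℕ+)
    (e : ∀ j, M.V j ≃ₗ[k] (segment k (s none).1 (s none).2).V j × C.V j)
    (he : ∀ j x, e (j + 1) (M.f j x) =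
      ((segment k (s none).1 (s none).2).f j (e j x).1, C.f j (e j x).2))
    (hC : C.Iso (directSum fun x => segment k (s (some x)).1 (s (some x)).2)) :
    M.Iso (directSum fun x => segment k (s x).1 (s x).2) := by
  obtain ⟨e', he'⟩ := hC
  let E : ∀ j, (directSum fun x => segment k (s x).1 (s x).2).V j ≃ₗ[k]
      (segment k (s none).1 (s none).2).V j ×
        (directSum fun x => segment k (s (some x)).1 (s (some x)).2).V j :=
    fun j => DirectSum.lequivProdDirectSum k (α := fun x => (segment k (s x).1 (s x).2).V j)
  have hE : ∀ j y, E (j + 1) ((directSum fun x => segment k (s x).1 (s x).2).f j y) =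
      ((segment k (s none).1 (s none).2).f j (E j y).1,
        (directSum fun x => segment k (s (some x)).1 (s (some x)).2).f j (E j y).2) := by
    intro j y
    refine Prod.ext rfl (DFinsupp.ext fun x => rfl)
  refine ⟨fun j => ((e j).trans ((LinearEquiv.refl k _).prodCongr (e' j))).trans (E j).symm,
    fun j x => ?_⟩
  simp only [LinearEquiv.trans_apply]
  rw [LinearEquiv.symm_apply_eq, hE, LinearEquiv.apply_symm_apply, he]
  simp [he']

/-- A vector `x` at the lowest vertex `i` of the support, which generates a subrepresentation
`S_i[l]`, and a functional `φ` on `V (i + l - 1)` with value one on its last nonzero image split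
off this subrepresentation: the kernels of the pulled back functionals are a complement. -/
theorem exists_split (M : QRep k) {i e : ℤ} (hie : i ≤ e) (l : ℕ+) (hl : i + (l : ℕ) = e + 1)
    (hi : ∀ j < i, Subsingleton (M.V j)) (x : M.V i) (hx : M.tr i (e + 1) x = 0)
    (φ : Module.Dual k (M.V e)) (hφ : φ (M.tr i e x) = 1) :
    ∃ (U : Sub M) (E : ∀ j, M.V j ≃ₗ[k] (segment k i l).V j × U.toRep.V j),
      (∀ j y, E (j + 1) (M.f j y) = ((segment k i l).f j (E j y).1, U.toRep.f j (E j y).2)) ∧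
      x ∉ U.carrier i := by
  let U : Sub M :=
    { carrier := fun j => LinearMap.ker (φ ∘ₗ M.tr j e)
      map_mem := fun j y hy => by
        rw [LinearMap.mem_ker, LinearMap.comp_apply] at hy ⊢
        by_cases h : j + 1 ≤ e
        · rw [tr_pred M h, hy]
        · rw [tr_of_lt M (by omega)]; simp }
  have hlate : ∀ j, e + 1 ≤ j → M.tr i j x = 0 := fun j hj => by
    rw [← tr_tr M (by omega) hj, hx, map_zero]
  have hin : ∀ j, (i ≤ j ∧ j < i + (l : ℕ)) → φ (M.tr j e (M.tr i j x)) = 1 := fun j hj => by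
    rw [tr_tr M hj.1 (by omega), hφ]
  have hout : ∀ j, ¬ (i ≤ j ∧ j < i + (l : ℕ)) → ∀ y, φ (M.tr j e y) = 0 := fun j hj y => by
    by_cases h : j < i
    · have := hi j h
      rw [Subsingleton.elim y 0]; simp
    · rw [tr_of_lt M (by omega)]; simp
  let E : ∀ j, M.V j ≃ₗ[k] (segment k i l).V j × U.toRep.V j := fun j =>
    { toFun := fun y => (segVec i l j (φ (M.tr j e y)),
        (⟨y - φ (M.tr j e y) • M.tr i j x, by
          change φ (M.tr j e _) = 0
          by_cases h : i ≤ j ∧ j < i + (l : ℕ)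
          · rw [map_sub, map_sub, map_smul, map_smul, hin j h]; simp
          · exact hout j h _⟩ : U.carrier j))
      map_add' := fun y z => by
        refine Prod.ext (by simp) (Subtype.ext ?_)
        change _ = (y - φ (M.tr j e y) • M.tr i j x) + (z - φ (M.tr j e z) • M.tr i j x)
        simp only [map_add, add_smul]
        abel
      map_smul' := fun c y => by
        refine Prod.ext (by simp only [map_smul, smul_eq_mul]; exact map_smul (segVec i l j) _ _)
          (Subtype.ext ?_)
        change _ = c • (y - φ (M.tr j e y) • M.tr i j x)
        simp [smul_sub, mul_smul]
      invFun := fun z => segCoord i l j z.1 • M.tr i j x + U.incl j z.2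
      left_inv := fun y => by
        change segCoord i l j (segVec i l j (φ (M.tr j e y))) • M.tr i j x +
          (y - φ (M.tr j e y) • M.tr i j x) = y
        rw [segCoord_segVec]
        split_ifs with h
        · abel
        · rw [hout j h]; simp
      right_inv := fun z => by
        obtain ⟨a, b⟩ := z
        have hb : φ (M.tr j e (U.incl j b)) = 0 := (b : U.carrier j).2
        have ha : φ (M.tr j e (segCoord i l j a • M.tr i j x + U.incl j b)) = segCoord i l j a := by
          rw [map_add, map_add, hb, add_zero, map_smul, map_smul, smul_eq_mul]
          by_cases h : i ≤ j ∧ j < i + (l : ℕ)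
          · rw [hin j h, mul_one]
          · rw [segCoord_of_not h, zero_mul]
        refine Prod.ext (segCoord_injective i l j ?_) (U.incl_injective j ?_)
        · change segCoord i l j (segVec i l j (φ (M.tr j e _))) = segCoord i l j a
          rw [ha, segCoord_segVec]
          split_ifs with h
          · rfl
          · exact (segCoord_of_not h a).symm
        · change _ - φ (M.tr j e _) • M.tr i j x = U.incl j b
          rw [ha]
          exact add_sub_cancel_left _ _ }
  refine ⟨U, E, fun j y => ?_, ?_⟩
  · refine Prod.ext (segCoord_injective i l (j + 1) ?_) (U.incl_injective (j + 1) ?_)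
    · change segCoord i l (j + 1) (segVec i l (j + 1) (φ (M.tr (j + 1) e (M.f j y)))) =
        segCoord i l (j + 1) ((segment k i l).f j (segVec i l j (φ (M.tr j e y))))
      rw [f_eq_tr (segment k i l), segCoord_tr i l (by omega), segCoord_segVec, segCoord_segVec]
      by_cases h1 : j + 1 < i + (l : ℕ)
      · rw [if_pos h1, tr_pred M (by omega)]
        by_cases h2 : i ≤ j
        · rw [if_pos (by omega), if_pos (by omega)]
        · rw [hout j (by omega)]; simp
      · rw [if_neg (by omega), if_neg h1]
    · change M.f j y - φ (M.tr (j + 1) e (M.f j y)) • M.tr i (j + 1) x =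
        M.f j (y - φ (M.tr j e y) • M.tr i j x)
      by_cases h2 : i ≤ j
      · rw [tr_succ_apply M h2, map_sub, map_smul]
        by_cases h1 : j + 1 ≤ e
        · rw [tr_pred M h1]
        · rw [← tr_succ_apply M h2, hlate (j + 1) (by omega)]; simp
      · have := hi j (by omega)
        rw [Subsingleton.elim y 0]; simp
  · change ¬ φ (M.tr i e x) = 0
    rw [hφ]
    exact one_ne_zero

open Classical in
theorem exists_iso_directSum_segment : ∀ (n : ℕ) (M : QRep k) (S : Finset ℤ),
    (∀ i, FiniteDimensional k (M.V i)) → (∀ i ∉ S, Subsingleton (M.V i)) →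
    ∑ i ∈ S, Module.finrank k (M.V i) = n →
    ∃ (ι : Type) (_ : Finite ι) (s : ι → ℤ × ℕ+),
      M.Iso (directSum fun x => segment k (s x).1 (s x).2) := by
  intro n
  induction n using Nat.strong_induction_on with
  | _ n ih =>
  intro M S hfd hS hn
  by_cases htriv : ∀ i, Subsingleton (M.V i)
  · refine ⟨Empty, inferInstance, Empty.elim, fun i => ?_, fun i x => ?_⟩
    · have := htriv i
      have : Subsingleton ((directSum fun x : Empty => segment k (Empty.elim x : ℤ × ℕ+).1
          (Empty.elim x : ℤ × ℕ+).2).V i) := ⟨fun a b => component_ext fun x => x.elim⟩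
      exact
        { toFun := fun _ => 0, invFun := fun _ => 0, map_add' := by simp, map_smul' := by simp,
          left_inv := fun _ => Subsingleton.elim _ _, right_inv := fun _ => Subsingleton.elim _ _ }
    · exact component_ext fun x => x.elim
  push Not at htriv
  obtain ⟨i0, hi0⟩ := htriv
  have hne : (S.filter fun i => Nontrivial (M.V i)).Nonempty := by
    refine ⟨i0, Finset.mem_filter.mpr ⟨by_contra fun h => ?_, hi0⟩⟩
    exact not_subsingleton (M.V i0) (hS i0 h)
  obtain ⟨i, hi, hmin⟩ := Finset.exists_minimal hne
  rw [Finset.mem_filter] at hi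
  obtain ⟨hiS, hnt⟩ := hi
  have hlow : ∀ j < i, Subsingleton (M.V j) := fun j hj => by
    by_contra h
    rw [not_subsingleton_iff_nontrivial] at h
    have hjS : j ∈ S := by
      by_contra h'
      exact not_subsingleton (M.V j) (hS j h')
    have := hmin (Finset.mem_filter.mpr ⟨hjS, h⟩) hj.le
    omega
  obtain ⟨x, hx⟩ := exists_ne (0 : M.V i)
  have hex : ∃ m : ℕ, M.tr i (i + m) x = 0 := by
    obtain ⟨B, hB⟩ := S.bddAbove
    refine ⟨(B + 1 - i).toNat, ?_⟩
    have : Subsingleton (M.V (i + ((B + 1 - i).toNat : ℤ))) := hS _ fun h => by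
      have := hB (Finset.mem_coe.mpr h)
      omega
    exact Subsingleton.elim _ _
  classical
  obtain ⟨L, hL, hLmin⟩ : ∃ L : ℕ, M.tr i (i + L) x = 0 ∧ ∀ m < L, M.tr i (i + m) x ≠ 0 :=
    ⟨Nat.find hex, Nat.find_spec hex, fun m hm => Nat.find_min hex hm⟩
  have hL0 : L ≠ 0 := by
    rintro rfl
    have : ∀ j, i = j → M.tr i j x = 0 → x = 0 := by rintro j rfl h; simpa using h
    exact hx (this _ (by simp) hL)
  obtain ⟨L, rfl⟩ := Nat.exists_eq_succ_of_ne_zero hL0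
  have hne : M.tr i (i + L) x ≠ 0 := hLmin L (Nat.lt_succ_self L)
  have hL : M.tr i (i + L + 1) x = 0 := by
    rw [show i + (L : ℤ) + 1 = i + ((L.succ : ℕ) : ℤ) by push_cast; ring]; exact hL
  obtain ⟨φ, hφ⟩ := Module.Projective.exists_dual_ne_zero k hne
  obtain ⟨U, E, hE, hxU⟩ := exists_split M (by omega) L.succPNat (by simp; ring) hlow x hL
    ((φ (M.tr i (i + L) x))⁻¹ • φ) (by simp [hφ])
  have hlt : Module.finrank k (U.toRep.V i) < Module.finrank k (M.V i) := by
    refine Submodule.finrank_lt (s := U.carrier i) ?_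
    intro h
    exact hxU (h ▸ Submodule.mem_top)
  have hsum : ∑ i ∈ S, Module.finrank k (U.toRep.V i) < n := by
    rw [← hn]
    refine Finset.sum_lt_sum (fun j _ => ?_) ⟨i, hiS, hlt⟩
    exact Submodule.finrank_le (U.carrier j)
  obtain ⟨ι, hι, s, hs⟩ := ih _ hsum U.toRep S
    (fun j => inferInstanceAs (FiniteDimensional k (U.carrier j)))
    (fun j hj => by have := hS j hj; exact (U.incl_injective j).subsingleton) rfl
  exact ⟨Option ι, inferInstance, fun o => o.elim (i, L.succPNat) s,
    iso_directSum_option (fun o => o.elim (i, L.succPNat) s) E hE hs⟩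

end QRep

/-- Every finite dimensional representation is isomorphic to `M(m)` for some multisegment. -/
theorem exists_iso_repOf {M : QRep k} (hM : M.IsFiniteDim) : ∃ m, M.Iso (repOf k m) := by
  classical
  obtain ⟨ι, hι, s, hs⟩ := QRep.exists_iso_directSum_segment _ M hM.2.toFinset hM.1 (fun i hi => by
    rw [Set.Finite.mem_toFinset] at hi
    exact not_nontrivial_iff_subsingleton.mp hi) rfl
  have : Fintype ι := Fintype.ofFinite ι
  let m : Multisegment := ∑ x, Finsupp.single (s x) 1
  have hm : ∀ p, Fintype.card {x // s x = p} = m p := fun p => by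
    rw [Fintype.card_subtype]
    simp only [m, Finsupp.finsetSum_apply, Finsupp.single_apply, Finset.sum_boole, Nat.cast_id]
  let σ : ι ≃ Σ p : ℤ × ℕ+, Fin (m p) := (Equiv.sigmaFiberEquiv s).symm.trans
    (Equiv.sigmaCongrRight fun p => Fintype.equivFinOfCardEq (hm p))
  have hσ : (fun y => s (σ.symm y)) = fun y => y.1 := by
    funext y
    obtain ⟨x, rfl⟩ := σ.surjective y
    rw [Equiv.symm_apply_apply]
    rfl
  refine ⟨m, hs.trans ((QRep.directSum_reindex σ _).trans ?_)⟩
  have h2 : (fun y => QRep.segment k (s (σ.symm y)).1 (s (σ.symm y)).2) =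
      fun y => QRep.segment k y.1.1 y.1.2 := by
    funext y
    rw [← congrFun hσ y]
  rw [h2]
  exact QRep.Iso.refl _

/-- Finite dimensional representations with equal ranks are isomorphic. -/
theorem iso_repOf_iff {M : QRep k} (hM : M.IsFiniteDim) (m : Multisegment) :
    M.Iso (repOf k m) ↔ ∀ i j, i ≤ j → M.rank i j = rk m i j := by
  constructor
  · intro h i j hij
    rw [h.rank_eq, rank_repOf m hij]
  · intro h
    obtain ⟨m', hm'⟩ := exists_iso_repOf hM
    have : m' = m := eq_of_rk_eq fun i j hij => by
      rw [← rank_repOf (k := k) m' hij, ← hm'.rank_eq, h i j hij]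
    rwa [← this]

/-! ### Homomorphisms and degenerations -/

namespace QRep

theorem mem_Hom {M N : QRep k} {g : ∀ i, M.V i →ₗ[k] N.V i} :
    g ∈ Hom M N ↔ ∀ i x, g (i + 1) (M.f i x) = N.f i (g i x) :=
  forall_congr' fun _ => LinearMap.ext_iff

open Classical in
/-- The inclusions of the summands into a direct sum. -/
def inclusion {ι : Type} (M : ι → QRep k) (x : ι) (i : ℤ) : (M x).V i →ₗ[k] (directSum M).V i :=
  DirectSum.lof k ι (fun x => (M x).V i) x

theorem inclusion_f {ι : Type} (M : ι → QRep k) (x : ι) (i : ℤ) (a : (M x).V i) :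
    (directSum M).f i (inclusion M x i a) = inclusion M x (i + 1) ((M x).f i a) := by
  classical
  exact DirectSum.lmap_lof (fun x => (M x).f i) x a

open Classical in
/-- The linear map on a direct sum with given restrictions to the summands. -/
def descend {ι : Type} (M : ι → QRep k) (i : ℤ) {W : Type u} [AddCommGroup W] [Module k W]
    (g : ∀ x, (M x).V i →ₗ[k] W) : (directSum M).V i →ₗ[k] W :=
  DirectSum.toModule k ι W g

theorem descend_inclusion {ι : Type} (M : ι → QRep k) (i : ℤ) {W : Type u} [AddCommGroup W]
    [Module k W] (g : ∀ x, (M x).V i →ₗ[k] W) (x : ι) (a : (M x).V i) :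
    descend M i g (inclusion M x i a) = g x a := by
  classical
  exact DirectSum.toModule_lof (M := fun x => (M x).V i) (φ := g) k x a

theorem directSum_hom_ext {ι : Type} (M : ι → QRep k) (i : ℤ) {W : Type u} [AddCommGroup W]
    [Module k W] {g h : (directSum M).V i →ₗ[k] W}
    (H : ∀ x a, g (inclusion M x i a) = h (inclusion M x i a)) : g = h := by
  classical
  exact DirectSum.linearMap_ext k fun x => LinearMap.ext (H x)

/-- Homomorphisms from a direct sum. -/
def homDirectSum {ι : Type} (M : ι → QRep k) (X : QRep k) :
    Hom (directSum M) X ≃ₗ[k] ∀ x, Hom (M x) X where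
  toFun g x := ⟨fun i => g.1 i ∘ₗ inclusion M x i, mem_Hom.mpr fun i a => by
    simp only [LinearMap.comp_apply]
    rw [← inclusion_f, mem_Hom.mp g.2]⟩
  map_add' _ _ := rfl
  map_smul' _ _ := rfl
  invFun g := ⟨fun i => descend M i fun x => (g x).1 i, fun i => directSum_hom_ext M i fun x a => by
    simp only [LinearMap.comp_apply]
    rw [inclusion_f, descend_inclusion, descend_inclusion, mem_Hom.mp (g x).2]⟩
  left_inv g := Subtype.ext (funext fun i => directSum_hom_ext M i fun x a =>
    descend_inclusion M i _ x a)
  right_inv g := funext fun x => Subtype.ext (funext fun i => LinearMap.ext fun a =>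
    descend_inclusion M i (fun x => (g x).1 i) x a)

/-- Homomorphisms from `S_i[l]` are vectors at `i` killed by the map to the vertex `i + l`. -/
def homSegment (i : ℤ) (l : ℕ+) (X : QRep k) :
    Hom (segment k i l) X ≃ₗ[k] LinearMap.ker (X.tr i (i + (l : ℕ))) where
  toFun g := ⟨g.1 i (segVec i l i 1), by
    rw [LinearMap.mem_ker, ← map_tr g.1 (mem_Hom.mp g.2)]
    have : (segment k i l).tr i (i + (l : ℕ)) (segVec i l i 1) = 0 := by
      refine segCoord_injective i l _ ?_
      rw [segCoord_tr i l (by omega), if_neg (by omega), map_zero]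
    rw [this, map_zero]⟩
  map_add' _ _ := rfl
  map_smul' _ _ := rfl
  invFun x := ⟨fun j => (segCoord i l j).smulRight (X.tr i j x.1), mem_Hom.mpr fun j a => by
    simp only [LinearMap.smulRight_apply, map_smul]
    rw [f_eq_tr (segment k i l), segCoord_tr i l (by omega)]
    by_cases h : i ≤ j ∧ j < i + (l : ℕ)
    · rw [← tr_succ_apply X h.1]
      split_ifs with h2
      · rfl
      · have h3 : j + 1 = i + (l : ℕ) := by omega
        rw [h3, LinearMap.mem_ker.mp x.2]; simp
    · rw [segCoord_of_not h]; simp⟩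
  left_inv g := by
    refine Subtype.ext (funext fun j => LinearMap.ext fun a => ?_)
    change segCoord i l j a • X.tr i j (g.1 i (segVec i l i 1)) = g.1 j a
    rw [← map_tr g.1 (mem_Hom.mp g.2), ← map_smul]
    congr 1
    refine segCoord_injective i l j ?_
    rw [map_smul, smul_eq_mul]
    by_cases h : i ≤ j ∧ j < i + (l : ℕ)
    · rw [segCoord_tr i l h.1, segCoord_segVec, if_pos h.2, if_pos, mul_one]
      have := l.pos
      omega
    · rw [segCoord_of_not h, zero_mul]
  right_inv x := by
    refine Subtype.ext ?_
    change segCoord i l i (segVec i l i (1 : k)) • X.tr i i x.1 = x.1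
    have := l.pos
    rw [segCoord_segVec, if_pos (by omega), one_smul, tr_self]; rfl

end QRep

/-- `dim Hom(M(m), X)` as a sum of dimensions of kernels. -/
theorem finrank_hom_repOf (m : Multisegment) (X : QRep k) (hX : X.IsFiniteDim) :
    Module.finrank k (QRep.Hom (repOf k m) X) =
      wt (fun p => Module.finrank k (LinearMap.ker (X.tr p.1 (p.1 + (p.2 : ℕ))))) m := by
  have := hX.1
  rw [repOf, (QRep.homDirectSum _ X).finrank_eq]
  have : ∀ x : (Σ p : ℤ × ℕ+, Fin (m p)),
      FiniteDimensional k (QRep.Hom (QRep.segment k x.1.1 x.1.2) X) := fun x =>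
    (QRep.homSegment x.1.1 x.1.2 X).symm.finiteDimensional
  rw [Module.finrank_pi_fintype]
  simp_rw [(QRep.homSegment _ _ X).finrank_eq]
  exact sum_sigma_eq_wt m fun p => Module.finrank k (LinearMap.ker (X.tr p.1 (p.1 + (p.2 : ℕ))))

theorem finrank_ker_tr_repOf (m : Multisegment) {i j : ℤ} (hij : i ≤ j) :
    rk m i j + Module.finrank k (LinearMap.ker ((repOf k m).tr i j)) = rk m i i := by
  rw [← rank_repOf (k := k) m hij, ← finrank_repOf (k := k)]
  exact LinearMap.finrank_range_add_finrank_ker _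

/-- The dimension of `End M(m)`. -/
theorem finrank_end_repOf (m : Multisegment) :
    Module.finrank k (QRep.Hom (repOf k m) (repOf k m)) =
      wt (fun p => rk m p.1 p.1 - rk m p.1 (p.1 + (p.2 : ℕ))) m := by
  rw [finrank_hom_repOf m _ (isFiniteDim_repOf m)]
  congr 1
  funext p
  have := finrank_ker_tr_repOf (k := k) m (show p.1 ≤ p.1 + (p.2 : ℕ) by omega)
  omega

open QRep

theorem wt_congr {g h : ℤ × ℕ+ → ℕ} {m : Multisegment} (H : ∀ p, m p ≠ 0 → g p = h p) :
    wt g m = wt h m :=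
  Finset.sum_congr rfl fun p hp => by
    change m p * g p = m p * h p
    rw [H p (Finsupp.mem_support_iff.mp hp)]

theorem wt_fun_sum {ι : Type*} (s : Finset ι) (g : ι → ℤ × ℕ+ → ℕ) (m : Multisegment) :
    wt (fun p => ∑ x ∈ s, g x p) m = ∑ x ∈ s, wt (g x) m := by
  simp only [wt, Finsupp.sum, Finset.mul_sum]
  exact Finset.sum_comm

theorem wt_fun_mul (c : ℕ) (g : ℤ × ℕ+ → ℕ) (m : Multisegment) :
    wt (fun p => g p * c) m = wt g m * c := by
  simp only [wt, Finsupp.sum, Finset.sum_mul, mul_assoc]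

theorem sum_Ico_int_telescope (F : ℤ → ℕ) {s j : ℤ} (hsj : s ≤ j)
    (hF : ∀ i, s ≤ i → i < j → F i ≤ F (i + 1)) :
    ∑ i ∈ Finset.Ico s j, (F (i + 1) - F i) + F s = F j := by
  induction j, hsj using Int.leInduction with
  | base => simp
  | succ j hsj ih =>
    have h : Finset.Ico s (j + 1) = insert j (Finset.Ico s j) := by
      ext x; simp only [Finset.mem_Ico, Finset.mem_insert]; omega
    rw [h, Finset.sum_insert (by simp)]
    have h1 := ih fun i h1 h2 => hF i h1 (by omega)
    have h2 := hF j hsj (by omega)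
    omega

/-- The dimension of the part of the image of `V i → V j` killed by `V j → V (j + 1)`. -/
theorem finrank_ker_tr_succ (X : QRep k) (hX : X.IsFiniteDim) {i j : ℤ} (hij : i ≤ j) :
    Module.finrank k (LinearMap.range (X.tr i j) ⊓ LinearMap.ker (X.f j) : Submodule k (X.V j)) +
      Module.finrank k (LinearMap.ker (X.tr i j)) =
    Module.finrank k (LinearMap.ker (X.tr i (j + 1))) := by
  have := hX.1
  rw [← finrank_map_add_finrank_inf_ker (X.tr i j) (LinearMap.ker (X.tr i (j + 1)))]
  have h1 : (LinearMap.ker (X.tr i (j + 1))).map (X.tr i j) =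
      LinearMap.range (X.tr i j) ⊓ LinearMap.ker (X.f j) := by
    ext y
    constructor
    · rintro ⟨x, hx, rfl⟩
      exact ⟨⟨x, rfl⟩, (tr_succ_apply X hij x).symm.trans hx⟩
    · rintro ⟨⟨x, rfl⟩, hy⟩
      exact ⟨x, (tr_succ_apply X hij x).trans hy, rfl⟩
  have h2 : LinearMap.ker (X.tr i (j + 1)) ⊓ LinearMap.ker (X.tr i j) =
      LinearMap.ker (X.tr i j) := by
    refine inf_eq_right.mpr ?_
    intro x hx
    rw [LinearMap.mem_ker] at hx ⊢
    rw [tr_succ_apply X hij, hx, map_zero]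
  rw [h1, h2]

/-- Larger ranks give smaller spaces of homomorphisms: summation by parts expresses
`dim Hom(M(m), X)` as a combination of ranks of `M(m)` with coefficients depending only on `X`,
and those of the ranks `V i → V j`, `i < j`, are nonpositive. -/
theorem finrank_hom_le_of_rk_le {m m' : Multisegment} (hd : ∀ i, rk m i i = rk m' i i)
    (hr : ∀ i j, i ≤ j → rk m i j ≤ rk m' i j) (X : QRep k) (hX : X.IsFiniteDim) :
    Module.finrank k (QRep.Hom (repOf k m') X) ≤ Module.finrank k (QRep.Hom (repOf k m) X) := by
  have := hX.1
  rw [finrank_hom_repOf _ X hX, finrank_hom_repOf _ X hX]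
  set κ : ℤ → ℤ → ℕ := fun i j => Module.finrank k (LinearMap.ker (X.tr i j)) with hκ
  set c : ℤ → ℤ → ℕ := fun i j => Module.finrank k
    (LinearMap.range (X.tr i j) ⊓ LinearMap.ker (X.f j) : Submodule k (X.V j)) with hc
  have hκc : ∀ i j, i ≤ j → c i j + κ i j = κ i (j + 1) := fun i j h =>
    finrank_ker_tr_succ X hX h
  have hκ0 : ∀ i, κ i i = 0 := fun i => by simp [hκ]
  have hcc : ∀ i j, i < j → c i j ≤ c (i + 1) j := fun i j h => by
    refine Submodule.finrank_mono (inf_le_inf_right _ ?_)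
    rintro _ ⟨x, rfl⟩
    exact ⟨X.f i x, tr_pred X (by omega) x⟩
  obtain ⟨a, ha⟩ := ((m.support ∪ m'.support).image Prod.fst).bddBelow
  obtain ⟨b, hb⟩ := ((m.support ∪ m'.support).image fun p => p.1 + ((p.2 : ℕ) : ℤ)).bddAbove
  have hpt : ∀ p : ℤ × ℕ+, a ≤ p.1 → p.1 + (p.2 : ℕ) ≤ b →
      κ p.1 (p.1 + (p.2 : ℕ)) + ∑ j ∈ Finset.Ico a b, ∑ i ∈ Finset.Ico a j,
        (if p.1 ≤ i ∧ j < p.1 + (p.2 : ℕ) then 1 else 0) * (c (i + 1) j - c i j) =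
      ∑ j ∈ Finset.Ico a b, (if p.1 ≤ j ∧ j < p.1 + (p.2 : ℕ) then 1 else 0) * c j j := by
    rintro ⟨s, l⟩ h1 h2
    simp only at h1 h2 ⊢
    have e1 : κ s (s + (l : ℕ)) = ∑ j ∈ Finset.Ico s (s + (l : ℕ)), c s j := by
      have h := sum_Ico_int_telescope (κ s) (s := s) (j := s + (l : ℕ)) (by omega)
        (fun i h1 _ => by have := hκc s i h1; omega)
      rw [hκ0, add_zero] at h
      rw [← h]
      refine Finset.sum_congr rfl fun j hj => ?_
      have := hκc s j (Finset.mem_Ico.mp hj).1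
      omega
    have e2 : ∀ G : ℤ → ℕ, ∑ j ∈ Finset.Ico a b, (if s ≤ j ∧ j < s + (l : ℕ) then 1 else 0) * G j =
        ∑ j ∈ Finset.Ico s (s + (l : ℕ)), G j := fun G => by
      simp only [ite_mul, one_mul, zero_mul]
      rw [← Finset.sum_filter]
      congr 1
      ext j; simp only [Finset.mem_filter, Finset.mem_Ico]; omega
    have e3 : ∀ j, ∑ i ∈ Finset.Ico a j,
        (if s ≤ i ∧ j < s + (l : ℕ) then 1 else 0) * (c (i + 1) j - c i j) =
        (if s ≤ j ∧ j < s + (l : ℕ) then 1 else 0) *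
          ∑ i ∈ Finset.Ico s j, (c (i + 1) j - c i j) := fun j => by
      by_cases hj : s ≤ j ∧ j < s + (l : ℕ)
      · rw [if_pos hj, one_mul]
        simp only [ite_mul, one_mul, zero_mul]
        rw [← Finset.sum_filter]
        congr 1
        ext i; simp only [Finset.mem_filter, Finset.mem_Ico]; omega
      · rw [if_neg hj, zero_mul]
        refine Finset.sum_eq_zero fun i hi => ?_
        rw [Finset.mem_Ico] at hi
        rw [if_neg (by omega), zero_mul]
    simp_rw [e3]
    rw [e2, e2, e1, ← Finset.sum_add_distrib]
    refine Finset.sum_congr rfl fun j hj => ?_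
    rw [Finset.mem_Ico] at hj
    rw [add_comm]
    exact sum_Ico_int_telescope (fun i => c i j) hj.1 fun i _ h => hcc i j h
  have key : ∀ n : Multisegment, n.support ⊆ m.support ∪ m'.support →
      wt (fun p => κ p.1 (p.1 + (p.2 : ℕ))) n +
        ∑ j ∈ Finset.Ico a b, ∑ i ∈ Finset.Ico a j, rk n i j * (c (i + 1) j - c i j) =
      ∑ j ∈ Finset.Ico a b, rk n j j * c j j := fun n hn => by
    have h := wt_congr (m := n) (fun p hp => hpt p
      (ha (Finset.mem_coe.mpr (Finset.mem_image_of_mem _ (hn (Finsupp.mem_support_iff.mpr hp)))))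
      (hb (Finset.mem_coe.mpr (Finset.mem_image_of_mem (fun p : ℤ × ℕ+ => p.1 + ((p.2 : ℕ) : ℤ))
        (hn (Finsupp.mem_support_iff.mpr hp))))))
    rw [wt_fun_add, wt_fun_sum, wt_fun_sum] at h
    simp only [wt_fun_sum, wt_fun_mul] at h
    exact h
  have k1 := key m Finset.subset_union_left
  have k2 := key m' Finset.subset_union_right
  simp only [hd] at k1
  have k3 : ∑ j ∈ Finset.Ico a b, ∑ i ∈ Finset.Ico a j, rk m i j * (c (i + 1) j - c i j) ≤
      ∑ j ∈ Finset.Ico a b, ∑ i ∈ Finset.Ico a j, rk m' i j * (c (i + 1) j - c i j) :=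
    Finset.sum_le_sum fun j _ => Finset.sum_le_sum fun i hi =>
      Nat.mul_le_mul_right _ (hr i j (Finset.mem_Ico.mp hi).2.le)
  change wt (fun p => κ p.1 (p.1 + (p.2 : ℕ))) m' ≤ wt (fun p => κ p.1 (p.1 + (p.2 : ℕ))) m
  omega

theorem finrank_hom_repOf_segN (m : Multisegment) (j : ℤ) (n : ℕ) :
    Module.finrank k (QRep.Hom (repOf k m) (repOf k (segN j (n + 1)))) + rk m (j - 1) (j + n) =
      rk m (j + n) (j + n) := by
  rw [finrank_hom_repOf _ _ (isFiniteDim_repOf _)]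
  unfold rk
  rw [← wt_fun_add]
  congr 1
  funext p
  have hl := p.2.pos
  have h := finrank_ker_tr_repOf (k := k) (segN j (n + 1)) (show p.1 ≤ p.1 + (p.2 : ℕ) by omega)
  rw [rk_segN _ _ (by omega), rk_segN _ _ le_rfl] at h
  push_cast at h
  split_ifs at h ⊢ <;> omega

/-- The degeneration order in terms of ranks. -/
theorem degLE_iff {m m' : Multisegment} :
    DegLE k m m' ↔ (∀ i, rk m i i = rk m' i i) ∧ ∀ i j, i ≤ j → rk m i j ≤ rk m' i j := by
  unfold DegLE QRep.DegLE
  simp only [finrank_repOf]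
  constructor
  · rintro ⟨h1, h2⟩
    refine ⟨h1, fun i j hij => ?_⟩
    obtain ⟨n, rfl⟩ := Int.le.dest hij
    cases n with
    | zero => simp [h1]
    | succ n =>
      have e1 := finrank_hom_repOf_segN (k := k) m (i + 1) n
      have e2 := finrank_hom_repOf_segN (k := k) m' (i + 1) n
      have e3 := h2 (repOf k (segN (i + 1) (n + 1))) (isFiniteDim_repOf _)
      rw [h1] at e1
      rw [add_sub_cancel_right, show i + 1 + (n : ℤ) = i + ((n + 1 : ℕ) : ℤ) by push_cast; ring]
        at e1 e2
      omega
  · rintro ⟨h1, h2⟩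
    exact ⟨h1, fun X hX => finrank_hom_le_of_rk_le h1 h2 X hX⟩

open QRep

/-! ### Counting subrepresentations -/

namespace QRep

/-- The number of subrepresentations of type `m'` and cotype `m`. -/
def subCount (M : QRep k) (m m' : Multisegment) : ℕ :=
  {U : M.Sub | U.quotient.Iso (repOf k m) ∧ U.toRep.Iso (repOf k m')}.ncard

theorem finite_sub [Finite k] {M : QRep k} (hM : M.IsFiniteDim) : Finite M.Sub := by
  have h1 : ∀ i, Finite (Submodule k (M.V i)) := fun i => by
    have := hM.1 i
    have : Finite (M.V i) := Module.finite_of_finite k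
    exact Finite.of_injective (fun U : Submodule k (M.V i) => (U : Set (M.V i)))
      SetLike.coe_injective
  have := hM.2.to_subtype
  refine Finite.of_injective
    (fun (U : M.Sub) (i : {i | Nontrivial (M.V i)}) => U.carrier i.1) fun U U' h => ?_
  refine Sub.ext fun i => ?_
  by_cases hi : Nontrivial (M.V i)
  · exact congrFun h ⟨i, hi⟩
  · have := not_nontrivial_iff_subsingleton.mp hi
    exact Subsingleton.elim _ _

/-- The image of a subrepresentation under an isomorphism. -/
def Sub.mapIso {M N : QRep k} (e : ∀ i, M.V i ≃ₗ[k] N.V i)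
    (he : ∀ i x, e (i + 1) (M.f i x) = N.f i (e i x)) (U : M.Sub) : N.Sub where
  carrier i := (U.carrier i).map (e i : M.V i →ₗ[k] N.V i)
  map_mem i := by
    rintro _ ⟨x, hx, rfl⟩
    exact ⟨M.f i x, U.map_mem i x hx, he i x⟩

theorem Sub.mapIso_toRep {M N : QRep k} (e : ∀ i, M.V i ≃ₗ[k] N.V i)
    (he : ∀ i x, e (i + 1) (M.f i x) = N.f i (e i x)) (U : M.Sub) :
    U.toRep.Iso (U.mapIso e he).toRep :=
  ⟨fun i => (e i).submoduleMap (U.carrier i), fun i x => Subtype.ext (he i x.1)⟩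

theorem Sub.mapIso_quotient {M N : QRep k} (e : ∀ i, M.V i ≃ₗ[k] N.V i)
    (he : ∀ i x, e (i + 1) (M.f i x) = N.f i (e i x)) (U : M.Sub) :
    U.quotient.Iso (U.mapIso e he).quotient :=
  ⟨fun i => Submodule.Quotient.equiv (U.carrier i) _ (e i) rfl, fun i x => by
    obtain ⟨x, rfl⟩ := U.proj_surjective i x
    exact congrArg ((U.mapIso e he).proj (i + 1)) (he i x)⟩

theorem subCount_congr {M N : QRep k} (h : M.Iso N) (m m' : Multisegment) :
    M.subCount m m' = N.subCount m m' := by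
  obtain ⟨e, he⟩ := h
  have he' : ∀ i x, (e (i + 1)).symm (N.f i x) = M.f i ((e i).symm x) := fun i x => by
    rw [LinearEquiv.symm_apply_eq, he, LinearEquiv.apply_symm_apply]
  have hinv : ∀ U : N.Sub, (U.mapIso (fun i => (e i).symm) he').mapIso e he = U := fun U =>
    Sub.ext fun i => by
      change ((U.carrier i).map _).map _ = U.carrier i
      rw [← Submodule.map_comp]
      simp
  refine Set.ncard_congr (fun U _ => U.mapIso e he) ?_ ?_ ?_
  · rintro U ⟨h1, h2⟩
    exact ⟨(U.mapIso_quotient e he).symm.trans h1, (U.mapIso_toRep e he).symm.trans h2⟩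
  · intro U U' _ _ h
    refine Sub.ext fun i => ?_
    exact Submodule.map_injective_of_injective (e i).injective
      (congrArg (fun W : N.Sub => W.carrier i) h)
  · rintro U ⟨h1, h2⟩
    exact ⟨U.mapIso (fun i => (e i).symm) he', ⟨(U.mapIso_quotient _ he').symm.trans h1,
      (U.mapIso_toRep _ he').symm.trans h2⟩, hinv U⟩

/-- A subrepresentation of a subrepresentation, as a subrepresentation. -/
def Sub.push {M : QRep k} (U : M.Sub) (W : U.toRep.Sub) : M.Sub where
  carrier i := (W.carrier i).map (U.incl i)
  map_mem i := by
    rintro _ ⟨x, hx, rfl⟩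
    exact ⟨_, W.map_mem i x hx, rfl⟩

/-- The preimage of a subrepresentation of a quotient. -/
def Sub.pull {M : QRep k} (U : M.Sub) (W : U.quotient.Sub) : M.Sub where
  carrier i := (W.carrier i).comap (U.proj i)
  map_mem i _ hx := W.map_mem i _ hx

/-- `U' ⊆ U` is an inclusion of subrepresentations of `M`, and the subquotient `U / U'` has the
ranks of `M(m)`. -/
def Sub.HasSubquotient {M : QRep k} (m : Multisegment) (U U' : M.Sub) : Prop :=
  (∀ i, U'.carrier i ≤ U.carrier i) ∧ ∀ i j, i ≤ j →
    rk m i j + Module.finrank k ((U.carrier i).map (M.tr i j) ⊓ U'.carrier j : Submodule k (M.V j))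
      = Module.finrank k ((U.carrier i).map (M.tr i j))

theorem Sub.push_injective {M : QRep k} (U : M.Sub) : Function.Injective U.push := by
  intro W W' h
  refine Sub.ext fun i => ?_
  exact Submodule.map_injective_of_injective (U.incl_injective i)
    (congrArg (fun W : M.Sub => W.carrier i) h)

theorem Sub.pull_injective {M : QRep k} (U : M.Sub) : Function.Injective U.pull := by
  intro W W' h
  refine Sub.ext fun i => ?_
  exact Submodule.comap_injective_of_surjective (U.proj_surjective i)
    (congrArg (fun W : M.Sub => W.carrier i) h)

theorem Sub.push_toRep_iso {M : QRep k} (U : M.Sub) (W : U.toRep.Sub) :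
    W.toRep.Iso (U.push W).toRep :=
  ⟨fun i => Submodule.equivMapOfInjective _ (U.incl_injective i) (W.carrier i),
    fun _ _ => Subtype.ext rfl⟩

theorem Sub.push_quotient_iso_iff {M : QRep k} (hM : M.IsFiniteDim) (U : M.Sub) (W : U.toRep.Sub)
    (m : Multisegment) : W.quotient.Iso (repOf k m) ↔ HasSubquotient m U (U.push W) := by
  have hU := U.isFiniteDim_toRep hM
  have := hU.1
  rw [iso_repOf_iff (W.isFiniteDim_quotient hU)]
  have h1 : ∀ i, (U.push W).carrier i ≤ U.carrier i := fun i => by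
    rw [← U.range_incl]
    exact LinearMap.map_le_range
  have h2 : ∀ i j, W.quotient.rank i j + Module.finrank k
      ((U.carrier i).map (M.tr i j) ⊓ (U.push W).carrier j : Submodule k (M.V j)) =
      Module.finrank k ((U.carrier i).map (M.tr i j)) := fun i j => by
    rw [← U.rank_toRep, ← W.rank_quotient, ← U.map_incl_range_tr]
    congr 1
    change Module.finrank k (_ ⊓ (W.carrier j).map (U.incl j) : Submodule k (M.V j)) = _
    rw [← Submodule.map_inf _ (U.incl_injective j)]
    exact (Submodule.equivMapOfInjective _ (U.incl_injective j) _).finrank_eq.symm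
  constructor
  · exact fun h => ⟨h1, fun i j hij => by rw [← h i j hij, h2]⟩
  · intro h i j hij
    have := h2 i j
    have := h.2 i j hij
    omega

theorem Sub.pull_toRep_iso_iff {M : QRep k} (hM : M.IsFiniteDim) (U : M.Sub) (W : U.quotient.Sub)
    (m : Multisegment) : W.toRep.Iso (repOf k m) ↔ HasSubquotient m (U.pull W) U := by
  have hU := U.isFiniteDim_quotient hM
  have := hM.1
  rw [iso_repOf_iff (W.isFiniteDim_toRep hU)]
  have h1 : ∀ i, U.carrier i ≤ (U.pull W).carrier i := fun i => by
    rw [← U.ker_proj]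
    exact LinearMap.ker_le_comap _
  have h2 : ∀ i j, W.toRep.rank i j + Module.finrank k
      (((U.pull W).carrier i).map (M.tr i j) ⊓ U.carrier j : Submodule k (M.V j)) =
      Module.finrank k (((U.pull W).carrier i).map (M.tr i j)) := fun i j => by
    have h3 : W.carrier i = ((U.pull W).carrier i).map (U.proj i) :=
      (Submodule.map_comap_eq_of_surjective (U.proj_surjective i) _).symm
    have h4 : U.quotient.tr i j ∘ₗ U.proj i = U.proj j ∘ₗ M.tr i j :=
      LinearMap.ext fun x => (U.proj_tr i j x).symm
    have h5 : (W.carrier i).map (U.quotient.tr i j) =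
        (((U.pull W).carrier i).map (M.tr i j)).map (U.proj j) := by
      rw [h3, ← Submodule.map_comp, ← Submodule.map_comp, h4]
    rw [W.rank_toRep, h5,
      ← finrank_map_add_finrank_inf_ker (U.proj j) (((U.pull W).carrier i).map (M.tr i j)),
      U.ker_proj]
  constructor
  · exact fun h => ⟨h1, fun i j hij => by rw [← h i j hij, h2]⟩
  · intro h i j hij
    have := h2 i j
    have := h.2 i j hij
    omega

theorem Sub.pull_quotient_iso_iff {M : QRep k} (hM : M.IsFiniteDim) (U : M.Sub)
    (W : U.quotient.Sub) (m : Multisegment) :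
    W.quotient.Iso (repOf k m) ↔ (U.pull W).quotient.Iso (repOf k m) := by
  have hU := U.isFiniteDim_quotient hM
  have := hM.1
  have := hU.1
  rw [iso_repOf_iff (W.isFiniteDim_quotient hU),
    iso_repOf_iff ((U.pull W).isFiniteDim_quotient hM)]
  have h1 : ∀ i, U.carrier i ≤ (U.pull W).carrier i := fun i => by
    rw [← U.ker_proj]
    exact LinearMap.ker_le_comap _
  refine forall₂_congr fun i j => imp_congr_right fun _ => ?_
  have e1 := W.rank_quotient i j
  have e2 := U.rank_quotient i j
  have e3 := (U.pull W).rank_quotient i j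
  have e4 := finrank_map_add_finrank_inf_ker (U.proj j)
    (LinearMap.range (M.tr i j) ⊓ (U.pull W).carrier j)
  rw [U.ker_proj, inf_assoc, inf_eq_right.mpr (h1 j)] at e4
  have e5 : (LinearMap.range (M.tr i j) ⊓ (U.pull W).carrier j).map (U.proj j) =
      LinearMap.range (U.quotient.tr i j) ⊓ W.carrier j := by
    rw [← U.map_proj_range_tr]
    ext y
    constructor
    · rintro ⟨x, ⟨hx1, hx2⟩, rfl⟩
      exact ⟨⟨x, hx1, rfl⟩, hx2⟩
    · rintro ⟨⟨x, hx1, rfl⟩, hx2⟩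
      exact ⟨x, ⟨hx1, hx2⟩, rfl⟩
  rw [e5] at e4
  omega

/-- Subrepresentations of `U` as the part of a flag in `M` below `U`. -/
theorem subCount_toRep {M : QRep k} (hM : M.IsFiniteDim) (U : M.Sub) (m m' : Multisegment) :
    U.toRep.subCount m m' =
      {U' : M.Sub | U'.toRep.Iso (repOf k m') ∧ Sub.HasSubquotient m U U'}.ncard := by
  rw [subCount, ← Set.ncard_image_of_injective _ U.push_injective]
  congr 1
  ext U'
  constructor
  · rintro ⟨W, ⟨h1, h2⟩, rfl⟩
    exact ⟨(U.push_toRep_iso W).symm.trans h2, (U.push_quotient_iso_iff hM W m).mp h1⟩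
  · rintro ⟨h1, h2⟩
    let W : U.toRep.Sub :=
      { carrier := fun i => (U'.carrier i).comap (U.incl i)
        map_mem := fun i x hx => U'.map_mem i _ hx }
    have hW : U.push W = U' := Sub.ext fun i => by
      change ((U'.carrier i).comap (U.incl i)).map (U.incl i) = U'.carrier i
      rw [Submodule.map_comap_eq, U.range_incl]
      exact inf_eq_right.mpr (h2.1 i)
    refine ⟨W, ⟨?_, ?_⟩, hW⟩
    · rw [U.push_quotient_iso_iff hM, hW]; exact h2
    · exact (U.push_toRep_iso W).trans (hW ▸ h1)

/-- Subrepresentations of `M / U` as the part of a flag in `M` above `U`. -/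
theorem subCount_quotient {M : QRep k} (hM : M.IsFiniteDim) (U : M.Sub) (m m' : Multisegment) :
    U.quotient.subCount m m' =
      {U' : M.Sub | U'.quotient.Iso (repOf k m) ∧ Sub.HasSubquotient m' U' U}.ncard := by
  rw [subCount, ← Set.ncard_image_of_injective _ U.pull_injective]
  congr 1
  ext U'
  constructor
  · rintro ⟨W, ⟨h1, h2⟩, rfl⟩
    exact ⟨(U.pull_quotient_iso_iff hM W m).mp h1, (U.pull_toRep_iso_iff hM W m').mp h2⟩
  · rintro ⟨h1, h2⟩
    let W : U.quotient.Sub :=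
      { carrier := fun i => (U'.carrier i).map (U.proj i)
        map_mem := by
          rintro i _ ⟨x, hx, rfl⟩
          exact ⟨_, U'.map_mem i x hx, rfl⟩ }
    have hW : U.pull W = U' := Sub.ext fun i => by
      change ((U'.carrier i).map (U.proj i)).comap (U.proj i) = U'.carrier i
      rw [Submodule.comap_map_eq, U.ker_proj]
      exact sup_eq_left.mpr (h2.1 i)
    refine ⟨W, ⟨?_, ?_⟩, hW⟩
    · rw [U.pull_quotient_iso_iff hM, hW]; exact h1
    · rw [U.pull_toRep_iso_iff hM, hW]; exact h2

open Classical in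
/-- Summation over the types of the elements of a finite set. -/
theorem _root_.FockHall.sum_eq_finsum_fiber {α β : Type*} (s : Finset α) (t : α → β) (g : β → ℕ) :
    ∑ a ∈ s, g (t a) = ∑ᶠ b, (s.filter fun a => t a = b).card * g b := by
  rw [Finset.sum_comp, finsum_eq_sum_of_support_subset (s := s.image t)]
  · simp
  · intro b hb
    rw [Function.mem_support] at hb
    have h : (s.filter fun a => t a = b).card ≠ 0 := fun h => hb (by rw [h, zero_mul])
    rw [Finset.card_ne_zero] at h
    obtain ⟨a, ha⟩ := h
    rw [Finset.mem_filter] at ha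
    exact Finset.mem_coe.mpr (Finset.mem_image.mpr ⟨a, ha⟩)

end QRep

/-- Associativity of the Hall numbers: both sides count the flags `U' ⊆ U` in `M(x)` whose
subquotients have types `m₁`, `m₂`, `m₃`. -/
theorem hallNumber_assoc [Finite k] (m₁ m₂ m₃ x : Multisegment) :
    ∑ᶠ p, hallNumber k m₁ m₂ p * hallNumber k p m₃ x =
      ∑ᶠ p, hallNumber k m₁ p x * hallNumber k m₂ m₃ p := by
  classical
  set M := repOf k x with hMdef
  have hM : M.IsFiniteDim := isFiniteDim_repOf x
  have := QRep.finite_sub hM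
  have : Fintype M.Sub := Fintype.ofFinite _
  choose tS htS using fun U : M.Sub => exists_iso_repOf (U.isFiniteDim_toRep hM)
  choose tQ htQ using fun U : M.Sub => exists_iso_repOf (U.isFiniteDim_quotient hM)
  have hS : ∀ U p, U.toRep.Iso (repOf k p) ↔ tS U = p := fun U p =>
    ⟨fun h => eq_of_iso_repOf ((htS U).symm.trans h), fun h => h ▸ htS U⟩
  have hQ : ∀ U p, U.quotient.Iso (repOf k p) ↔ tQ U = p := fun U p =>
    ⟨fun h => eq_of_iso_repOf ((htQ U).symm.trans h), fun h => h ▸ htQ U⟩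
  have hh : ∀ p p', hallNumber k p p' x =
      (Finset.univ.filter fun U : M.Sub => tQ U = p ∧ tS U = p').card := fun p p' => by
    rw [hallNumber, Set.ncard_eq_toFinset_card']
    congr 1
    ext U
    simp [hS, hQ]
  have h1 : ∑ U ∈ Finset.univ.filter (fun U : M.Sub => tQ U = m₁), hallNumber k m₂ m₃ (tS U) =
      ∑ᶠ p, hallNumber k m₁ p x * hallNumber k m₂ m₃ p := by
    rw [sum_eq_finsum_fiber]
    simp only [hh, Finset.filter_filter]
    congr!
  have h2 : ∑ U ∈ Finset.univ.filter (fun U : M.Sub => tS U = m₃), hallNumber k m₁ m₂ (tQ U) =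
      ∑ᶠ p, hallNumber k m₁ m₂ p * hallNumber k p m₃ x := by
    rw [sum_eq_finsum_fiber _ _ fun p => hallNumber k m₁ m₂ p]
    refine finsum_congr fun p => ?_
    rw [hh, Finset.filter_filter, mul_comm]
    simp only [and_comm]
    congr!
  rw [← h1, ← h2]
  have h3 : ∀ U : M.Sub, hallNumber k m₂ m₃ (tS U) = (Finset.bipartiteAbove
      (fun U U' => QRep.Sub.HasSubquotient m₂ U U')
      (Finset.univ.filter fun U' : M.Sub => tS U' = m₃) U).card := fun U => by
    change QRep.subCount _ _ _ = _
    rw [← QRep.subCount_congr (htS U), QRep.subCount_toRep hM, Set.ncard_eq_toFinset_card']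
    congr 1
    ext U'
    simp [hS, Finset.mem_bipartiteAbove]
  have h4 : ∀ U : M.Sub, hallNumber k m₁ m₂ (tQ U) = (Finset.bipartiteBelow
      (fun U U' => QRep.Sub.HasSubquotient m₂ U U')
      (Finset.univ.filter fun U' : M.Sub => tQ U' = m₁) U).card := fun U => by
    change QRep.subCount _ _ _ = _
    rw [← QRep.subCount_congr (htQ U), QRep.subCount_quotient hM, Set.ncard_eq_toFinset_card']
    congr 1
    ext U'
    simp [hQ, Finset.mem_bipartiteBelow]
  simp only [h3, h4]
  exact (Finset.sum_card_bipartiteAbove_eq_sum_card_bipartiteBelow _).symm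

theorem dimVec_of_hallNumber_ne_zero [Finite k] {m m' p : Multisegment}
    (h : hallNumber k m m' p ≠ 0) : dimVec p = dimVec m + dimVec m' := by
  obtain ⟨U, h1, h2⟩ := Set.nonempty_of_ncard_ne_zero h
  ext i
  rw [Finsupp.add_apply, dimVec_apply, dimVec_apply, dimVec_apply, ← rank_repOf (k := k) m le_rfl,
    ← rank_repOf (k := k) m' le_rfl, ← rank_repOf (k := k) p le_rfl, ← h1.rank_eq, ← h2.rank_eq,
    ← U.rank_quotient, U.rank_toRep,
    QRep.tr_self, LinearMap.range_id, top_inf_eq, Submodule.map_id]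

open QRep

/-! ### Hall numbers with a simple quotient -/

namespace QRep

/-- The subrepresentation of the vectors on which the pullback of a functional at `i` vanishes. -/
def kerSub (M : QRep k) (i : ℤ) (φ : Module.Dual k (M.V i)) : M.Sub where
  carrier j := LinearMap.ker (φ ∘ₗ M.tr j i)
  map_mem j y hy := by
    rw [LinearMap.mem_ker, LinearMap.comp_apply] at hy ⊢
    by_cases h : j + 1 ≤ i
    · rw [tr_pred M h, hy]
    · rw [tr_of_lt M (by omega)]; simp

theorem kerSub_self (M : QRep k) (i : ℤ) (φ : Module.Dual k (M.V i)) :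
    (M.kerSub i φ).carrier i = LinearMap.ker φ := by
  change LinearMap.ker (φ ∘ₗ M.tr i i) = _
  rw [tr_self, LinearMap.comp_id]

theorem comp_tr_eq_zero {M : QRep k} {i : ℤ} {φ : Module.Dual k (M.V i)}
    (hφ : φ ∘ₗ M.tr (i - 1) i = 0) {j : ℤ} (h : j < i) : φ ∘ₗ M.tr j i = 0 := by
  rw [← M.tr_comp (show j ≤ i - 1 by omega) (show i - 1 ≤ i by omega), ← LinearMap.comp_assoc, hφ,
    LinearMap.zero_comp]

theorem kerSub_of_ne {M : QRep k} {i : ℤ} {φ : Module.Dual k (M.V i)}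
    (hφ : φ ∘ₗ M.tr (i - 1) i = 0) {j : ℤ} (h : j ≠ i) : (M.kerSub i φ).carrier j = ⊤ := by
  change LinearMap.ker (φ ∘ₗ M.tr j i) = ⊤
  rcases lt_or_gt_of_ne h with h | h
  · rw [comp_tr_eq_zero hφ h, LinearMap.ker_zero]
  · rw [tr_of_lt M h, LinearMap.comp_zero, LinearMap.ker_zero]

/-- The subrepresentations with quotient `S_i` are the kernels of the functionals on `V i` which vanish
on the image of `V (i - 1)`. -/
theorem quotient_iso_simple_iff {M : QRep k} (hM : M.IsFiniteDim) (i : ℤ) (U : M.Sub) :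
    U.quotient.Iso (repOf k (seg i 1)) ↔
      ∃ φ : Module.Dual k (M.V i), φ ≠ 0 ∧ φ ∘ₗ M.tr (i - 1) i = 0 ∧ U = M.kerSub i φ := by
  have := hM.1
  rw [iso_repOf_iff (U.isFiniteDim_quotient hM)]
  have hrk : ∀ a b, a ≤ b → rk (seg i 1) a b = if a = i ∧ b = i then 1 else 0 := fun a b h => by
    rw [← segN_one, rk_segN _ _ h]
    split_ifs <;> omega
  constructor
  · intro h
    have hdim : ∀ j, (if j = i ∧ j = i then 1 else 0) + Module.finrank k (U.carrier j) =
        Module.finrank k (M.V j) := fun j => by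
      rw [← hrk j j le_rfl, ← h j j le_rfl, ← M.rank_self, ← U.rank_quotient j j, tr_self,
        LinearMap.range_id, top_inf_eq]
    have htop : ∀ j, j ≠ i → U.carrier j = ⊤ := fun j hj => by
      have := hdim j
      rw [if_neg (by tauto), zero_add] at this
      exact Submodule.eq_top_of_finrank_eq this
    have hi := hdim i
    rw [if_pos ⟨rfl, rfl⟩] at hi
    have hlt : U.carrier i < ⊤ := by
      rw [lt_top_iff_ne_top]
      intro h'
      rw [h', finrank_top] at hi
      omega
    obtain ⟨φ, hφ, hle⟩ := Submodule.exists_le_ker_of_lt_top _ hlt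
    have hker : U.carrier i = LinearMap.ker φ := by
      refine Submodule.eq_of_le_of_finrank_eq hle ?_
      have := Module.Dual.finrank_ker_add_one_of_ne_zero (f := φ) hφ
      omega
    have hφ2 : φ ∘ₗ M.tr (i - 1) i = 0 := by
      refine LinearMap.ext fun x => ?_
      have := U.tr_mem (i - 1) i (x := x) (by rw [htop _ (by omega)]; trivial)
      rw [hker] at this
      exact this
    refine ⟨φ, hφ, hφ2, Sub.ext fun j => ?_⟩
    by_cases hj : j = i
    · subst hj
      rw [kerSub_self, hker]
    · rw [kerSub_of_ne hφ2 hj, htop j hj]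
  · rintro ⟨φ, hφ, hφ2, rfl⟩ a b hab
    have h1 := (M.kerSub i φ).rank_quotient a b
    rw [hrk a b hab]
    by_cases hb : b = i
    · subst hb
      rw [kerSub_self] at h1
      by_cases ha : a = b
      · subst ha
        rw [tr_self, LinearMap.range_id, top_inf_eq, rank_self M] at h1
        have := Module.Dual.finrank_ker_add_one_of_ne_zero (f := φ) hφ
        rw [if_pos ⟨rfl, rfl⟩]
        omega
      · rw [if_neg (by tauto)]
        have h2 : LinearMap.range (M.tr a b) ≤ LinearMap.ker φ := by
          rw [LinearMap.range_le_ker_iff]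
          exact comp_tr_eq_zero hφ2 (by omega)
        rw [inf_eq_left.mpr h2] at h1
        unfold rank at h1 ⊢
        omega
    · rw [if_neg (by tauto)]
      rw [kerSub_of_ne hφ2 hb, inf_top_eq] at h1
      unfold rank at h1 ⊢
      omega

open Classical in
theorem rank_kerSub {M : QRep k} (hM : M.IsFiniteDim) {i : ℤ} {φ : Module.Dual k (M.V i)}
    (hφ : φ ≠ 0) (hφ2 : φ ∘ₗ M.tr (i - 1) i = 0) (a b : ℤ) :
    (M.kerSub i φ).toRep.rank a b +
      (if a = i ∧ LinearMap.ker (M.tr i b) ≤ LinearMap.ker φ then 1 else 0) = M.rank a b := by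
  have := hM.1
  rw [Sub.rank_toRep]
  by_cases ha : a = i
  · subst ha
    rw [kerSub_self]
    have h1 := finrank_map_add_finrank_inf_ker (M.tr a b) (LinearMap.ker φ)
    have h2 := LinearMap.finrank_range_add_finrank_ker (M.tr a b)
    have h3 := Module.Dual.finrank_ker_add_one_of_ne_zero (f := φ) hφ
    have h4 := finrank_map_add_finrank_inf_ker φ (LinearMap.ker (M.tr a b))
    rw [inf_comm] at h4
    unfold rank
    split_ifs with h
    · rw [inf_eq_right.mpr h.2] at h1
      omega
    · have h5 : (LinearMap.ker (M.tr a b)).map φ ≠ ⊥ := fun h' =>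
        h ⟨rfl, fun x hx => by
        rw [LinearMap.mem_ker, ← Submodule.mem_bot k, ← h']
        exact Submodule.mem_map_of_mem hx⟩
      have h6 : (LinearMap.ker (M.tr a b)).map φ = ⊤ := (eq_bot_or_eq_top _).resolve_left h5
      rw [h6, finrank_top, Module.finrank_self] at h4
      omega
  · rw [if_neg (by tauto), kerSub_of_ne hφ2 ha, Submodule.map_top]
    rfl

theorem ker_tr_mono (M : QRep k) (i : ℤ) {b c : ℤ} (hib : i ≤ b) (hbc : b ≤ c) :
    LinearMap.ker (M.tr i b) ≤ LinearMap.ker (M.tr i c) := fun x hx => by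
  rw [LinearMap.mem_ker] at hx ⊢
  rw [← tr_tr M hib hbc, hx, map_zero]

end QRep

/-- The type of the kernel of a functional `φ` is determined by the first of the increasing subspaces
`ker (V i → V (i + n))` on which `φ` does not vanish. -/
theorem kerSub_iso_red_iff {p : Multisegment} {i : ℤ} {n : ℕ} (h : segN i (n + 1) ≤ p)
    {φ : Module.Dual k ((repOf k p).V i)} (hφ : φ ≠ 0)
    (hφ2 : φ ∘ₗ (repOf k p).tr (i - 1) i = 0) :
    ((repOf k p).kerSub i φ).toRep.Iso (repOf k (red p i n)) ↔
      LinearMap.ker ((repOf k p).tr i (i + n)) ≤ LinearMap.ker φ ∧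
      ¬ LinearMap.ker ((repOf k p).tr i (i + n + 1)) ≤ LinearMap.ker φ := by
  classical
  have hp := isFiniteDim_repOf (k := k) p
  rw [iso_repOf_iff (((repOf k p).kerSub i φ).isFiniteDim_toRep hp)]
  have h1 := fun a b => QRep.rank_kerSub hp hφ hφ2 a b
  constructor
  · intro H
    have a1 := h1 i (i + n)
    have a2 := h1 i (i + n + 1)
    have b1 := rk_red h (show i ≤ i + n by omega)
    have b2 := rk_red h (show i ≤ i + n + 1 by omega)
    rw [H i _ (by omega), rank_repOf p (by omega)] at a1 a2
    rw [if_pos (by omega)] at b1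
    rw [if_neg (by omega)] at b2
    constructor
    · by_contra hc
      rw [if_neg (by tauto)] at a1
      omega
    · intro hc
      rw [if_pos (by tauto)] at a2
      omega
  · rintro ⟨H1, H2⟩ a b hab
    have a1 := h1 a b
    have b1 := rk_red h hab
    rw [rank_repOf p hab] at a1
    have e : (a = i ∧ LinearMap.ker ((repOf k p).tr i b) ≤ LinearMap.ker φ) ↔
        (a = i ∧ b < i + (n + 1)) := by
      refine and_congr_right fun hai => ?_
      subst hai
      constructor
      · intro h3
        by_contra h4
        exact H2 ((QRep.ker_tr_mono _ a (by omega) (by omega)).trans h3)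
      · intro h3
        exact (QRep.ker_tr_mono _ a hab (by omega)).trans H1
    simp only [e] at a1
    omega

/-- The functionals on `V i` which vanish on the image of `V (i - 1)` and on the kernel of
`V i → V (i + n)`. -/
def functionals (M : QRep k) (i : ℤ) (n : ℕ) : Submodule k (Module.Dual k (M.V i)) :=
  (LinearMap.range (M.tr (i - 1) i) ⊔ LinearMap.ker (M.tr i (i + n))).dualAnnihilator

theorem mem_functionals {M : QRep k} {i : ℤ} {n : ℕ} {φ : Module.Dual k (M.V i)} :
    φ ∈ functionals M i n ↔
      φ ∘ₗ M.tr (i - 1) i = 0 ∧ LinearMap.ker (M.tr i (i + n)) ≤ LinearMap.ker φ := by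
  unfold functionals
  rw [Submodule.dualAnnihilator_sup_eq, Submodule.mem_inf, Submodule.mem_dualAnnihilator,
    Submodule.mem_dualAnnihilator, ← LinearMap.range_le_ker_iff]
  rfl

theorem finrank_functionals (p : Multisegment) (i : ℤ) (n : ℕ) :
    Module.finrank k (functionals (repOf k p) i n) = cg p i n := by
  set M := repOf k p with hM
  set W := LinearMap.range (M.tr (i - 1) i) ⊔ LinearMap.ker (M.tr i (i + n)) with hW
  have h1 := Subspace.finrank_add_finrank_dualAnnihilator_eq W
  have h2 := finrank_map_add_finrank_inf_ker (M.tr i (i + n)) W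
  have h3 := LinearMap.finrank_range_add_finrank_ker (M.tr i (i + n))
  have h4 : W.map (M.tr i (i + n)) = LinearMap.range (M.tr (i - 1) (i + n)) := by
    rw [hW, Submodule.map_sup, ← LinearMap.range_comp, QRep.tr_comp _ (by omega) (by omega),
      LinearMap.le_ker_iff_map.mp le_rfl, sup_bot_eq]
  rw [h4, inf_eq_right.mpr le_sup_right] at h2
  have h5 : Module.finrank k (LinearMap.range (M.tr (i - 1) (i + n))) = rk p (i - 1) (i + n) :=
    rank_repOf p (by omega)
  have h6 : Module.finrank k (LinearMap.range (M.tr i (i + n))) = rk p i (i + n) :=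
    rank_repOf p (by omega)
  have h7 := rk_eq_add_cg p i n
  change Module.finrank k W.dualAnnihilator = _
  omega

theorem functionals_antitone (M : QRep k) (i : ℤ) : Antitone (functionals M i) :=
  antitone_nat_of_succ_le fun n φ hφ => by
    rw [mem_functionals] at hφ ⊢
    exact ⟨hφ.1, (QRep.ker_tr_mono M i (by omega) (by push_cast; omega)).trans hφ.2⟩

theorem ncard_functionals_diff [Finite k] (p : Multisegment) (i : ℤ) (n : ℕ) :
    (((functionals (repOf k p) i n : Set (Module.Dual k ((repOf k p).V i))) \
      (functionals (repOf k p) i (n + 1) : Set (Module.Dual k ((repOf k p).V i)))).ncard : ℤ) =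
      (Nat.card k : ℤ) ^ cg p i n - (Nat.card k : ℤ) ^ cg p i (n + 1) := by
  have : Finite (Module.Dual k ((repOf k p).V i)) := Module.finite_of_finite k
  have h1 : ∀ n, (functionals (repOf k p) i n : Set (Module.Dual k ((repOf k p).V i))).ncard = Nat.card k ^ cg p i n := fun n => by
    rw [← finrank_functionals (k := k)]
    exact Module.natCard_eq_pow_finrank (K := k) (V := functionals (repOf k p) i n)
  have h := Set.ncard_sdiff_add_ncard_of_subset
    (functionals_antitone (repOf k p) i (Nat.le_succ n)) (Set.toFinite _)
  rw [h1, h1] at h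
  have : ((_ + _ : ℕ) : ℤ) = ((_ : ℕ) : ℤ) := congrArg Nat.cast h
  push_cast at this
  linarith

theorem exists_smul_of_ker_le {V : Type*} [AddCommGroup V] [Module k V] {φ ψ : Module.Dual k V}
    (h : LinearMap.ker φ ≤ LinearMap.ker ψ) : ∃ c : k, c • φ = ψ := by
  have := mem_span_of_iInf_ker_le_ker (ι := Unit) (L := fun _ => φ) (K := ψ)
    ((iInf_le _ ()).trans h)
  rw [Set.range_const, Submodule.mem_span_singleton] at this
  exact this

theorem exists_functionals {p : Multisegment} {i : ℤ} {φ : Module.Dual k ((repOf k p).V i)}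
    (hφ : φ ≠ 0) (hφ2 : φ ∘ₗ (repOf k p).tr (i - 1) i = 0) :
    ∃ n, φ ∈ functionals (repOf k p) i n ∧ φ ∉ functionals (repOf k p) i (n + 1) := by
  classical
  have hex : ∃ n, φ ∉ functionals (repOf k p) i n := by
    refine ⟨totalDim p, fun h => hφ ?_⟩
    have : functionals (repOf k p) i (totalDim p) = ⊥ := by
      rw [← Submodule.finrank_eq_zero, finrank_functionals, cg_eq_zero_of_le le_rfl]
    rw [this] at h
    exact h
  have h0 : Nat.find hex ≠ 0 := by
    rw [ne_eq, Nat.find_eq_zero, not_not, mem_functionals]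
    refine ⟨hφ2, fun x hx => ?_⟩
    have h : ∀ j, i = j → (repOf k p).tr i j x = 0 → x = 0 := by rintro j rfl h; simpa using h
    rw [h _ (by simp) hx]
    exact map_zero φ
  obtain ⟨n, hn⟩ := Nat.exists_eq_succ_of_ne_zero h0
  exact ⟨n, not_not.mp (Nat.find_min hex (show n < Nat.find hex by omega)),
    by have := Nat.find_spec hex; rwa [hn] at this⟩

theorem mu_ne_zero_of_functionals {p : Multisegment} {i : ℤ} {n : ℕ}
    {φ : Module.Dual k ((repOf k p).V i)} (h : φ ∈ functionals (repOf k p) i n)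
    (h' : φ ∉ functionals (repOf k p) i (n + 1)) : segN i (n + 1) ≤ p := by
  rw [segN_le_iff]
  intro h0
  have h1 := cg_succ p i n
  rw [h0, zero_add, ← finrank_functionals (k := k), ← finrank_functionals (k := k) p i] at h1
  exact h' (Submodule.eq_of_le_of_finrank_eq (functionals_antitone _ i (Nat.le_succ n)) h1.symm ▸ h)

theorem exists_red_of_hallNumber_ne_zero {i : ℤ} {m p : Multisegment}
    (h : hallNumber k (seg i 1) m p ≠ 0) : ∃ n, segN i (n + 1) ≤ p ∧ m = red p i n := by
  obtain ⟨U, h1, h2⟩ := Set.nonempty_of_ncard_ne_zero h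
  obtain ⟨φ, hφ, hφ2, rfl⟩ := (QRep.quotient_iso_simple_iff (isFiniteDim_repOf p) i U).mp h1
  obtain ⟨n, hn, hn'⟩ := exists_functionals hφ hφ2
  have hle := mu_ne_zero_of_functionals hn hn'
  refine ⟨n, hle, eq_of_iso_repOf (k := k) (h2.symm.trans ?_)⟩
  rw [kerSub_iso_red_iff hle hφ hφ2]
  rw [mem_functionals] at hn hn'
  refine ⟨hn.2, fun hc => hn' ⟨hφ2, ?_⟩⟩
  rw [show i + ((n + 1 : ℕ) : ℤ) = i + n + 1 by push_cast; ring]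
  exact hc

/-- The Hall numbers with a simple quotient: the subrepresentations in question are the kernels of
functionals on `V i`, and each of them is the kernel of `|k| - 1` functionals. -/
theorem hallNumber_simple_red [Finite k] {i : ℤ} {p : Multisegment} {n : ℕ}
    (h : segN i (n + 1) ≤ p) :
    ((Nat.card k : ℤ) - 1) * hallNumber k (seg i 1) (red p i n) p =
      (Nat.card k : ℤ) ^ cg p i n - (Nat.card k : ℤ) ^ cg p i (n + 1) := by
  classical
  rw [← ncard_functionals_diff]
  set M := repOf k p with hM
  have hMf : M.IsFiniteDim := isFiniteDim_repOf p
  have : Finite (Module.Dual k (M.V i)) := Module.finite_of_finite k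
  have := QRep.finite_sub hMf
  set Φ : Set (Module.Dual k (M.V i)) :=
    (functionals M i n : Set (Module.Dual k (M.V i))) \
      (functionals M i (n + 1) : Set (Module.Dual k (M.V i))) with hΦ
  set S : Set M.Sub := {U : M.Sub | U.quotient.Iso (repOf k (seg i 1)) ∧
    U.toRep.Iso (repOf k (red p i n))} with hS
  have hcast : i + ((n + 1 : ℕ) : ℤ) = i + n + 1 := by push_cast; ring
  have hne : ∀ φ ∈ Φ, φ ≠ 0 := by
    rintro φ ⟨-, h2⟩ rfl
    exact h2 (Submodule.zero_mem _)
  have hΦS : ∀ φ, φ ∈ Φ ↔ φ ≠ 0 ∧ φ ∘ₗ M.tr (i - 1) i = 0 ∧ M.kerSub i φ ∈ S := by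
    intro φ
    constructor
    · intro hφ
      have h0 := hne φ hφ
      have h1 := mem_functionals.mp hφ.1
      refine ⟨h0, h1.1, (QRep.quotient_iso_simple_iff hMf i _).mpr ⟨φ, h0, h1.1, rfl⟩,
        (kerSub_iso_red_iff h h0 h1.1).mpr ⟨h1.2, fun hc => hφ.2 (mem_functionals.mpr ⟨h1.1, ?_⟩)⟩⟩
      rw [hcast]; exact hc
    · rintro ⟨h0, h1, h2⟩
      have h3 := (kerSub_iso_red_iff h h0 h1).mp h2.2
      refine ⟨mem_functionals.mpr ⟨h1, h3.1⟩, fun hc => h3.2 ?_⟩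
      have := (mem_functionals.mp hc).2
      rwa [hcast] at this
  have hfib : ∀ U ∈ S.toFinite.toFinset,
      (Φ.toFinite.toFinset.filter fun φ => M.kerSub i φ = U).card = Nat.card kˣ := by
    intro U hU
    rw [Set.Finite.mem_toFinset] at hU
    obtain ⟨φ, hφ, hφ2, rfl⟩ := (QRep.quotient_iso_simple_iff hMf i U).mp hU.1
    have : Fintype kˣ := Fintype.ofFinite _
    rw [Nat.card_eq_fintype_card, ← Finset.card_univ]
    symm
    refine Finset.card_bij (fun c _ => (c : k) • φ) ?_ ?_ ?_
    · intro c _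
      have hk : M.kerSub i ((c : k) • φ) = M.kerSub i φ := QRep.Sub.ext fun j => by
        change LinearMap.ker (((c : k) • φ) ∘ₗ M.tr j i) = LinearMap.ker (φ ∘ₗ M.tr j i)
        rw [LinearMap.smul_comp, LinearMap.ker_smul _ _ c.ne_zero]
      rw [Finset.mem_filter, Set.Finite.mem_toFinset, hΦS, hk]
      refine ⟨⟨smul_ne_zero c.ne_zero hφ, ?_, hU⟩, rfl⟩
      rw [LinearMap.smul_comp, hφ2, smul_zero]
    · intro c _ c' _ hcc
      exact Units.ext (smul_left_injective k hφ hcc)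
    · intro ψ hψ
      rw [Finset.mem_filter, Set.Finite.mem_toFinset] at hψ
      have hker : LinearMap.ker φ ≤ LinearMap.ker ψ := by
        rw [← QRep.kerSub_self M i φ, ← QRep.kerSub_self M i ψ, hψ.2]
      obtain ⟨c, rfl⟩ := exists_smul_of_ker_le hker
      have hc : c ≠ 0 := by
        rintro rfl
        exact hne _ hψ.1 (zero_smul k φ)
      exact ⟨Units.mk0 c hc, Finset.mem_univ _, rfl⟩
  have hcount := Finset.card_eq_sum_card_fiberwise (s := Φ.toFinite.toFinset)
    (t := S.toFinite.toFinset) (f := fun φ => M.kerSub i φ) (fun φ hφ => by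
      rw [Finset.mem_coe, Set.Finite.mem_toFinset] at hφ ⊢
      exact ((hΦS φ).mp hφ).2.2)
  rw [Finset.sum_congr rfl hfib, Finset.sum_const, smul_eq_mul, Nat.card_units] at hcount
  rw [Set.ncard_eq_toFinset_card _ Φ.toFinite, hcount, hallNumber,
    Set.ncard_eq_toFinset_card _ S.toFinite]
  have : 1 ≤ Nat.card k := Nat.card_pos
  push_cast [this]
  ring

end Representations

/-! ### Induction on multisegments -/

/-- Shorten all segments starting at `i` by their top. -/
def shift (i : ℤ) : Multisegment →+ Multisegment :=
  Finsupp.liftAddHom fun p => (multiplesHom Multisegment)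
    (if p.1 = i then segN (i + 1) ((p.2 : ℕ) - 1) else Finsupp.single p 1)

theorem shift_single (i : ℤ) (p : ℤ × ℕ+) (c : ℕ) : shift i (Finsupp.single p c) =
    c • (if p.1 = i then segN (i + 1) ((p.2 : ℕ) - 1) else Finsupp.single p 1) := by
  rw [shift, Finsupp.liftAddHom_apply_single]
  rfl

theorem shift_segN_self (i : ℤ) (n : ℕ) : shift i (segN i (n + 1)) = segN (i + 1) n := by
  rw [segN_succ, shift_single]
  simp

theorem shift_segN_succ (i : ℤ) (n : ℕ) : shift i (segN (i + 1) n) = segN (i + 1) n := by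
  cases n with
  | zero => simp
  | succ n => rw [segN_succ, shift_single]; simp

theorem shift_red {p : Multisegment} {i : ℤ} {n : ℕ} (h : segN i (n + 1) ≤ p) :
    shift i (red p i n) = shift i p := by
  obtain ⟨c, rfl⟩ := exists_add_of_le h
  rw [red, add_tsub_cancel_left, map_add, map_add, shift_segN_self, shift_segN_succ, add_comm]

theorem shift_of_cg_eq_zero {p : Multisegment} {i : ℤ} (h : cg p i 0 = 0) : shift i p = p := by
  unfold cg at h
  rw [wt_eq_zero_iff] at h
  conv_rhs => rw [← p.sum_single]
  rw [shift, Finsupp.liftAddHom_apply]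
  refine Finset.sum_congr rfl fun x hx => ?_
  have := h x (Finsupp.mem_support_iff.mp hx)
  have hpos := x.2.pos
  have hx1 : x.1 ≠ i := fun h' => by
    rw [if_pos ⟨h', hpos⟩] at this
    omega
  beta_reduce
  rw [if_neg hx1]
  simp

theorem exists_mu_ne_zero {p : Multisegment} {i : ℤ} {n : ℕ} (h : cg p i n ≠ 0) :
    ∃ n, segN i (n + 1) ≤ p := by
  by_contra hc
  push Not at hc
  have h1 : ∀ n, mu p i n = 0 := fun n => by
    by_contra h'
    exact hc n (segN_le_iff.mpr h')
  have h2 : ∀ r, cg p i n = cg p i (n + r) := fun r => by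
    induction r with
    | zero => rfl
    | succ r ih => have := cg_succ p i (n + r); rw [h1] at this; rw [ih, this, zero_add]; rfl
  exact h (by rw [h2 (totalDim p), cg_eq_zero_of_le (by omega)])

theorem cg_red_zero {p : Multisegment} {i : ℤ} {n : ℕ} (h : segN i (n + 1) ≤ p) :
    cg (red p i n) i 0 + 1 = cg p i 0 := by
  have := cg_red h i 0
  simpa using this

/-- Shortening all segments starting at `i` is an iteration of shortening one of them. -/
theorem shift_rec {i : ℤ} {P : Multisegment → Prop} (h0 : ∀ p, cg p i 0 = 0 → P p)
    (h1 : ∀ p n, segN i (n + 1) ≤ p → P (red p i n) → P p) (p : Multisegment) : P p := by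
  generalize ha : cg p i 0 = a
  induction a generalizing p with
  | zero => exact h0 p ha
  | succ a ih =>
    obtain ⟨n, hn⟩ := exists_mu_ne_zero (p := p) (i := i) (n := 0) (by omega)
    have := cg_red_zero hn
    exact h1 p n hn (ih _ (by omega))

theorem rk_shift (i : ℤ) (p : Multisegment) : ∀ j l, j ≤ l → j ≠ i →
    rk (shift i p) j l = rk p j l := by
  refine shift_rec (i := i) (P := fun p => ∀ j l, j ≤ l → j ≠ i → rk (shift i p) j l = rk p j l)
    (fun p hp => ?_) (fun p n hn ih => ?_) p
  · rw [shift_of_cg_eq_zero hp]; exact fun _ _ _ _ => rfl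
  · intro j l hjl hj
    rw [← shift_red hn, ih j l hjl hj, ← rk_red hn hjl, if_neg (by tauto), add_zero]

theorem dimVec_shift (i : ℤ) (p : Multisegment) :
    dimVec (shift i p) + Finsupp.single i (cg p i 0) = dimVec p := by
  refine shift_rec (i := i) (P := fun p => dimVec (shift i p) + Finsupp.single i (cg p i 0) = dimVec p)
    (fun p hp => ?_) (fun p n hn ih => ?_) p
  · rw [shift_of_cg_eq_zero hp, hp]; simp
  · rw [← dimVec_red hn, ← ih, ← shift_red hn, ← cg_red_zero hn, Finsupp.single_add, add_assoc]

theorem totalDim_shift (i : ℤ) (p : Multisegment) :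
    totalDim (shift i p) + cg p i 0 = totalDim p := by
  refine shift_rec (i := i) (P := fun p => totalDim (shift i p) + cg p i 0 = totalDim p)
    (fun p hp => ?_) (fun p n hn ih => ?_) p
  · rw [shift_of_cg_eq_zero hp, hp]; simp
  · have h1 := totalDim_red hn
    have h2 := cg_red_zero hn
    rw [shift_red hn] at ih
    omega

/-- The degeneration order in combinatorial form. -/
def RkLE (p m : Multisegment) : Prop :=
  dimVec p = dimVec m ∧ ∀ i j, i ≤ j → rk p i j ≤ rk m i j

theorem degLE_iff_rkLE (k : Type u) [Field k] {m m' : Multisegment} :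
    DegLE k m m' ↔ RkLE m m' := by
  rw [degLE_iff, RkLE, DFunLike.ext_iff]
  simp only [dimVec_apply]

theorem RkLE.refl (m : Multisegment) : RkLE m m := ⟨rfl, fun _ _ _ => le_rfl⟩

theorem RkLE.trans {a b c : Multisegment} (h : RkLE a b) (h' : RkLE b c) : RkLE a c :=
  ⟨h.1.trans h'.1, fun i j hij => (h.2 i j hij).trans (h'.2 i j hij)⟩

theorem RkLE.antisymm {a b : Multisegment} (h : RkLE a b) (h' : RkLE b a) : a = b :=
  eq_of_rk_eq fun i j hij => le_antisymm (h.2 i j hij) (h'.2 i j hij)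

theorem finite_rkLE (m : Multisegment) : {p | RkLE p m}.Finite :=
  (finite_dimVec_eq (dimVec m)).subset fun _ h => h.1

theorem ncard_rkLE_lt {p m : Multisegment} (h : RkLE p m) (hne : p ≠ m) :
    {x | RkLE x p}.ncard < {x | RkLE x m}.ncard := by
  refine Set.ncard_lt_ncard ⟨fun x hx => RkLE.trans hx h, fun hc => ?_⟩ (finite_rkLE m)
  exact hne (h.antisymm (hc (RkLE.refl m)))

theorem eq_zero_of_cg (m : Multisegment) (h : ∀ i, cg m i 0 = 0) : m = 0 := by
  ext ⟨i, l⟩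
  have h1 : cg m i l.natPred = 0 :=
    Nat.le_zero.mp ((cg_antitone m i (Nat.zero_le _)).trans (h i).le)
  have h2 := cg_succ m i l.natPred
  rw [h1, mu, PNat.succPNat_natPred] at h2
  simp only [Finsupp.coe_zero, Pi.zero_apply]
  omega

theorem totalDim_eq_degree (x : Multisegment) : totalDim x = (dimVec x).degree := by
  unfold totalDim dimVec Finsupp.sum
  rw [map_sum]
  refine Finset.sum_congr rfl fun q _ => ?_
  rw [map_nsmul, map_sum]
  simp

/-- Induction on multisegments: a nonzero `m` is reached from smaller ones in the degeneration
order, and from the multisegment obtained by shortening all segments with the largest start. -/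
theorem multisegment_induction {P : Multisegment → Prop} (h0 : P 0)
    (h1 : ∀ m i, cg m i 0 ≠ 0 → (∀ j, i < j → cg m j 0 = 0) → P (shift i m) →
      (∀ p, RkLE p m → p ≠ m → P p) → P m) (m : Multisegment) : P m := by
  generalize hd : totalDim m = d
  induction d using Nat.strong_induction_on generalizing m with
  | _ d ihd =>
  generalize hr : {x | RkLE x m}.ncard = r
  induction r using Nat.strong_induction_on generalizing m with
  | _ r ihr =>
  by_cases hm : m = 0
  · rw [hm]; exact h0
  have hne : ∃ i, cg m i 0 ≠ 0 := by
    by_contra hc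
    push Not at hc
    exact hm (eq_zero_of_cg m hc)
  obtain ⟨B, hB⟩ := (m.support.image Prod.fst).bddAbove
  have hbd : ∀ i, cg m i 0 ≠ 0 → i ≤ B := fun i hi => by
    by_contra hc
    refine hi ?_
    unfold cg
    rw [wt_eq_zero_iff]
    intro p hp
    have := hB (Finset.mem_coe.mpr (Finset.mem_image_of_mem Prod.fst
      (Finsupp.mem_support_iff.mpr hp)))
    rw [if_neg]; omega
  obtain ⟨i, hi, hmax⟩ := Int.exists_greatest_of_bdd ⟨B, hbd⟩ hne
  refine h1 m i hi (fun j hj => ?_) (ihd _ ?_ _ rfl) (fun p hp hne => ?_)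
  · by_contra hc
    have := hmax j hc
    omega
  · have := totalDim_shift i m
    omega
  · refine ihr _ (hr ▸ ncard_rkLE_lt hp hne) p ?_ rfl
    rw [totalDim_eq_degree, hp.1, ← totalDim_eq_degree, hd]

/-! ### Quantum integers -/

section Quantum

variable {R : Type*} [CommRing R]

/-- The quantum integer `1 + t + ⋯ + t^{n-1}`. -/
def qn (t : R) (n : ℕ) : R := ∑ j ∈ Finset.range n, t ^ j

@[simp] theorem qn_zero (t : R) : qn t 0 = 0 := rfl

@[simp] theorem qn_one (t : R) : qn t 1 = 1 := by simp [qn]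

theorem qn_add (t : R) (a b : ℕ) : qn t (a + b) = qn t a + t ^ a * qn t b := by
  simp only [qn, Finset.sum_range_add, Finset.mul_sum, pow_add]

theorem qn_mul (t : R) (n : ℕ) : (t - 1) * qn t n = t ^ n - 1 := mul_geom_sum t n

theorem map_qn {S : Type*} [CommRing S] (f : R →+* S) (t : R) (n : ℕ) :
    f (qn t n) = qn (f t) n := by simp [qn]

/-- The quantum factorial. -/
def qfact (t : R) : ℕ → R
  | 0 => 1
  | n + 1 => qn t (n + 1) * qfact t n

/-- The products of nonzero quantum integers. -/
def qProducts (t : R) : Submonoid R := Submonoid.closure (Set.range fun n => qn t (n + 1))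

theorem qfact_mem (t : R) (n : ℕ) : qfact t n ∈ qProducts t := by
  induction n with
  | zero => exact Submonoid.one_mem _
  | succ n ih => exact Submonoid.mul_mem _ (Submonoid.subset_closure ⟨n, rfl⟩) ih

/-- The Hall polynomial for the quotient `S_i` of `M(p)` by a submodule of type `red p i n`. -/
def simpleCoeff (t : R) (p : Multisegment) (i : ℤ) (n : ℕ) : R :=
  t ^ cg p i (n + 1) * qn t (mu p i n)

theorem simpleCoeff_eq_zero (t : R) {p : Multisegment} {i : ℤ} {n : ℕ} (h : ¬ segN i (n + 1) ≤ p) :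
    simpleCoeff t p i n = 0 := by
  rw [segN_le_iff, not_not] at h
  rw [simpleCoeff, h, qn_zero, mul_zero]

theorem segN_le_of_simpleCoeff {t : R} {p : Multisegment} {i : ℤ} {n : ℕ}
    (h : simpleCoeff t p i n ≠ 0) : segN i (n + 1) ≤ p := by
  by_contra hc
  exact h (simpleCoeff_eq_zero t hc)

theorem map_simpleCoeff {S : Type*} [CommRing S] (f : R →+* S) (t : R) (p : Multisegment) (i : ℤ)
    (n : ℕ) : f (simpleCoeff t p i n) = simpleCoeff (f t) p i n := by
  simp [simpleCoeff, map_qn]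

theorem sum_simpleCoeff (t : R) (p : Multisegment) (i : ℤ) :
    ∑ n ∈ Finset.range (totalDim p), simpleCoeff t p i n = qn t (cg p i 0) := by
  have h : ∀ N, ∑ n ∈ Finset.range N, simpleCoeff t p i n + qn t (cg p i N) = qn t (cg p i 0) := by
    intro N
    induction N with
    | zero => simp
    | succ N ih =>
      rw [← ih, Finset.sum_range_succ, cg_succ p i N, add_comm (mu p i N), qn_add, simpleCoeff]
      ring
  rw [← h (totalDim p), cg_eq_zero_of_le le_rfl, qn_zero, add_zero]

end Quantum

/-! ### The operators of multiplication by the simple generators -/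

section Operators

variable {R : Type} [CommRing R]

theorem exists_mem_of_sum_simple_ne_zero {t : R} {y : Hall R} {i : ℤ} {p : Multisegment}
    (h : ∑ n ∈ Finset.range (totalDim p), simpleCoeff t p i n * y (red p i n) ≠ 0) :
    ∃ n, segN i (n + 1) ≤ p ∧ red p i n ∈ y.support := by
  obtain ⟨n, _, hne⟩ := Finset.exists_ne_zero_of_sum_ne_zero h
  exact ⟨n, segN_le_of_simpleCoeff (left_ne_zero_of_mul hne),
    Finsupp.mem_support_iff.mpr (right_ne_zero_of_mul hne)⟩

open Classical in
/-- The operator of multiplication by `u_i` from the left in the untwisted Hall algebra with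
parameter `t`, twisted by a function `c` of the dimension vector of the product. -/
def lop (t : R) (c : (ℤ →₀ ℕ) → R) (i : ℤ) : Hall R →ₗ[R] Hall R where
  toFun y := Finsupp.onFinset
    (y.support.biUnion fun m => (Finset.range (totalDim m + 1)).image (ext m i))
    (fun p => c (dimVec p) *
      ∑ n ∈ Finset.range (totalDim p), simpleCoeff t p i n * y (red p i n)) fun p hp => by
      obtain ⟨n, h1, h2⟩ := exists_mem_of_sum_simple_ne_zero (right_ne_zero_of_mul hp)
      rw [Finset.mem_biUnion]
      refine ⟨_, h2, Finset.mem_image.mpr ⟨n, Finset.mem_range.mpr ?_, ext_red h1⟩⟩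
      rw [totalDim_red h1]
      have := wt_mono (fun p => (p.2 : ℕ)) h1
      change totalDim _ ≤ totalDim _ at this
      rw [totalDim_segN] at this
      omega
  map_add' y z := by
    ext p
    simp [mul_add, Finset.sum_add_distrib]
  map_smul' a y := by
    ext p
    simp only [Finsupp.onFinset_apply, Finsupp.smul_apply, smul_eq_mul, Finset.mul_sum,
      RingHom.id_apply]
    exact Finset.sum_congr rfl fun _ _ => by ring

theorem lop_apply (t : R) (c : (ℤ →₀ ℕ) → R) (i : ℤ) (y : Hall R) (p : Multisegment) :
    lop t c i y p = c (dimVec p) *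
      ∑ n ∈ Finset.range (totalDim p), simpleCoeff t p i n * y (red p i n) := rfl

theorem mem_support_lop {t : R} {c : (ℤ →₀ ℕ) → R} {i : ℤ} {y : Hall R} {p : Multisegment}
    (h : p ∈ (lop t c i y).support) : ∃ n, segN i (n + 1) ≤ p ∧ red p i n ∈ y.support := by
  rw [Finsupp.mem_support_iff, lop_apply] at h
  exact exists_mem_of_sum_simple_ne_zero (right_ne_zero_of_mul h)

theorem mem_support_lop_pow {t : R} {c : (ℤ →₀ ℕ) → R} {i : ℤ} {y : Hall R} (a : ℕ)
    {p : Multisegment} (h : p ∈ ((lop t c i ^ a) y).support) :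
    ∃ p' ∈ y.support, dimVec p = dimVec p' + Finsupp.single i a ∧
      ∀ j l, j ≤ l → j ≠ i → rk p j l = rk p' j l := by
  induction a generalizing p with
  | zero => exact ⟨p, h, by simp, fun _ _ _ _ => rfl⟩
  | succ a ih =>
    rw [pow_succ', Module.End.mul_apply] at h
    obtain ⟨n, h1, h2⟩ := mem_support_lop h
    obtain ⟨p', hp', h3, h4⟩ := ih h2
    refine ⟨p', hp', ?_, fun j l hjl hj => ?_⟩
    · rw [← dimVec_red h1, h3, Finsupp.single_add, add_assoc]
    · rw [← h4 j l hjl hj, ← rk_red h1 hjl, if_neg (by tauto), add_zero]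

/-- The leading coefficient of the `a`-th power of multiplication by `u_i`, where `a` is the number
of segments with start `i`. -/
theorem lop_pow_leading (t : R) (i : ℤ) (m : Multisegment) :
    (lop t 1 i ^ cg m i 0) (uBasis R (shift i m)) m = qfact t (cg m i 0) := by
  generalize ha : cg m i 0 = a
  induction a generalizing m with
  | zero => simp [shift_of_cg_eq_zero ha, uBasis, qfact]
  | succ a ih =>
    rw [pow_succ', Module.End.mul_apply, lop_apply, Pi.one_apply, one_mul]
    have : ∀ n ∈ Finset.range (totalDim m), simpleCoeff t m i n *
        (lop t 1 i ^ a) (uBasis R (shift i m)) (red m i n) =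
        simpleCoeff t m i n * qfact t a := fun n _ => by
      by_cases h : segN i (n + 1) ≤ m
      · rw [← shift_red h, ih]
        have := cg_red_zero h
        omega
      · rw [simpleCoeff_eq_zero t h, zero_mul, zero_mul]
    rw [Finset.sum_congr rfl this, ← Finset.sum_mul, sum_simpleCoeff, ha]
    rfl

/-- If no segment of `m` starts at `i + 1`, then `m` dominates all `p` which arise by lengthening
segments at `i` from multisegments dominated by `shift i m`. -/
theorem rkLE_of_lengthening {m p p' : Multisegment} {i : ℤ} (hi : cg m (i + 1) 0 = 0)
    (hp' : RkLE p' (shift i m)) (hd : dimVec p = dimVec p' + Finsupp.single i (cg m i 0))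
    (hr : ∀ j l, j ≤ l → j ≠ i → rk p j l = rk p' j l) : RkLE p m := by
  have hdim : dimVec p = dimVec m := by rw [hd, hp'.1, dimVec_shift]
  have h1 : ∀ j l, j ≤ l → j ≠ i → rk p j l ≤ rk m j l := fun j l hjl hj => by
    rw [hr j l hjl hj, ← rk_shift i m j l hjl hj]
    exact hp'.2 j l hjl
  refine ⟨hdim, fun j l hjl => ?_⟩
  by_cases hj : j = i
  · subst hj
    rcases hjl.eq_or_lt with h | h
    · subst h
      rw [← dimVec_apply, ← dimVec_apply, hdim]
    · have h2 := h1 (j + 1) l (by omega) (by omega)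
      obtain ⟨n, rfl⟩ := Int.le.dest (show j + 1 ≤ l by omega)
      have h3 := rk_eq_add_cg m (j + 1) n
      have h4 := rk_eq_add_cg p (j + 1) n
      have h5 := cg_antitone m (j + 1) (Nat.zero_le n)
      rw [add_sub_cancel_right] at h3 h4
      omega
  · exact h1 j l hjl hj

/-- In the situation of `rkLE_of_lengthening`, `p = m` is only possible for `p' = shift i m`. -/
theorem eq_shift_of_lengthening {m p' : Multisegment} {i : ℤ}
    (hp' : RkLE p' (shift i m)) (hr : ∀ j l, j ≤ l → j ≠ i → rk m j l = rk p' j l) :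
    p' = shift i m := by
  refine hp'.antisymm ⟨hp'.1.symm, fun j l hjl => ?_⟩
  have h1 : ∀ j l, j ≤ l → j ≠ i → rk (shift i m) j l = rk p' j l := fun j l hjl hj => by
    rw [rk_shift i m j l hjl hj, hr j l hjl hj]
  by_cases hj : j = i
  · subst hj
    obtain ⟨n, rfl⟩ := Int.le.dest hjl
    have h2 := rk_eq_add_cg (shift j m) j n
    have h3 := rk_eq_add_cg p' j n
    have h4 := h1 (j - 1) (j + n) (by omega) (by omega)
    have h5 : cg (shift j m) j n = 0 := by
      refine Nat.le_zero.mp ((cg_antitone _ _ (Nat.zero_le n)).trans ?_)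
      refine shift_rec (i := j) (P := fun m => cg (shift j m) j 0 ≤ 0) (fun p hp => ?_)
        (fun p n hn ih => ?_) m
      · rw [shift_of_cg_eq_zero hp, hp]
      · rwa [← shift_red hn]
    omega
  · rw [h1 j l hjl hj]

end Operators

section Generation

variable {R : Type} [CommRing R]

theorem lop_eq_smul (t : R) (c : (ℤ →₀ ℕ) → R) (i : ℤ) {y : Hall R} {d : ℤ →₀ ℕ}
    (hy : ∀ p ∈ y.support, dimVec p = d) :
    lop t c i y = c (d + Finsupp.single i 1) • lop t 1 i y := by
  ext p
  rw [Finsupp.smul_apply, lop_apply, lop_apply, Pi.one_apply, one_mul, smul_eq_mul]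
  by_cases h : ∑ n ∈ Finset.range (totalDim p), simpleCoeff t p i n * y (red p i n) = 0
  · rw [h, mul_zero, mul_zero]
  · obtain ⟨n, h1, h2⟩ := exists_mem_of_sum_simple_ne_zero h
    rw [← dimVec_red h1, hy _ h2]

theorem exists_smul_mem_of_forall {S : Submonoid R} {W : Submodule R (Hall R)} {z : Hall R}
    (h : ∀ p ∈ z.support, ∃ D ∈ S, D • uBasis R p ∈ W) : ∃ D ∈ S, D • z ∈ W := by
  classical
  have key : ∀ T : Finset Multisegment, T ⊆ z.support →
      ∃ D ∈ S, D • (∑ p ∈ T, z p • uBasis R p) ∈ W := by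
    intro T
    induction T using Finset.induction_on with
    | empty => exact fun _ => ⟨1, S.one_mem, by simp⟩
    | insert p T hp ih =>
      intro hT
      obtain ⟨D, hD, hDW⟩ := ih ((Finset.subset_insert _ _).trans hT)
      obtain ⟨E, hE, hEW⟩ := h p (hT (Finset.mem_insert_self _ _))
      refine ⟨D * E, S.mul_mem hD hE, ?_⟩
      rw [Finset.sum_insert hp, smul_add]
      refine W.add_mem ?_ ?_
      · have := W.smul_mem (D * z p) hEW
        rwa [smul_smul, mul_right_comm, ← smul_smul] at this
      · have := W.smul_mem E hDW
        rwa [smul_smul, mul_comm E D] at this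
  obtain ⟨D, hD, hDW⟩ := key z.support subset_rfl
  refine ⟨D, hD, ?_⟩
  convert hDW
  conv_lhs => rw [← z.sum_single]
  refine Finset.sum_congr rfl fun p _ => ?_
  simp [uBasis]

/-- Up to products of quantum integers, every basis element lies in the submodule generated from
`u_0` by the operators of multiplication by the simple generators. -/
theorem exists_smul_uBasis_mem (t : R) (c : ℤ → (ℤ →₀ ℕ) → R) (hc : ∀ i d, IsUnit (c i d))
    (W : Submodule R (Hall R)) (h0 : uBasis R 0 ∈ W) (hW : ∀ i, ∀ y ∈ W, lop t (c i) i y ∈ W)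
    (m : Multisegment) : ∃ D ∈ qProducts t, D • uBasis R m ∈ W := by
  induction m using multisegment_induction with
  | h0 => exact ⟨1, Submonoid.one_mem _, by rwa [one_smul]⟩
  | h1 m i hi hmax ih1 ih2 =>
    obtain ⟨D, hD, hDW⟩ := ih1
    have hpow : ∀ a, (lop t 1 i ^ a) (D • uBasis R (shift i m)) ∈ W := by
      intro a
      induction a with
      | zero => exact hDW
      | succ a ih =>
        have hhom : ∀ p ∈ ((lop t 1 i ^ a) (D • uBasis R (shift i m))).support,
            dimVec p = dimVec (shift i m) + Finsupp.single i a := fun p hp => by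
          obtain ⟨p', hp', h1, -⟩ := mem_support_lop_pow a hp
          have hp' := Finsupp.support_single_subset (Finsupp.support_smul hp')
          rw [Finset.mem_singleton] at hp'
          rw [h1, hp']
        have h1 := hW i _ ih
        rw [lop_eq_smul t (c i) i hhom] at h1
        rw [pow_succ', Module.End.mul_apply]
        obtain ⟨u, hu⟩ := hc i (dimVec (shift i m) + Finsupp.single i a + Finsupp.single i 1)
        rw [← hu] at h1
        have h2 := W.smul_mem ((u⁻¹ : Rˣ) : R) h1
        rwa [smul_smul, Units.inv_mul, one_smul] at h2
    set y := (lop t 1 i ^ cg m i 0) (uBasis R (shift i m)) with hy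
    have hlead : y m = qfact t (cg m i 0) := lop_pow_leading t i m
    have hlow : ∀ p ∈ (y - (y m) • uBasis R m).support, RkLE p m ∧ p ≠ m := by
      intro p hp
      have hne : p ≠ m := by
        rintro rfl
        rw [Finsupp.mem_support_iff] at hp
        exact hp (by simp [uBasis])
      refine ⟨?_, hne⟩
      have hpy : p ∈ y.support := by
        rw [Finsupp.mem_support_iff] at hp ⊢
        simpa [uBasis, Finsupp.single_apply, hne.symm] using hp
      obtain ⟨p', hp', h1, h2⟩ := mem_support_lop_pow _ hpy
      have hp' := Finsupp.support_single_subset hp'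
      rw [Finset.mem_singleton] at hp'
      subst hp'
      exact rkLE_of_lengthening (hmax _ (by omega)) (RkLE.refl _) h1 h2
    obtain ⟨E, hE, hEW⟩ := exists_smul_mem_of_forall fun p hp =>
      ih2 p (hlow p hp).1 (hlow p hp).2
    refine ⟨E * (D * qfact t (cg m i 0)), Submonoid.mul_mem _ hE
      (Submonoid.mul_mem _ hD (qfact_mem _ _)), ?_⟩
    have h1 := hpow (cg m i 0)
    rw [map_smul, ← hy] at h1
    have h2 := W.sub_mem (W.smul_mem E h1) (W.smul_mem D hEW)
    convert h2 using 1
    rw [hlead]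
    module

end Generation

/-! ### Existence of Hall polynomials -/

theorem one_lt_card (k : Type*) [Field k] [Finite k] : (1 : ℤ) < Nat.card k := by
  exact_mod_cast Finite.one_lt_card

open Classical in
theorem hallNumber_simple (k : Type u) [Field k] [Finite k] (i : ℤ) (m p : Multisegment) :
    (hallNumber k (seg i 1) m p : ℤ) = ∑ n ∈ Finset.range (totalDim p),
      simpleCoeff (Nat.card k : ℤ) p i n * if m = red p i n then 1 else 0 := by
  have hlt : ∀ n, segN i (n + 1) ≤ p → n ∈ Finset.range (totalDim p) := fun n hn => by
    have := wt_mono (fun p => (p.2 : ℕ)) hn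
    change totalDim _ ≤ totalDim _ at this
    rw [totalDim_segN] at this
    rw [Finset.mem_range]
    omega
  by_cases h : ∃ n, segN i (n + 1) ≤ p ∧ m = red p i n
  · obtain ⟨n, hn, rfl⟩ := h
    rw [Finset.sum_eq_single_of_mem n (hlt n hn), if_pos rfl, mul_one]
    · have h1 := hallNumber_simple_red (k := k) hn
      have h2 := one_lt_card k
      have h3 := qn_mul (Nat.card k : ℤ) (mu p i n)
      refine mul_left_cancel₀ (show (Nat.card k : ℤ) - 1 ≠ 0 by omega) ?_
      rw [h1, simpleCoeff, mul_left_comm, h3, cg_succ p i n, pow_add]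
      ring
    · intro n' _ hne
      by_cases h' : segN i (n' + 1) ≤ p
      · rw [if_neg fun e => hne (red_injective hn h' e).symm, mul_zero]
      · rw [simpleCoeff_eq_zero _ h', zero_mul]
  · rw [Finset.sum_eq_zero]
    · by_contra hc
      exact h (exists_red_of_hallNumber_ne_zero (by exact_mod_cast hc))
    · intro n _
      by_cases h' : segN i (n + 1) ≤ p
      · rw [if_neg fun e => h ⟨n, h', e⟩, mul_zero]
      · rw [simpleCoeff_eq_zero _ h', zero_mul]

/-- Summation against the Hall numbers with a simple quotient. -/
theorem finsum_hallNumber_simple (k : Type u) [Field k] [Finite k] (i : ℤ) (x : Multisegment)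
    (g : Multisegment → ℤ) :
    ∑ᶠ p, (hallNumber k (seg i 1) p x : ℤ) * g p = ∑ n ∈ Finset.range (totalDim x),
      simpleCoeff (Nat.card k : ℤ) x i n * g (red x i n) := by
  classical
  simp only [hallNumber_simple]
  rw [finsum_eq_sum_of_support_subset (s := (Finset.range (totalDim x)).image (red x i))]
  · simp only [Finset.sum_mul]
    rw [Finset.sum_comm]
    refine Finset.sum_congr rfl fun n hn => ?_
    rw [Finset.sum_eq_single_of_mem (red x i n) (Finset.mem_image_of_mem _ hn)]
    · simp
    · intro p _ hp
      rw [if_neg hp]; simp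
  · intro p hp
    obtain ⟨n, hn, hne⟩ := Finset.exists_ne_zero_of_sum_ne_zero (left_ne_zero_of_mul hp)
    have : p = red x i n := by
      by_contra hc
      exact hne (by rw [if_neg hc, mul_zero])
    exact Finset.mem_coe.mpr (Finset.mem_image.mpr ⟨n, hn, this.symm⟩)

/-- The coefficient at `u_x` of the product of `y`, evaluated at `|k|`, with `u_{m'}` in the
Hall algebra of `k`. -/
def hallEval (k : Type u) [Field k] (m' : Multisegment) (x : Multisegment) :
    Hall (Polynomial ℤ) →+ ℤ :=
  Finsupp.liftAddHom fun m => (AddMonoidHom.mulRight (hallNumber k m m' x : ℤ)).comp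
    (Polynomial.evalRingHom (Nat.card k : ℤ)).toAddMonoidHom

theorem hallEval_single (k : Type u) [Field k] (m' x m : Multisegment) (a : Polynomial ℤ) :
    hallEval k m' x (Finsupp.single m a) = a.eval (Nat.card k : ℤ) * hallNumber k m m' x := by
  rw [hallEval, Finsupp.liftAddHom_apply_single]
  rfl

theorem hallEval_smul (k : Type u) [Field k] (m' x : Multisegment) (a : Polynomial ℤ)
    (y : Hall (Polynomial ℤ)) :
    hallEval k m' x (a • y) = a.eval (Nat.card k : ℤ) * hallEval k m' x y := by
  induction y using Finsupp.induction_linear with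
  | zero => simp
  | add y z hy hz => rw [smul_add, map_add, map_add, hy, hz, mul_add]
  | single m b => rw [Finsupp.smul_single, hallEval_single, hallEval_single, smul_eq_mul,
      Polynomial.eval_mul, mul_assoc]

theorem lop_uBasis_apply {R : Type} [CommRing R] (t : R) (i : ℤ) (m p : Multisegment) :
    open Classical in lop t 1 i (uBasis R m) p = ∑ n ∈ Finset.range (totalDim p),
      simpleCoeff t p i n * if m = red p i n then 1 else 0 := by
  rw [lop_apply, Pi.one_apply, one_mul]
  simp only [uBasis, Finsupp.single_apply]

theorem hallEval_lop (k : Type u) [Field k] [Finite k] (m' x : Multisegment) (i : ℤ)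
    (y : Hall (Polynomial ℤ)) :
    hallEval k m' x (lop Polynomial.X 1 i y) = ∑ n ∈ Finset.range (totalDim x),
      simpleCoeff (Nat.card k : ℤ) x i n * hallEval k m' (red x i n) y := by
  classical
  induction y using Finsupp.induction_linear with
  | zero => simp
  | add y z hy hz => simp only [map_add, hy, hz, mul_add, Finset.sum_add_distrib]
  | single m a =>
    have hs : (Finsupp.single m a : Hall (Polynomial ℤ)) = a • uBasis _ m := by simp [uBasis]
    rw [hs, map_smul]
    simp only [hallEval_smul]
    have h1 : hallEval k m' x (lop Polynomial.X 1 i (uBasis (Polynomial ℤ) m)) =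
        ∑ᶠ p, (hallNumber k (seg i 1) m p : ℤ) * hallNumber k p m' x := by
      set L := lop Polynomial.X 1 i (uBasis (Polynomial ℤ) m) with hL
      have h2 : ∀ p, (hallNumber k (seg i 1) m p : ℤ) = (L p).eval (Nat.card k : ℤ) := fun p => by
        rw [hL, lop_uBasis_apply, hallNumber_simple, Polynomial.eval_finsetSum]
        refine Finset.sum_congr rfl fun n _ => ?_
        rw [Polynomial.eval_mul]
        congr 1
        · have := map_simpleCoeff (Polynomial.evalRingHom (Nat.card k : ℤ)) Polynomial.X p i n
          rw [Polynomial.coe_evalRingHom, Polynomial.eval_X] at this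
          exact this.symm
        · split_ifs <;> simp
      simp only [h2]
      rw [finsum_eq_sum_of_support_subset (s := L.support)]
      · conv_lhs => rw [← L.sum_single]
        rw [Finsupp.sum, map_sum]
        simp only [hallEval_single]
      · intro p hp
        rw [Finset.mem_coe, Finsupp.mem_support_iff]
        intro hc
        exact hp (by simp [hc])
    have h3 : ∑ᶠ p, (hallNumber k (seg i 1) m p : ℤ) * hallNumber k p m' x =
        ∑ᶠ p, (hallNumber k (seg i 1) p x : ℤ) * hallNumber k m m' p := by
      have := congrArg (Nat.cast : ℕ → ℤ) (hallNumber_assoc (k := k) (seg i 1) m m' x)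
      have hinj : Function.Injective (Nat.castAddMonoidHom ℤ) := Nat.cast_injective
      have hcast : ∀ f : Multisegment → ℕ, ((∑ᶠ p, f p : ℕ) : ℤ) = ∑ᶠ p, (f p : ℤ) := fun f =>
        AddMonoidHom.map_finsum_of_injective (Nat.castAddMonoidHom ℤ) hinj f
      rw [hcast, hcast] at this
      exact_mod_cast this
    rw [h1, h3, finsum_hallNumber_simple, Finset.mul_sum]
    refine Finset.sum_congr rfl fun n _ => ?_
    rw [uBasis, hallEval_single, Polynomial.eval_one, one_mul]
    ring

theorem hallNumber_zero_left (k : Type u) [Field k] [Finite k] (m x : Multisegment) :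
    hallNumber k 0 m x = if m = x then 1 else 0 := by
  have htop : ∀ U : (repOf k x).Sub, U.quotient.Iso (repOf k 0) → ∀ i, U.carrier i = ⊤ := by
    intro U h i
    have h1 := U.rank_quotient i i
    rw [h.rank_eq, rank_repOf _ le_rfl, QRep.tr_self, LinearMap.range_id, top_inf_eq,
      QRep.rank_self] at h1
    refine Submodule.eq_top_of_finrank_eq ?_
    simpa [rk] using h1
  let T : (repOf k x).Sub := ⟨fun _ => ⊤, fun _ _ _ => trivial⟩
  have hT1 : T.toRep.Iso (repOf k x) :=
    ⟨fun i => Submodule.topEquiv, fun _ _ => rfl⟩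
  have hT2 : T.quotient.Iso (repOf k 0) := by
    rw [iso_repOf_iff (T.isFiniteDim_quotient (isFiniteDim_repOf x))]
    intro i j hij
    have h1 := T.rank_quotient i j
    have h2 : T.carrier j = ⊤ := rfl
    rw [h2, inf_top_eq] at h1
    unfold QRep.rank at h1 ⊢
    simp only [rk, wt_zero]
    omega
  unfold hallNumber
  split_ifs with h
  · subst h
    rw [Set.ncard_eq_one]
    refine ⟨T, Set.eq_singleton_iff_unique_mem.mpr ⟨⟨hT2, hT1⟩, fun U hU => ?_⟩⟩
    exact QRep.Sub.ext fun i => htop U hU.1 i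
  · rw [Set.ncard_eq_zero (@Set.toFinite _ _ (@Subtype.finite _ (QRep.finite_sub (isFiniteDim_repOf x)) _))]
    rw [Set.eq_empty_iff_forall_notMem]
    rintro U ⟨h1, h2⟩
    have : U = T := QRep.Sub.ext fun i => htop U h1 i
    subst this
    exact h (eq_of_iso_repOf (h2.symm.trans hT1))

theorem monic_of_mem_qProducts {D : Polynomial ℤ} (h : D ∈ qProducts (Polynomial.X : Polynomial ℤ)) :
    D.Monic := by
  induction h using Submonoid.closure_induction with
  | mem x hx =>
    obtain ⟨n, rfl⟩ := hx
    exact Polynomial.monic_geom_sum_X (Nat.succ_ne_zero n)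
  | one => exact Polynomial.monic_one
  | mul x y _ _ hx hy => exact hx.mul hy

theorem eval_pos_of_mem_qProducts {D : Polynomial ℤ}
    (h : D ∈ qProducts (Polynomial.X : Polynomial ℤ)) {q : ℤ} (hq : 1 < q) : 0 < D.eval q := by
  induction h using Submonoid.closure_induction with
  | mem x hx =>
    obtain ⟨n, rfl⟩ := hx
    simp only [qn, Polynomial.eval_finsetSum, Polynomial.eval_pow, Polynomial.eval_X]
    exact Finset.sum_pos (fun _ _ => by positivity) (by simp)
  | one => simp
  | mul x y _ _ hx hy => rw [Polynomial.eval_mul]; positivity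

/-- If a monic polynomial `D` divides `N` at infinitely many integers, then it divides `N`. -/
theorem modByMonic_eq_zero_of_dvd_eval {D N : Polynomial ℤ} (hD : D.Monic)
    (h : ∃ᶠ n : ℕ in Filter.atTop, D.eval (n : ℤ) ∣ N.eval (n : ℤ)) : N %ₘ D = 0 := by
  set Rm := N %ₘ D with hR
  have hdeg : Rm.degree < D.degree := Polynomial.degree_modByMonic_lt N hD
  have h1 : ∃ᶠ n : ℕ in Filter.atTop, D.eval (n : ℤ) ∣ Rm.eval (n : ℤ) := by
    refine h.mono fun n hn => ?_
    have h2 := congrArg (Polynomial.eval (n : ℤ)) (Polynomial.modByMonic_add_div N D)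
    rw [Polynomial.eval_add, Polynomial.eval_mul] at h2
    rw [← h2] at hn
    exact (Int.dvd_iff_dvd_of_dvd_add hn).mpr (dvd_mul_right _ _)
  have hinj : Function.Injective (Int.castRingHom ℝ) := Int.cast_injective
  have hlim := (Polynomial.div_tendsto_atTop_zero_of_degree_lt (Rm.map (Int.castRingHom ℝ))
    (D.map (Int.castRingHom ℝ)) (by
      rwa [Polynomial.degree_map_eq_of_injective hinj,
        Polynomial.degree_map_eq_of_injective hinj])).comp tendsto_natCast_atTop_atTop
  have hev := hlim.eventually (Metric.ball_mem_nhds (0 : ℝ) one_pos)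
  have hev2 : ∀ᶠ n : ℕ in Filter.atTop, D.eval (n : ℤ) ∣ Rm.eval (n : ℤ) → Rm.eval (n : ℤ) = 0 := by
    have hDne : ∀ᶠ n : ℕ in Filter.atTop, D.eval (n : ℤ) ≠ 0 := by
      have hfin : {n : ℕ | D.eval (n : ℤ) = 0}.Finite := by
        refine Set.Finite.of_finite_image (f := (Nat.cast : ℕ → ℤ)) ?_ Nat.cast_injective.injOn
        refine (Polynomial.finite_setOfPred_isRoot hD.ne_zero).subset ?_
        rintro _ ⟨n, hn, rfl⟩
        exact hn
      have := hfin.compl_mem_cofinite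
      rwa [Nat.cofinite_eq_atTop] at this
    filter_upwards [hev, hDne] with n hn hDn hdvd
    by_contra hne
    have h3 : |D.eval (n : ℤ)| ≤ |Rm.eval (n : ℤ)| := by
      exact Int.le_of_dvd (abs_pos.mpr hne) ((abs_dvd_abs _ _).mpr hdvd)
    simp only [Function.comp_apply, dist_zero_right] at hn
    rw [Polynomial.eval_natCast_map, Polynomial.eval_natCast_map, norm_div,
      div_lt_one (by simpa using hDn)] at hn
    simp only [eq_intCast, Real.norm_eq_abs] at hn
    have : |Rm.eval (n : ℤ)| < |D.eval (n : ℤ)| := by exact_mod_cast hn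
    omega
  have h4 : ∃ᶠ n : ℕ in Filter.atTop, Rm.eval (n : ℤ) = 0 :=
    (h1.and_eventually hev2).mono fun n hn => hn.2 hn.1
  by_contra hne
  have hfin : {n : ℕ | Rm.eval (n : ℤ) = 0}.Finite := by
    refine Set.Finite.of_finite_image (f := (Nat.cast : ℕ → ℤ)) ?_ Nat.cast_injective.injOn
    refine (Polynomial.finite_setOfPred_isRoot hne).subset ?_
    rintro _ ⟨n, hn, rfl⟩
    exact hn
  exact (Nat.frequently_atTop_iff_infinite.mp h4) hfin

/-- Existence of Hall polynomials. By associativity and the formula for simple quotients, the Hall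
numbers multiplied with a product `D` of quantum integers are values of a polynomial `N`; as `D` is
monic and divides `N` at all primes, it divides `N`. -/
theorem exists_isHallPoly (m m' x : Multisegment) : ∃ P, IsHallPoly m m' x P := by
  let W : Submodule (Polynomial ℤ) (Hall (Polynomial ℤ)) :=
    { carrier := {y | ∀ x, ∃ N : Polynomial ℤ, ∀ (k : Type) [Field k] [Finite k],
        hallEval k m' x y = N.eval (Nat.card k : ℤ)}
      add_mem' := fun {y z} hy hz x => by
        obtain ⟨N, hN⟩ := hy x
        obtain ⟨N', hN'⟩ := hz x
        exact ⟨N + N', fun k _ _ => by rw [map_add, hN, hN', Polynomial.eval_add]⟩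
      zero_mem' := fun x => ⟨0, fun k _ _ => by simp⟩
      smul_mem' := fun a y hy x => by
        obtain ⟨N, hN⟩ := hy x
        exact ⟨a * N, fun k _ _ => by rw [hallEval_smul, hN, Polynomial.eval_mul]⟩ }
  have h0 : uBasis (Polynomial ℤ) 0 ∈ W := fun x => by
    classical
    refine ⟨if m' = x then 1 else 0, fun k _ _ => ?_⟩
    rw [uBasis, hallEval_single, hallNumber_zero_left]
    split_ifs <;> simp
  have hW : ∀ i, ∀ y ∈ W, lop Polynomial.X 1 i y ∈ W := fun i y hy x => by
    choose N hN using hy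
    refine ⟨∑ n ∈ Finset.range (totalDim x), simpleCoeff Polynomial.X x i n * N (red x i n),
      fun k _ _ => ?_⟩
    rw [hallEval_lop, Polynomial.eval_finsetSum]
    refine Finset.sum_congr rfl fun n _ => ?_
    have := map_simpleCoeff (Polynomial.evalRingHom (Nat.card k : ℤ)) Polynomial.X x i n
    rw [Polynomial.coe_evalRingHom, Polynomial.eval_X] at this
    rw [Polynomial.eval_mul, this, hN]
  obtain ⟨D, hD, hDW⟩ := exists_smul_uBasis_mem Polynomial.X (fun _ => 1) (fun _ _ => isUnit_one) W
    h0 hW m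
  obtain ⟨N, hN⟩ := hDW x
  have hN' : ∀ (k : Type) [Field k] [Finite k],
      D.eval (Nat.card k : ℤ) * hallNumber k m m' x = N.eval (Nat.card k : ℤ) := fun k _ _ => by
    rw [← hN k, hallEval_smul, uBasis, hallEval_single, Polynomial.eval_one, one_mul]
  have hmod : N %ₘ D = 0 := by
    refine modByMonic_eq_zero_of_dvd_eval (monic_of_mem_qProducts hD) ?_
    rw [Nat.frequently_atTop_iff_infinite]
    refine Nat.infinite_setOfPred_prime.mono fun p hp => ?_
    have : Fact p.Prime := ⟨hp⟩
    have h1 := hN' (ZMod p)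
    rw [Nat.card_zmod] at h1
    exact ⟨_, h1.symm⟩
  have hdvd : D * (N /ₘ D) = N := by
    have := Polynomial.modByMonic_add_div N D
    rwa [hmod, zero_add] at this
  refine ⟨N /ₘ D, fun k _ _ => ?_⟩
  have h1 := hN' k
  rw [← hdvd, Polynomial.eval_mul] at h1
  exact (mul_left_cancel₀ (eval_pos_of_mem_qProducts hD (one_lt_card k)).ne' h1).symm

theorem isHallPoly_hallPoly (m m' p : Multisegment) : IsHallPoly m m' p (hallPoly m m' p) := by
  have h := exists_isHallPoly m m' p
  rw [hallPoly, dif_pos h]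
  exact h.choose_spec

/-- Polynomials which agree at the orders of all finite fields are equal. -/
theorem poly_eq_of_eval_card {P Q : Polynomial ℤ}
    (h : ∀ (k : Type) [Field k] [Finite k], P.eval (Nat.card k : ℤ) = Q.eval (Nat.card k : ℤ)) :
    P = Q := by
  refine Polynomial.eq_of_infinite_eval_eq P Q ?_
  refine (Nat.infinite_setOfPred_prime.image (Nat.cast_injective (R := ℤ)).injOn).mono ?_
  rintro _ ⟨p, hp, rfl⟩
  have : Fact (Nat.Prime p) := ⟨hp⟩
  have h1 := h (ZMod p)
  rwa [Nat.card_zmod] at h1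

/-! ### The generic Hall algebra as a module over its simple generators -/

theorem eulerForm_zero_left (e : ℤ →₀ ℕ) : eulerForm 0 e = 0 := by simp [eulerForm]

theorem eulerForm_add_left (d d' e : ℤ →₀ ℕ) :
    eulerForm (d + d') e = eulerForm d e + eulerForm d' e := by
  unfold eulerForm
  rw [Finsupp.sum_add_index'] <;> intros <;> push_cast <;> ring

theorem eulerForm_single (i : ℤ) (a : ℕ) (e : ℤ →₀ ℕ) :
    eulerForm (Finsupp.single i a) e = a * ((e i : ℤ) - e (i + 1)) := by
  unfold eulerForm
  rw [Finsupp.sum_single_index]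
  simp

theorem hallPoly_simple (i : ℤ) (m p : Multisegment) :
    open Classical in hallPoly (seg i 1) m p = ∑ n ∈ Finset.range (totalDim p),
      simpleCoeff Polynomial.X p i n * if m = red p i n then 1 else 0 := by
  refine poly_eq_of_eval_card fun k _ _ => ?_
  rw [isHallPoly_hallPoly (seg i 1) m p k, hallNumber_simple, Polynomial.eval_finsetSum]
  refine Finset.sum_congr rfl fun n _ => ?_
  have := map_simpleCoeff (Polynomial.evalRingHom (Nat.card k : ℤ)) Polynomial.X p i n
  rw [Polynomial.coe_evalRingHom, Polynomial.eval_X] at this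
  rw [Polynomial.eval_mul, this]
  split_ifs <;> simp

theorem hallPoly_zero_left (m x : Multisegment) :
    open Classical in hallPoly 0 m x = if m = x then 1 else 0 := by
  refine poly_eq_of_eval_card fun k _ _ => ?_
  rw [isHallPoly_hallPoly 0 m x k, hallNumber_zero_left]
  split_ifs <;> simp

theorem dimVec_of_hallPoly_ne_zero {m m' p : Multisegment} (h : hallPoly m m' p ≠ 0) :
    dimVec p = dimVec m + dimVec m' := by
  by_contra hc
  refine h (poly_eq_of_eval_card fun k _ _ => ?_)
  rw [isHallPoly_hallPoly m m' p k, Polynomial.eval_zero]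
  by_contra h0
  exact hc (dimVec_of_hallNumber_ne_zero (k := k) (by exact_mod_cast h0))

section Ring

variable {R : Type} [CommRing R]

theorem hallMul_uBasis_apply (v : Rˣ) (m m' x : Multisegment) :
    hallMul R v (uBasis R m) (uBasis R m') x =
      ((v ^ eulerForm (dimVec m) (dimVec m') : Rˣ) : R) *
        Polynomial.aeval ((v : R) ^ 2) (hallPoly m m' x) := by
  have h1 : hallMul R v (uBasis R m) (uBasis R m') =
      ((v ^ eulerForm (dimVec m) (dimVec m') : Rˣ) : R) •
      ∑ᶠ p : Multisegment, Polynomial.aeval ((v : R) ^ 2) (hallPoly m m' p) • uBasis R p := by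
    rw [hallMul, uBasis, uBasis, Finsupp.linearCombination_single, one_smul,
      Finsupp.linearCombination_single, one_smul]
  rw [h1, Finsupp.smul_apply, smul_eq_mul]
  congr 1
  have hfin : (Function.support fun p : Multisegment =>
      Polynomial.aeval ((v : R) ^ 2) (hallPoly m m' p) • uBasis R p).Finite := by
    refine (finite_dimVec_eq (dimVec m + dimVec m')).subset fun p hp => ?_
    refine dimVec_of_hallPoly_ne_zero fun hc => hp ?_
    simp [hc]
  have h2 := (Finsupp.applyAddHom x : Hall R →+ R).map_finsum hfin
  simp only [Finsupp.applyAddHom_apply] at h2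
  rw [h2, finsum_eq_single _ x]
  · simp [uBasis]
  · intro p hp
    simp [uBasis, hp]

/-- The power of `v` in the product of `u_i` with an element such that the product has dimension
vector `d`. -/
def gcoef (v : Rˣ) (i : ℤ) (d : ℤ →₀ ℕ) : R := ((v ^ ((d i : ℤ) - d (i + 1) - 1) : Rˣ) : R)

theorem isUnit_gcoef (v : Rˣ) (i : ℤ) (d : ℤ →₀ ℕ) : IsUnit (gcoef v i d) := Units.isUnit _

/-- Left multiplication by the generator `u_i`. -/
abbrev lmul (v : Rˣ) (i : ℤ) : Hall R →ₗ[R] Hall R := lop ((v : R) ^ 2) (gcoef v i) i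

theorem map_aeval_simpleCoeff (t : R) (p : Multisegment) (i : ℤ) (n : ℕ) :
    Polynomial.aeval t (simpleCoeff (Polynomial.X : Polynomial ℤ) p i n) = simpleCoeff t p i n := by
  have := map_simpleCoeff (Polynomial.aeval t : Polynomial ℤ →ₐ[ℤ] R).toRingHom Polynomial.X p i n
  simpa using this

theorem hall_ext {M : Type*} [AddCommMonoid M] [Module R M] {f g : Hall R →ₗ[R] M}
    (h : ∀ m, f (uBasis R m) = g (uBasis R m)) : f = g :=
  Finsupp.lhom_ext' fun m => LinearMap.ext_ring (h m)

theorem hallMul_seg (v : Rˣ) (i : ℤ) : hallMul R v (uBasis R (seg i 1)) = lmul v i := by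
  classical
  refine hall_ext fun m => ?_
  ext p
  rw [hallMul_uBasis_apply, lmul, lop_apply, hallPoly_simple, map_sum, Finset.mul_sum,
    Finset.mul_sum]
  refine Finset.sum_congr rfl fun n _ => ?_
  rw [map_mul, map_aeval_simpleCoeff]
  simp only [uBasis, Finsupp.single_apply]
  by_cases h : m = red p i n
  · by_cases hs : segN i (n + 1) ≤ p
    · rw [if_pos h, if_pos h, map_one, dimVec_seg_one, eulerForm_single, gcoef, ← dimVec_red hs, h]
      congr 3
      simp
      ring
    · rw [simpleCoeff_eq_zero _ hs]; simp
  · rw [if_neg h, if_neg h]; simp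

theorem hallMul_zero_left (v : Rˣ) : hallMul R v (uBasis R 0) = LinearMap.id := by
  classical
  refine hall_ext fun m => ?_
  ext p
  rw [hallMul_uBasis_apply, hallPoly_zero_left, dimVec_zero, eulerForm_zero_left]
  simp only [LinearMap.id_apply, uBasis, Finsupp.single_apply]
  split_ifs <;> simp

theorem hallMul_apply_of_dimVec (v : Rˣ) {y : Hall R} {d : ℤ →₀ ℕ} (s : Finset Multisegment)
    (hs : y.support ⊆ s) (hy : ∀ q ∈ s, dimVec q = d) (m' x : Multisegment) :
    hallMul R v y (uBasis R m') x = ((v ^ eulerForm d (dimVec m') : Rˣ) : R) *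
      ∑ q ∈ s, y q * Polynomial.aeval ((v : R) ^ 2) (hallPoly q m' x) := by
  have h1 : y = ∑ q ∈ s, y q • uBasis R q := by
    conv_lhs => rw [← y.sum_single]
    rw [Finsupp.sum_of_support_subset _ hs _ (by simp)]
    refine Finset.sum_congr rfl fun q _ => by simp [uBasis]
  conv_lhs => rw [h1, map_sum, LinearMap.sum_apply, Finsupp.finsetSum_apply]
  rw [Finset.mul_sum]
  refine Finset.sum_congr rfl fun q hq => ?_
  rw [map_smul, LinearMap.smul_apply, Finsupp.smul_apply, hallMul_uBasis_apply, hy q hq,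
    smul_eq_mul]
  ring

/-- Associativity of Hall numbers, for a simple first factor, as an identity of polynomials. -/
theorem sum_hallPoly_simple (i : ℤ) (m m' x : Multisegment) :
    ∑ q ∈ (lop Polynomial.X 1 i (uBasis (Polynomial ℤ) m)).support,
      lop Polynomial.X 1 i (uBasis (Polynomial ℤ) m) q * hallPoly q m' x =
    ∑ n ∈ Finset.range (totalDim x), simpleCoeff Polynomial.X x i n *
      hallPoly m m' (red x i n) := by
  refine poly_eq_of_eval_card fun k _ _ => ?_
  set L := lop Polynomial.X 1 i (uBasis (Polynomial ℤ) m) with hL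
  have h1 : hallEval k m' x L = ∑ q ∈ L.support, (L q).eval (Nat.card k : ℤ) *
      hallNumber k q m' x := by
    conv_lhs => rw [← L.sum_single, Finsupp.sum, map_sum]
    exact Finset.sum_congr rfl fun q _ => hallEval_single _ _ _ _ _
  have h2 := hallEval_lop k m' x i (uBasis (Polynomial ℤ) m)
  rw [← hL, h1] at h2
  rw [Polynomial.eval_finsetSum, Polynomial.eval_finsetSum]
  simp only [Polynomial.eval_mul]
  convert h2 using 2 with q _ n _
  · rw [isHallPoly_hallPoly q m' x k]
  · have := map_simpleCoeff (Polynomial.evalRingHom (Nat.card k : ℤ)) Polynomial.X x i n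
    rw [Polynomial.coe_evalRingHom, Polynomial.eval_X] at this
    rw [this, uBasis, hallEval_single, Polynomial.eval_one, one_mul,
      isHallPoly_hallPoly m m' _ k]

theorem dimVec_of_mem_lop_uBasis {t : R} {c : (ℤ →₀ ℕ) → R} {i : ℤ} {m q : Multisegment}
    (h : q ∈ (lop t c i (uBasis R m)).support) : dimVec q = dimVec m + Finsupp.single i 1 := by
  obtain ⟨n, h1, h2⟩ := mem_support_lop h
  have := Finsupp.support_single_subset h2
  rw [Finset.mem_singleton] at this
  rw [← dimVec_red h1, this]

/-- Left multiplication by a simple generator commutes with right multiplications. -/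
theorem hallMul_lmul (v : Rˣ) (i : ℤ) (x y : Hall R) :
    hallMul R v (lmul v i x) y = lmul v i (hallMul R v x y) := by
  have : (hallMul R v) ∘ₗ lmul v i = (LinearMap.compRight R (lmul v i)) ∘ₗ hallMul R v := by
    refine hall_ext fun m => hall_ext fun m' => ?_
    ext x
    rw [LinearMap.comp_apply, LinearMap.comp_apply, LinearMap.compRight_apply,
      LinearMap.comp_apply]
    set P := lop Polynomial.X 1 i (uBasis (Polynomial ℤ) m) with hP
    have hcoef : ∀ q, lop ((v : R) ^ 2) 1 i (uBasis R m) q =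
        Polynomial.aeval ((v : R) ^ 2) (P q) := fun q => by
      rw [hP, lop_uBasis_apply, lop_uBasis_apply, map_sum]
      refine Finset.sum_congr rfl fun n _ => ?_
      rw [map_mul, map_aeval_simpleCoeff]
      split_ifs <;> simp
    have hlop : lmul v i (uBasis R m) = gcoef v i (dimVec m + Finsupp.single i 1) •
        lop ((v : R) ^ 2) 1 i (uBasis R m) := by
      refine lop_eq_smul _ _ _ fun p hp => ?_
      have := Finsupp.support_single_subset hp
      rw [Finset.mem_singleton] at this
      rw [this]
    rw [hlop, map_smul, LinearMap.smul_apply, Finsupp.smul_apply,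
      hallMul_apply_of_dimVec v (d := dimVec m + Finsupp.single i 1) P.support _
        fun q hq => dimVec_of_mem_lop_uBasis hq]
    swap
    · intro q hq
      rw [Finsupp.mem_support_iff, hcoef] at hq
      rw [Finsupp.mem_support_iff]
      exact fun hc => hq (by rw [hc, map_zero])
    have h1 := congrArg (Polynomial.aeval ((v : R) ^ 2)) (sum_hallPoly_simple i m m' x)
    rw [map_sum, map_sum] at h1
    simp only [map_mul, map_aeval_simpleCoeff, ← hP] at h1
    simp only [hcoef]
    have h2 : lmul v i (hallMul R v (uBasis R m) (uBasis R m')) x = gcoef v i (dimVec x) *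
        (((v ^ eulerForm (dimVec m) (dimVec m') : Rˣ) : R) *
        ∑ n ∈ Finset.range (totalDim x), simpleCoeff ((v : R) ^ 2) x i n *
        Polynomial.aeval ((v : R) ^ 2) (hallPoly m m' (red x i n))) := by
      rw [lmul, lop_apply]
      congr 1
      rw [Finset.mul_sum]
      refine Finset.sum_congr rfl fun n _ => ?_
      rw [hallMul_uBasis_apply]
      ring
    rw [h2, ← h1, smul_eq_mul]
    by_cases hd : dimVec x = dimVec m + Finsupp.single i 1 + dimVec m'
    · rw [← mul_assoc, ← mul_assoc]
      congr 1
      unfold gcoef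
      rw [← Units.val_mul, ← Units.val_mul, ← zpow_add, ← zpow_add, eulerForm_add_left,
        eulerForm_single, hd]
      congr 2
      simp
      ring
    · rw [Finset.sum_eq_zero]
      · simp
      · intro q hq
        by_cases h0 : hallPoly q m' x = 0
        · rw [h0]; simp
        · exact absurd ((dimVec_of_hallPoly_ne_zero h0).trans
            (by rw [dimVec_of_mem_lop_uBasis hq])) hd
  exact LinearMap.congr_fun (LinearMap.congr_fun this x) y

theorem lmul_pow (v : Rˣ) (i : ℤ) (a : ℕ) (y : Hall R) :
    (lmul v i ^ a) y = hallMul R v ((lmul v i ^ a) (uBasis R 0)) y := by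
  induction a generalizing y with
  | zero => simp [hallMul_zero_left]
  | succ a ih => rw [pow_succ', Module.End.mul_apply, ih, Module.End.mul_apply, hallMul_lmul]

end Ring

/-! ### The derivations of the Hall algebra -/

theorem mu_add (m m' : Multisegment) (i : ℤ) (n : ℕ) : mu (m + m') i n = mu m i n + mu m' i n := rfl

theorem mu_segN (i : ℤ) (n : ℕ) (a : ℤ) (b : ℕ) :
    mu (segN i n) a b = if i = a ∧ n = b + 1 then 1 else 0 := by
  have h1 := cg_succ (segN i n) a b
  rw [cg_segN, cg_segN] at h1
  split_ifs at h1 ⊢ <;> omega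

theorem ext_add_segN (c : Multisegment) (i : ℤ) (n : ℕ) :
    ext (c + segN (i + 1) n) i n = c + segN i (n + 1) := by
  rw [ext, add_tsub_cancel_right]

theorem red_add_segN (c : Multisegment) (i : ℤ) (n : ℕ) :
    red (c + segN i (n + 1)) i n = c + segN (i + 1) n := by
  rw [red, add_tsub_cancel_right]

theorem segN_le_ext_iff {m : Multisegment} {i j : ℤ} {n n' : ℕ} (h : i = j → n ≠ n') :
    (segN (j + 1) n' ≤ m ∧ segN i (n + 1) ≤ ext m j n') ↔
      segN (j + 1) n' + segN i (n + 1) ≤ m := by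
  constructor
  · rintro ⟨h1, h2⟩
    obtain ⟨c, rfl⟩ := exists_add_of_le h1
    rw [add_comm _ c, ext_add_segN, segN_le_iff, mu_add, mu_segN, if_neg (by
      rintro ⟨rfl, h3⟩; exact h rfl (by omega)), add_zero, ← segN_le_iff] at h2
    gcongr
  · intro h1
    obtain ⟨c, rfl⟩ := exists_add_of_le h1
    refine ⟨le_self_add.trans le_self_add, ?_⟩
    rw [show segN (j + 1) n' + segN i (n + 1) + c = (segN i (n + 1) + c) + segN (j + 1) n' by abel,
      ext_add_segN]
    exact le_self_add.trans le_self_add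

theorem segN_le_red_iff {m : Multisegment} {i j : ℤ} {n n' : ℕ} (h : i = j → n ≠ n') :
    (segN i (n + 1) ≤ m ∧ segN (j + 1) n' ≤ red m i n) ↔
      segN (j + 1) n' + segN i (n + 1) ≤ m := by
  constructor
  · rintro ⟨h1, h2⟩
    obtain ⟨c, rfl⟩ := exists_add_of_le h1
    rw [add_comm (segN (j + 1) n')]
    rw [add_comm _ c, red_add_segN] at h2
    cases n' with
    | zero => simp
    | succ n' =>
      rw [segN_le_iff, mu_add, mu_segN, if_neg (by
        rintro ⟨h3, h4⟩; exact h (by omega) (by omega)), add_zero, ← segN_le_iff] at h2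
      gcongr
  · intro h1
    obtain ⟨c, rfl⟩ := exists_add_of_le h1
    refine ⟨le_add_self.trans le_self_add, ?_⟩
    rw [show segN (j + 1) n' + segN i (n + 1) + c = (segN (j + 1) n' + c) + segN i (n + 1) by abel,
      red_add_segN]
    exact le_self_add.trans le_self_add

section Ring

variable {R : Type} [CommRing R]

/-- The coefficient, up to a power of `v`, of `u_m` with `[i + 1, n]` lengthened in `u_i u_m`. -/
def extCoeff (t : R) (m : Multisegment) (i : ℤ) (n : ℕ) : R :=
  t ^ cg m i (n + 1) * qn t (mu m i n + 1)

theorem simpleCoeff_ext (t : R) {m : Multisegment} {i : ℤ} {n : ℕ} (h : segN (i + 1) n ≤ m) :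
    simpleCoeff t (ext m i n) i n = extCoeff t m i n := by
  obtain ⟨c, rfl⟩ := exists_add_of_le h
  rw [add_comm, ext_add_segN, simpleCoeff, extCoeff]
  simp [cg_add, mu_add, cg_segN, mu_segN]

theorem lop_uBasis (t : R) (c : (ℤ →₀ ℕ) → R) (i : ℤ) (m : Multisegment) (N : ℕ)
    (hN : totalDim m < N) :
    open Classical in lop t c i (uBasis R m) = ∑ n ∈ Finset.range N, if segN (i + 1) n ≤ m then
      (c (dimVec m + Finsupp.single i 1) * extCoeff t m i n) • uBasis R (ext m i n) else 0 := by
  classical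
  rw [lop_eq_smul t c i (d := dimVec m) fun p hp => by
    have := Finsupp.support_single_subset hp
    rw [Finset.mem_singleton] at this
    rw [this]]
  ext p
  rw [Finsupp.smul_apply, lop_uBasis_apply, Finsupp.finsetSum_apply]
  by_cases h : ∃ n, segN i (n + 1) ≤ p ∧ m = red p i n
  · obtain ⟨n, hn, rfl⟩ := h
    have hd := totalDim_red hn
    have hlen : n + 1 ≤ totalDim p := by
      have := wt_mono (fun p => (p.2 : ℕ)) hn
      change totalDim _ ≤ totalDim _ at this
      rwa [totalDim_segN] at this
    rw [Finset.sum_eq_single_of_mem n (Finset.mem_range.mpr (by omega)),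
      Finset.sum_eq_single_of_mem n (Finset.mem_range.mpr (by omega))]
    · rw [if_pos rfl, if_pos (segN_le_red p i n), ← simpleCoeff_ext t (segN_le_red p i n),
        ext_red hn]
      simp [uBasis]
    · intro n' _ hne
      split_ifs with h
      · have : ext (red p i n) i n' ≠ p := fun he => hne (ext_injective h (segN_le_red p i n)
          (he.trans (ext_red hn).symm))
        simp [uBasis, this]
      · rfl
    · intro n' _ hne
      by_cases h' : segN i (n' + 1) ≤ p
      · rw [if_neg fun e => hne (red_injective hn h' e).symm, mul_zero]
      · rw [simpleCoeff_eq_zero _ h', zero_mul]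
  · rw [Finset.sum_eq_zero, Finset.sum_eq_zero, smul_zero]
    · intro n _
      split_ifs with hn
      · have : ext m i n ≠ p := fun he => h ⟨n, he ▸ segN_le_ext m i n, by rw [← he, red_ext hn]⟩
        simp [uBasis, this]
      · rfl
    · intro n _
      by_cases h' : segN i (n + 1) ≤ p
      · rw [if_neg fun e => h ⟨n, h', e⟩, mul_zero]
      · rw [simpleCoeff_eq_zero _ h', zero_mul]

/-- The coefficient, up to a power of `v`, of `u_m` with `[i, n + 1]` shortened in `E_i u_m`. -/
def redCoeff (v : Rˣ) (m : Multisegment) (i : ℤ) : ℕ → R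
  | 0 => (v : R) ^ 2 * ((v⁻¹ : Rˣ) : R) ^ (2 * cg m (i + 1) 0)
  | n + 1 => ((v : R) ^ 2 - 1) * ((v⁻¹ : Rˣ) : R) ^ (2 * cg m (i + 1) n) *
      qn ((v : R) ^ 2) (mu m (i + 1) n + 1)

/-- The power of `v` occurring in `E_i u_m`, for `d` the dimension vector of `m`. -/
def ecoef (v : Rˣ) (i : ℤ) (d : ℤ →₀ ℕ) : R := ((v ^ (-((d i : ℤ) - d (i + 1)) - 1) : Rˣ) : R)

open Classical in
/-- The twisted derivation `E_i` of the Hall algebra, which is adjoint to the multiplication by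
`u_i` for the scalar product given by the orders of the automorphism groups. -/
def eop (v : Rˣ) (i : ℤ) : Hall R →ₗ[R] Hall R :=
  Finsupp.linearCombination R fun m => ∑ n ∈ Finset.range (totalDim m),
    if segN i (n + 1) ≤ m then (ecoef v i (dimVec m) * redCoeff v m i n) • uBasis R (red m i n)
    else 0

theorem lt_totalDim_of_segN_le {m : Multisegment} {i : ℤ} {n : ℕ} (h : segN i (n + 1) ≤ m) :
    n < totalDim m := by
  have := wt_mono (fun p => (p.2 : ℕ)) h
  change totalDim _ ≤ totalDim _ at this
  rw [totalDim_segN] at this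
  omega

theorem eop_uBasis (v : Rˣ) (i : ℤ) (m : Multisegment) (N : ℕ) (hN : totalDim m ≤ N) :
    open Classical in eop v i (uBasis R m) = ∑ n ∈ Finset.range N, if segN i (n + 1) ≤ m then
      (ecoef v i (dimVec m) * redCoeff v m i n) • uBasis R (red m i n) else 0 := by
  classical
  rw [eop, uBasis, Finsupp.linearCombination_single, one_smul]
  refine Finset.sum_subset (Finset.range_subset_range.mpr hN) fun n _ hn => ?_
  rw [if_neg fun h => hn (Finset.mem_range.mpr (lt_totalDim_of_segN_le h))]

theorem eop_zero (v : Rˣ) (i : ℤ) : eop v i (uBasis R 0) = 0 := by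
  rw [eop_uBasis v i 0 0 (by simp [totalDim])]
  simp

/-- The commutation of the coefficients when `[j + 1, n']` is lengthened and `[i, n + 1]`
shortened. -/
theorem extCoeff_mul_redCoeff (v : Rˣ) (c : Multisegment) {i j : ℤ} {n n' : ℕ}
    (h : i = j → n ≠ n') :
    (if j = i + 1 then (v : R) ^ 2 else 1) *
      (extCoeff ((v : R) ^ 2) (c + segN (j + 1) n' + segN i (n + 1)) j n' *
        redCoeff v (c + segN j (n' + 1) + segN i (n + 1)) i n) =
    (if i = j then (v : R) ^ 2 else 1) *
      (extCoeff ((v : R) ^ 2) (c + segN (j + 1) n' + segN (i + 1) n) j n' *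
        redCoeff v (c + segN (j + 1) n' + segN i (n + 1)) i n) := by
  have hv : (v : R) ^ 2 * ((v⁻¹ : Rˣ) : R) ^ 2 = 1 := by
    rw [← mul_pow, Units.mul_inv, one_pow]
  set t := (v : R) ^ 2 with ht
  set w := ((v⁻¹ : Rˣ) : R) ^ 2 with hw
  by_cases hij : i = j
  · subst hij
    rw [if_neg (by omega), if_pos rfl]
    have hne := h rfl
    rcases lt_or_gt_of_ne hne with hlt | hlt
    · cases n with
      | zero =>
        simp only [extCoeff, redCoeff, cg_add, mu_add, cg_segN, mu_segN, pow_mul, ← ht, ← hw]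
        simp [show ¬ (n' = 0) by omega, show 0 < n' by omega, pow_add]
        linear_combination (-(t * t ^ cg c i (n' + 1) * qn t (mu c i n' + 1) * w ^ cg c (i + 1) 0)) * hv
      | succ n =>
        simp only [extCoeff, redCoeff, cg_add, mu_add, cg_segN, mu_segN, pow_mul, ← ht, ← hw]
        simp [show ¬ (n' = n + 1) by omega, show ¬ (n + 1 = n') by omega, show n < n' by omega,
          show ¬ (n' ≤ n) by omega, pow_add]
        linear_combination (-((t - 1) * t ^ cg c i (n' + 1) * qn t (mu c i n' + 1) *
          w ^ cg c (i + 1) n * qn t (mu c (i + 1) n + 1))) * hv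
    · cases n with
      | zero => omega
      | succ n =>
        simp only [extCoeff, redCoeff, cg_add, mu_add, cg_segN, mu_segN, pow_mul, ← ht, ← hw]
        simp [show ¬ (n' = n + 1) by omega, show ¬ (n + 1 = n') by omega, show ¬ (n < n') by omega,
          show n' ≤ n by omega, pow_add]
        ring
  · rw [if_neg hij]
    by_cases hj : j = i + 1
    · subst hj
      rw [if_pos rfl]
      cases n with
      | zero =>
        simp only [extCoeff, redCoeff, cg_add, mu_add, cg_segN, mu_segN, pow_mul, ← ht, ← hw]
        simp [pow_add]
        linear_combination (t * t ^ cg c (i + 1) (n' + 1) * qn t (mu c (i + 1) n' + 1) *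
          w ^ cg c (i + 1) 0) * hv
      | succ n =>
        simp only [extCoeff, redCoeff, cg_add, mu_add, cg_segN, mu_segN, pow_mul, ← ht, ← hw]
        rcases lt_trichotomy n n' with h1 | h1 | h1
        · simp [show ¬ (n' = n) by omega, show ¬ (n = n') by omega, show ¬ (n' < n) by omega,
            show n < n' + 1 by omega, pow_add]
          linear_combination ((t - 1) * t ^ cg c (i + 1) (n' + 1) * qn t (mu c (i + 1) n' + 1) *
            w ^ cg c (i + 1) n * qn t (mu c (i + 1) n + 1)) * hv
        · subst h1
          simp [pow_add]
          linear_combination ((t - 1) * t ^ cg c (i + 1) (n + 1) * qn t (mu c (i + 1) n + 1) *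
            w ^ cg c (i + 1) n * qn t (mu c (i + 1) n + 1 + 1)) * hv
        · simp [show ¬ (n' = n) by omega, show ¬ (n = n') by omega, show (n' < n) by omega,
            show ¬ n < n' + 1 by omega, pow_add]
          ring
    · rw [if_neg hj, one_mul, one_mul]
      have h1 : extCoeff t (c + segN (j + 1) n' + segN i (n + 1)) j n' =
          extCoeff t (c + segN (j + 1) n' + segN (i + 1) n) j n' := by
        simp only [extCoeff, cg_add, mu_add, cg_segN, mu_segN]
        simp [hij, show ¬ (i + 1 = j) by omega]
      have h2 : redCoeff v (c + segN j (n' + 1) + segN i (n + 1)) i n =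
          redCoeff v (c + segN (j + 1) n' + segN i (n + 1)) i n := by
        cases n <;> simp only [redCoeff, cg_add, mu_add, cg_segN, mu_segN] <;>
          simp [hj, show ¬ (j = i) by omega]
      rw [h1, h2]

/-- The symmetrized Euler form of simple representations. -/
def cartan (i j : ℤ) : ℤ := if i = j then 2 else if j = i + 1 ∨ i = j + 1 then -1 else 0

theorem gcoef_mul_ecoef (v : Rˣ) (d : ℤ →₀ ℕ) (i j : ℤ) :
    gcoef v j (d + Finsupp.single i 1 + Finsupp.single j 1) *
      ecoef v i (d + Finsupp.single i 1 + Finsupp.single j 1) *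
        (if i = j then (v : R) ^ 2 else 1) =
    ((v ^ cartan i j : Rˣ) : R) * (if j = i + 1 then (v : R) ^ 2 else 1) *
      (ecoef v i (d + Finsupp.single i 1) * gcoef v j (d + Finsupp.single j 1)) := by
  have h1 : (if i = j then (v : R) ^ 2 else 1) = ((v ^ (if i = j then 2 else 0 : ℤ) : Rˣ) : R) := by
    split_ifs <;> simp
  have h2 : (if j = i + 1 then (v : R) ^ 2 else 1) =
      ((v ^ (if j = i + 1 then 2 else 0 : ℤ) : Rˣ) : R) := by
    split_ifs <;> simp
  rw [h1, h2]
  unfold gcoef ecoef cartan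
  simp only [← Units.val_mul, ← zpow_add]
  congr 2
  simp only [Finsupp.add_apply, Finsupp.single_apply]
  push_cast
  split_ifs <;> omega

/-- The extremal terms of the commutator of `E_i` with the multiplication by `u_i` telescope. -/
theorem sum_extCoeff_mul_redCoeff (v : Rˣ) (m : Multisegment) (i : ℤ) (N : ℕ)
    (hN : totalDim m ≤ N) :
    open Classical in ∑ n ∈ Finset.range (N + 1),
      ((if segN (i + 1) n ≤ m then extCoeff ((v : R) ^ 2) m i n * redCoeff v (ext m i n) i n else 0) -
        (v : R) ^ 2 * if segN i (n + 1) ≤ m then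
          redCoeff v m i n * extCoeff ((v : R) ^ 2) (red m i n) i n else 0) = (v : R) ^ 2 := by
  classical
  have hv : (v : R) ^ 2 * ((v⁻¹ : Rˣ) : R) ^ 2 = 1 := by
    rw [← mul_pow, Units.mul_inv, one_pow]
  have hred : ∀ n, (if segN i (n + 1) ≤ m then
      redCoeff v m i n * extCoeff ((v : R) ^ 2) (red m i n) i n else 0) =
      redCoeff v m i n * (((v : R) ^ 2) ^ cg m i (n + 1) * qn ((v : R) ^ 2) (mu m i n)) := by
    intro n
    split_ifs with h
    · obtain ⟨c, rfl⟩ := exists_add_of_le h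
      rw [add_comm _ c, red_add_segN]
      simp [extCoeff, cg_add, mu_add, cg_segN, mu_segN]
    · rw [segN_le_iff, not_not] at h
      simp [h]
  have hext0 : (if segN (i + 1) 0 ≤ m then
      extCoeff ((v : R) ^ 2) m i 0 * redCoeff v (ext m i 0) i 0 else 0) =
      extCoeff ((v : R) ^ 2) m i 0 * redCoeff v m i 0 := by
    rw [if_pos (by simp)]
    simp [redCoeff, ext, cg_add, cg_segN]
  have hext : ∀ n, (if segN (i + 1) (n + 1) ≤ m then
      extCoeff ((v : R) ^ 2) m i (n + 1) * redCoeff v (ext m i (n + 1)) i (n + 1) else 0) =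
      extCoeff ((v : R) ^ 2) m i (n + 1) * (((v : R) ^ 2 - 1) * (v : R) ^ 2 *
        ((v⁻¹ : Rˣ) : R) ^ (2 * cg m (i + 1) n) * qn ((v : R) ^ 2) (mu m (i + 1) n)) := by
    intro n
    split_ifs with h
    · obtain ⟨c, rfl⟩ := exists_add_of_le h
      rw [add_comm _ c, ext_add_segN]
      simp [redCoeff, cg_add, mu_add, cg_segN, mu_segN, pow_mul, pow_add]
      congr 1
      linear_combination (-(((v : R) ^ 2 - 1) * (((v⁻¹ : Rˣ) : R) ^ 2) ^ cg c (i + 1) n *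
        qn ((v : R) ^ 2) (mu c (i + 1) n + 1))) * hv
    · rw [segN_le_iff, not_not] at h
      simp [h]
  have key : ∀ M, ∑ n ∈ Finset.range (M + 1),
      ((if segN (i + 1) n ≤ m then extCoeff ((v : R) ^ 2) m i n * redCoeff v (ext m i n) i n else 0) -
        (v : R) ^ 2 * if segN i (n + 1) ≤ m then
          redCoeff v m i n * extCoeff ((v : R) ^ 2) (red m i n) i n else 0) =
      (v : R) ^ 2 * ((v : R) ^ 2) ^ cg m i (M + 1) *
        (((v⁻¹ : Rˣ) : R) ^ 2) ^ cg m (i + 1) M := by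
    intro M
    set t := (v : R) ^ 2 with ht
    set w := ((v⁻¹ : Rˣ) : R) ^ 2 with hw
    induction M with
    | zero =>
      rw [Finset.sum_range_one, hred, hext0]
      simp only [extCoeff, redCoeff, pow_mul, ← ht, ← hw]
      rw [add_comm (mu m i 0) 1, qn_add, qn_one, pow_one]
      ring
    | succ M ih =>
      rw [Finset.sum_range_succ, ih, hred, hext]
      simp only [extCoeff, redCoeff, pow_mul, ← ht, ← hw]
      rw [cg_succ m i (M + 1), cg_succ m (i + 1) M, add_comm (mu m i (M + 1)) 1, qn_add, qn_one, pow_one,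
        add_comm (mu m (i + 1) M) 1, qn_add, qn_one, pow_one]
      have h1 := qn_mul t (mu m i (M + 1))
      have h2 := qn_mul t (mu m (i + 1) M)
      have h3 : t ^ mu m (i + 1) M * w ^ mu m (i + 1) M = 1 := by rw [← mul_pow, hv, one_pow]
      rw [pow_add, pow_add]
      linear_combination (t * t ^ cg m i (M + 1 + 1) * w ^ mu m (i + 1) M *
        w ^ cg m (i + 1) (M + 1)) * (h2 - h1) +
        (t * t ^ cg m i (M + 1 + 1) * w ^ cg m (i + 1) (M + 1)) * h3
  rw [key, cg_eq_zero_of_le (by omega), cg_eq_zero_of_le hN]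
  simp

/-- The commutation of the derivation `E_i` with the multiplication by `u_j`. -/
theorem eop_lmul (v : Rˣ) (i j : ℤ) (y : Hall R) : eop v i (lmul v j y) =
    (if i = j then y else 0) + ((v ^ cartan i j : Rˣ) : R) • lmul v j (eop v i y) := by
  classical
  have key : eop v i ∘ₗ lmul v j = (if i = j then LinearMap.id else 0) +
      ((v ^ cartan i j : Rˣ) : R) • (lmul v j ∘ₗ eop v i) := by
    refine hall_ext fun m => ?_
    set N := totalDim m + 1 + 1 with hN
    let X : ℕ → ℕ → Hall R := fun n' n =>
      if segN (j + 1) n' ≤ m ∧ segN i (n + 1) ≤ ext m j n' then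
        (gcoef v j (dimVec m + Finsupp.single j 1) * extCoeff ((v : R) ^ 2) m j n' *
          (ecoef v i (dimVec m + Finsupp.single j 1) * redCoeff v (ext m j n') i n)) •
            uBasis R (red (ext m j n') i n) else 0
    let Y : ℕ → ℕ → Hall R := fun n' n =>
      if segN i (n + 1) ≤ m ∧ segN (j + 1) n' ≤ red m i n then
        (ecoef v i (dimVec m) * redCoeff v m i n *
          (gcoef v j (dimVec (red m i n) + Finsupp.single j 1) *
            extCoeff ((v : R) ^ 2) (red m i n) j n')) • uBasis R (ext (red m i n) j n') else 0
    have hX : (eop v i ∘ₗ lmul v j) (uBasis R m) =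
        ∑ n' ∈ Finset.range N, ∑ n ∈ Finset.range N, X n' n := by
      rw [LinearMap.comp_apply, lmul, lop_uBasis _ _ _ _ N (by omega), map_sum]
      refine Finset.sum_congr rfl fun n' _ => ?_
      by_cases h : segN (j + 1) n' ≤ m
      · rw [if_pos h, map_smul, eop_uBasis v i _ N (by rw [totalDim_ext h]; omega), Finset.smul_sum]
        refine Finset.sum_congr rfl fun n _ => ?_
        by_cases h' : segN i (n + 1) ≤ ext m j n'
        · rw [if_pos h', dimVec_ext h, smul_smul]; exact (if_pos ⟨h, h'⟩).symm
        · rw [if_neg h', smul_zero]; exact (if_neg fun hc => h' hc.2).symm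
      · rw [if_neg h, map_zero]
        exact (Finset.sum_eq_zero fun n _ => if_neg fun hc => h hc.1).symm
    have hY : (lmul v j ∘ₗ eop v i) (uBasis R m) =
        ∑ n' ∈ Finset.range N, ∑ n ∈ Finset.range N, Y n' n := by
      rw [Finset.sum_comm, LinearMap.comp_apply, eop_uBasis v i _ N (by omega), map_sum]
      refine Finset.sum_congr rfl fun n _ => ?_
      by_cases h : segN i (n + 1) ≤ m
      · have := totalDim_red h
        rw [if_pos h, map_smul, lmul, lop_uBasis _ _ _ _ N (by omega), Finset.smul_sum]
        refine Finset.sum_congr rfl fun n' _ => ?_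
        by_cases h' : segN (j + 1) n' ≤ red m i n
        · rw [if_pos h', smul_smul]; exact (if_pos ⟨h, h'⟩).symm
        · rw [if_neg h', smul_zero]; exact (if_neg fun hc => h' hc.2).symm
      · rw [if_neg h, map_zero]
        exact (Finset.sum_eq_zero fun n' _ => if_neg fun hc => h hc.1).symm
    have hXY : ∀ n' n, (i = j → n ≠ n') → X n' n = ((v ^ cartan i j : Rˣ) : R) • Y n' n := by
      intro n' n hne
      by_cases h : segN (j + 1) n' + segN i (n + 1) ≤ m
      · simp only [X, Y]
        rw [if_pos ((segN_le_ext_iff hne).mpr h), if_pos ((segN_le_red_iff hne).mpr h)]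
        have hd := dimVec_red ((segN_le_red_iff hne).mpr h).1
        rw [← hd]
        obtain ⟨c, hc⟩ := exists_add_of_le h
        have e1 : ext m j n' = c + segN j (n' + 1) + segN i (n + 1) := by
          rw [hc, show segN (j + 1) n' + segN i (n + 1) + c =
            (c + segN i (n + 1)) + segN (j + 1) n' by abel, ext_add_segN]
          abel
        have e2 : red m i n = c + segN (j + 1) n' + segN (i + 1) n := by
          rw [hc, show segN (j + 1) n' + segN i (n + 1) + c =
            (c + segN (j + 1) n') + segN i (n + 1) by abel, red_add_segN]
        have e3 : red (ext m j n') i n = c + segN j (n' + 1) + segN (i + 1) n := by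
          rw [e1, red_add_segN]
        have e4 : ext (red m i n) j n' = c + segN j (n' + 1) + segN (i + 1) n := by
          rw [e2, show c + segN (j + 1) n' + segN (i + 1) n =
            (c + segN (i + 1) n) + segN (j + 1) n' by abel, ext_add_segN]
          abel
        have e5 : m = c + segN (j + 1) n' + segN i (n + 1) := by rw [hc]; abel
        have h1 := extCoeff_mul_redCoeff v c hne
        have h2 := gcoef_mul_ecoef v (dimVec (red m i n)) i j
        rw [← e1, ← e2, ← e5] at h1
        rw [e3, ← e4, smul_smul]
        congr 1
        have hu1 : IsUnit (if i = j then (v : R) ^ 2 else 1) := by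
          split_ifs
          · exact v.isUnit.pow 2
          · exact isUnit_one
        have hu2 : IsUnit (if j = i + 1 then (v : R) ^ 2 else 1) := by
          split_ifs
          · exact v.isUnit.pow 2
          · exact isUnit_one
        refine (hu1.mul hu2).mul_left_cancel ?_
        set α := (if i = j then (v : R) ^ 2 else 1)
        set β := (if j = i + 1 then (v : R) ^ 2 else 1)
        linear_combination (β * (extCoeff ((v : R) ^ 2) m j n' * redCoeff v (ext m j n') i n)) * h2 +
          (((v ^ cartan i j : Rˣ) : R) * β *
            (ecoef v i (dimVec (red m i n) + Finsupp.single i 1) *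
              gcoef v j (dimVec (red m i n) + Finsupp.single j 1))) * h1
      · simp only [X, Y]
        rw [if_neg fun hc => h ((segN_le_ext_iff hne).mp hc),
          if_neg fun hc => h ((segN_le_red_iff hne).mp hc), smul_zero]
    rw [hX, LinearMap.add_apply, LinearMap.smul_apply, hY]
    by_cases hij : i = j
    · subst hij
      rw [if_pos rfl, LinearMap.id_apply, ← sub_eq_iff_eq_add, Finset.smul_sum,
        ← Finset.sum_sub_distrib]
      have hc : cartan i i = 2 := if_pos rfl
      have h1 : ∀ n' ∈ Finset.range N, (∑ n ∈ Finset.range N, X n' n) -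
          ((v ^ cartan i i : Rˣ) : R) • ∑ n ∈ Finset.range N, Y n' n =
          (((v⁻¹ : Rˣ) : R) ^ 2 * ((if segN (i + 1) n' ≤ m then
            extCoeff ((v : R) ^ 2) m i n' * redCoeff v (ext m i n') i n' else 0) -
            (v : R) ^ 2 * if segN i (n' + 1) ≤ m then
            redCoeff v m i n' * extCoeff ((v : R) ^ 2) (red m i n') i n' else 0)) •
            uBasis R m := by
        intro n' hn'
        rw [Finset.smul_sum, ← Finset.sum_sub_distrib, Finset.sum_eq_single_of_mem n' hn'
          fun n _ hne => sub_eq_zero.mpr (hXY n' n fun _ => hne), mul_sub, sub_smul]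
        congr 1
        · by_cases h : segN (i + 1) n' ≤ m
          · simp only [X]
            rw [if_pos ⟨h, segN_le_ext _ _ _⟩, if_pos h, red_ext h]
            congr 1
            have : gcoef v i (dimVec m + Finsupp.single i 1) *
                ecoef v i (dimVec m + Finsupp.single i 1) = ((v⁻¹ : Rˣ) : R) ^ 2 := by
              rw [gcoef, ecoef, ← Units.val_mul, ← zpow_add, ← Units.val_pow_eq_pow_val, inv_pow,
                ← zpow_natCast, ← zpow_neg]
              congr 2
              push_cast
              ring
            rw [← this]
            ring
          · simp only [X]
            rw [if_neg fun hc => h hc.1, if_neg h]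
            simp
        · by_cases h : segN i (n' + 1) ≤ m
          · simp only [Y]
            rw [if_pos ⟨h, segN_le_red _ _ _⟩, if_pos h, ext_red h, dimVec_red h, smul_smul, hc]
            congr 1
            have : ecoef v i (dimVec m) * gcoef v i (dimVec m) = ((v⁻¹ : Rˣ) : R) ^ 2 := by
              rw [gcoef, ecoef, ← Units.val_mul, ← zpow_add, ← Units.val_pow_eq_pow_val, inv_pow,
                ← zpow_natCast, ← zpow_neg]
              congr 2
              push_cast
              ring
            rw [← this, zpow_ofNat, Units.val_pow_eq_pow_val]
            ring
          · simp only [Y]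
            rw [if_neg fun hc => h hc.1, if_neg h]
            simp
      rw [Finset.sum_congr rfl h1, ← Finset.sum_smul, ← Finset.mul_sum, hN,
        sum_extCoeff_mul_redCoeff v m i _ (by omega), ← mul_pow, Units.inv_mul, one_pow, one_smul]
    · rw [if_neg hij, LinearMap.zero_apply, zero_add, Finset.smul_sum]
      refine Finset.sum_congr rfl fun n' _ => ?_
      rw [Finset.smul_sum]
      exact Finset.sum_congr rfl fun n _ => hXY n' n fun hc => absurd hc hij
  have := LinearMap.congr_fun key y
  rw [LinearMap.comp_apply] at this
  rw [this, LinearMap.add_apply, LinearMap.smul_apply, LinearMap.comp_apply]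
  split_ifs <;> rfl

/-- The derivations `E_i` have no common zeros outside of the degree `0` part: for the largest start
`i` of a segment in `y`, a term of `E_i y` determines the term of `y` which it comes from. -/
theorem eq_zero_of_eop_eq_zero [IsDomain R] (v : Rˣ) (hq : ∀ n, qn ((v : R) ^ 2) (n + 1) ≠ 0)
    (h1 : (v : R) ^ 2 ≠ 1) {y : Hall R} (hy : ∀ i, eop v i y = 0) (m : Multisegment) (hm : m ≠ 0) :
    y m = 0 := by
  classical
  by_contra hym
  -- the largest start of a segment occurring in `y`
  let S : Finset ℤ := y.support.biUnion fun m => m.support.image Prod.fst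
  have hmem : ∀ p ∈ y.support, ∀ j, cg p j 0 ≠ 0 → j ∈ S := by
    intro p hp j hj
    obtain ⟨n, hn⟩ := exists_mu_ne_zero hj
    refine Finset.mem_biUnion.mpr ⟨p, hp, Finset.mem_image.mpr ⟨(j, n.succPNat), ?_, rfl⟩⟩
    rw [Finsupp.mem_support_iff]
    exact segN_le_iff.mp hn
  have hne : S.Nonempty := by
    obtain ⟨j, hj⟩ : ∃ j, cg m j 0 ≠ 0 := by
      by_contra hc
      push Not at hc
      exact hm (eq_zero_of_cg m hc)
    exact ⟨j, hmem m (Finsupp.mem_support_iff.mpr hym) j hj⟩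
  obtain ⟨i, hi, hmax⟩ := S.exists_max_image id hne
  have hi1 : ∀ p ∈ y.support, cg p (i + 1) 0 = 0 := fun p hp => by
    by_contra hc
    have := hmax _ (hmem p hp _ hc)
    simp at this
  obtain ⟨p, hp, hpi⟩ := Finset.mem_biUnion.mp hi
  obtain ⟨⟨i', l⟩, hl, rfl⟩ := Finset.mem_image.mp hpi
  simp only at hi1
  have hseg : segN i' (l.natPred + 1) ≤ p := by
    rw [segN_le_iff, mu, PNat.succPNat_natPred]
    exact Finsupp.mem_support_iff.mp hl
  set n := l.natPred
  have hmu : ∀ p ∈ y.support, ∀ k, mu p (i' + 1) k = 0 := fun p hp k => by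
    have h2 := cg_succ p (i' + 1) k
    have h3 := cg_antitone p (i' + 1) (Nat.zero_le k)
    have h4 := hi1 p hp
    omega
  have hval : eop v i' y (red p i' n) = ecoef v i' (dimVec p) * redCoeff v p i' n * y p := by
    conv_lhs => rw [← y.sum_single, Finsupp.sum, map_sum, Finsupp.finsetSum_apply]
    have h2 : ∀ x, eop v i' (Finsupp.single x (y x)) (red p i' n) =
        y x * ∑ k ∈ Finset.range (totalDim x), if segN i' (k + 1) ≤ x ∧ red x i' k = red p i' n
          then ecoef v i' (dimVec x) * redCoeff v x i' k else 0 := fun x => by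
      have : (Finsupp.single x (y x) : Hall R) = y x • uBasis R x := by simp [uBasis]
      rw [this, map_smul, eop_uBasis v i' x _ le_rfl, Finsupp.smul_apply, Finsupp.finsetSum_apply,
        smul_eq_mul]
      congr 1
      refine Finset.sum_congr rfl fun k _ => ?_
      by_cases h : segN i' (k + 1) ≤ x
      · by_cases h' : red x i' k = red p i' n
        · rw [if_pos h, if_pos ⟨h, h'⟩, h']; simp [uBasis]
        · rw [if_pos h, if_neg fun hc => h' hc.2]; simp [uBasis, h']
      · rw [if_neg h, if_neg fun hc => h hc.1]; rfl
    have huniq : ∀ x ∈ y.support, ∀ k, segN i' (k + 1) ≤ x → red x i' k = red p i' n →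
        x = p ∧ k = n := by
      intro x hx k hk he
      -- the shortened segment is the only one starting at `i + 1`
      have h3 : k = n := by
        have hcg : ∀ b, cg (red x i' k) (i' + 1) b = if b < k then 1 else 0 := fun b => by
          have h4 := cg_red hk (i' + 1) b
          have h5 := cg_antitone x (i' + 1) (Nat.zero_le b)
          have h6 := hi1 x hx
          simp at h4
          omega
        have hcg' : ∀ b, cg (red p i' n) (i' + 1) b = if b < n then 1 else 0 := fun b => by
          have h4 := cg_red hseg (i' + 1) b
          have h5 := cg_antitone p (i' + 1) (Nat.zero_le b)
          have h6 := hi1 p hp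
          simp at h4
          omega
        rw [he] at hcg
        have h7 := (hcg n).symm.trans (hcg' n)
        have h8 := (hcg k).symm.trans (hcg' k)
        simp at h7 h8
        omega
      subst h3
      exact ⟨by rw [← ext_red hk, he, ext_red hseg], rfl⟩
    rw [Finset.sum_eq_single_of_mem p hp]
    · rw [h2, Finset.sum_eq_single_of_mem n (Finset.mem_range.mpr (lt_totalDim_of_segN_le hseg)),
        if_pos ⟨hseg, rfl⟩]
      · ring
      · intro k _ hne
        rw [if_neg fun hc => hne (huniq p hp k hc.1 hc.2).2]
    · intro x hx hne
      rw [h2, Finset.sum_eq_zero, mul_zero]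
      intro k _
      rw [if_neg fun hc => hne (huniq x hx k hc.1 hc.2).1]
  rw [hy i', Finsupp.zero_apply] at hval
  have hr : redCoeff v p i' n ≠ 0 := by
    have hw : ((v⁻¹ : Rˣ) : R) ≠ 0 := Units.ne_zero _
    cases n with
    | zero => exact mul_ne_zero (pow_ne_zero _ v.ne_zero) (pow_ne_zero _ hw)
    | succ n => exact mul_ne_zero (mul_ne_zero (sub_ne_zero.mpr h1) (pow_ne_zero _ hw)) (hq _)
  exact (mul_ne_zero (mul_ne_zero (Units.ne_zero _) hr) (Finsupp.mem_support_iff.mp hp)) hval.symm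

end Ring

/-! ### Divided powers of the generators -/

/-- The dimension of the endomorphism ring of `M(m)`. -/
def endDim (m : Multisegment) : ℕ :=
  wt (fun p => rk m p.1 p.1 - rk m p.1 (p.1 + (p.2 : ℕ))) m

theorem rk_mono {m : Multisegment} {i j l : ℤ} (h : j ≤ l) : rk m i l ≤ rk m i j := by
  refine wt_mono_fun (fun p => ?_) m
  split_ifs <;> omega

theorem wt_shift (H : ℤ × ℕ+ → ℕ) (δ : ℕ) (i : ℤ) (m : Multisegment) :
    wt (fun q => if q.1 = i then wt H (segN (i + 1) ((q.2 : ℕ) - 1)) + δ else H q) m =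
      wt H (shift i m) + δ * cg m i 0 := by
  set G : ℤ × ℕ+ → ℕ := fun q => if q.1 = i then wt H (segN (i + 1) ((q.2 : ℕ) - 1)) + δ else H q
    with hG
  refine shift_rec (i := i) (P := fun m => wt G m = wt H (shift i m) + δ * cg m i 0)
    (fun p hp => ?_) (fun p n hn ih => ?_) m
  · rw [shift_of_cg_eq_zero hp, hp, mul_zero, add_zero]
    refine wt_congr fun q hq => ?_
    unfold cg at hp
    rw [wt_eq_zero_iff] at hp
    have := hp q hq
    have hne : q.1 ≠ i := fun hc => by simp [hc] at this
    simp only [hG]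
    rw [if_neg hne]
  · have h1 := wt_red G hn
    have h2 : wt G (segN (i + 1) n) = wt H (segN (i + 1) n) := by
      cases n with
      | zero => simp
      | succ n => rw [segN, wt_seg, wt_seg]; simp [hG]
    have h3 : wt G (segN i (n + 1)) = wt H (segN (i + 1) n) + δ := by
      rw [segN, wt_seg]; simp [hG]
    rw [shift_red hn] at ih
    have h4 := cg_red_zero hn
    rw [← h4, mul_add, mul_one]
    omega

/-- The effect on the endomorphism ring of removing all tops `S_i`, where `S_{i+1}` does not occur
in the top of `M(m)`. -/
theorem endDim_shift {m : Multisegment} {i : ℤ} (hi : cg m (i + 1) 0 = 0) :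
    dimVec m (i + 1) ≤ dimVec m i ∧
      endDim m = endDim (shift i m) + (dimVec m i - dimVec m (i + 1)) * cg m i 0 := by
  have hcg : ∀ n, cg m (i + 1) n = 0 := fun n => by
    have := cg_antitone m (i + 1) (Nat.zero_le n)
    omega
  have hrk : ∀ n : ℕ, rk m (i + 1) (i + 1 + n) = rk m i (i + 1 + n) := fun n => by
    have := rk_eq_add_cg m (i + 1) n
    rwa [hcg, add_zero, add_sub_cancel_right] at this
  have h1 : dimVec m (i + 1) ≤ dimVec m i := by
    have := hrk 0
    rw [Nat.cast_zero, add_zero] at this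
    rw [dimVec_apply, dimVec_apply, this]
    exact rk_mono (by omega)
  refine ⟨h1, ?_⟩
  unfold endDim
  rw [← wt_shift]
  refine wt_congr fun q hq => ?_
  obtain ⟨j, l⟩ := q
  simp only
  split_ifs with hj
  · subst hj
    obtain ⟨n, hn⟩ : ∃ n, (l : ℕ) = n + 1 := ⟨l.natPred, (PNat.natPred_add_one l).symm⟩
    rw [hn, Nat.add_sub_cancel]
    have h2 := hrk 0
    rw [Nat.cast_zero, add_zero] at h2
    rw [dimVec_apply, dimVec_apply, h2]
    have h3 : rk m j (j + 1) ≤ rk m j j := rk_mono (by omega)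
    cases n with
    | zero => simp
    | succ n =>
      rw [segN, wt_seg, Nat.succPNat_coe, rk_shift _ _ _ _ le_rfl (by omega),
        rk_shift _ _ _ _ (by omega) (by omega), h2]
      have h4 := hrk (n + 1)
      rw [Nat.succ_eq_add_one, h4]
      have h5 : rk m j (j + 1 + ((n + 1 : ℕ) : ℤ)) ≤ rk m j (j + 1) := rk_mono (by omega)
      have h6 : j + ((n + 1 + 1 : ℕ) : ℤ) = j + 1 + ((n + 1 : ℕ) : ℤ) := by push_cast; ring
      rw [h6]
      omega
  · rw [rk_shift _ _ _ _ le_rfl hj, rk_shift _ _ _ _ (by omega) hj]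

/-- The multisegments strictly below `m` in the degeneration order span this submodule. -/
def lowerSpan (R : Type) [CommRing R] (m : Multisegment) : Submodule R (Hall R) :=
  Finsupp.supported R R {p | RkLE p m ∧ p ≠ m}

section Ring

variable {R : Type} [CommRing R]

theorem mem_lowerSpan {m : Multisegment} {y : Hall R} :
    y ∈ lowerSpan R m ↔ ∀ p, y p ≠ 0 → RkLE p m ∧ p ≠ m := by
  rw [lowerSpan, Finsupp.mem_supported]
  simp [Set.subset_def]

/-- The factor `v^{dim End M(m) - dim M(m)}`. -/
def tcoef (v : Rˣ) (m : Multisegment) : Rˣ := v ^ ((endDim m : ℤ) - totalDim m)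

/-- The normalized basis element `ũ_m`. -/
def uTil (v : Rˣ) (m : Multisegment) : Hall R := (tcoef v m : R) • uBasis R m

/-- The bar invariant quantum factorial. -/
def bfact (v : Rˣ) (a : ℕ) : R := ((v⁻¹ : Rˣ) : R) ^ a.choose 2 * qfact ((v : R) ^ 2) a

theorem lmul_pow_eq_smul (v : Rˣ) (i : ℤ) (a : ℕ) {y : Hall R} {d : ℤ →₀ ℕ}
    (hy : ∀ p ∈ y.support, dimVec p = d) :
    (lmul v i ^ a) y = ((v ^ ((a : ℤ) * ((d i : ℤ) - d (i + 1)) + (a.choose 2 : ℕ)) : Rˣ) : R) •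
      (lop ((v : R) ^ 2) 1 i ^ a) y := by
  induction a with
  | zero => simp
  | succ a ih =>
    rw [pow_succ' (lmul v i) a, Module.End.mul_apply, ih, map_smul,
      pow_succ' (lop ((v : R) ^ 2) 1 i) a, Module.End.mul_apply, lmul,
      lop_eq_smul (d := d + Finsupp.single i a), smul_smul, gcoef, ← Units.val_mul, ← zpow_add]
    · congr 3
      simp [Nat.choose_succ_succ]
      ring
    · intro p hp
      obtain ⟨p', hp', h1, -⟩ := mem_support_lop_pow a hp
      rw [h1, hy p' hp']

theorem lmul_pow_sub_mem (v : Rˣ) {m : Multisegment} {i : ℤ} (hi : cg m (i + 1) 0 = 0) {y : Hall R}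
    (hy : y - uTil v (shift i m) ∈ lowerSpan R (shift i m)) :
    (lmul v i ^ cg m i 0) y - bfact v (cg m i 0) • uTil v m ∈ lowerSpan R m := by
  set a := cg m i 0 with ha
  have hsupp : ∀ p' ∈ y.support, RkLE p' (shift i m) := fun p' hp' => by
    by_cases h : p' = shift i m
    · rw [h]; exact RkLE.refl _
    · refine (mem_lowerSpan.mp hy p' ?_).1
      rw [Finsupp.sub_apply, uTil, uBasis, Finsupp.smul_apply, Finsupp.single_eq_of_ne h,
        smul_zero, sub_zero]
      exact Finsupp.mem_support_iff.mp hp'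
  have hval : (lmul v i ^ a) y m = bfact v a * (tcoef v m : R) := by
    have h1 : (lmul v i ^ a) y m = (lmul v i ^ a) (uTil v (shift i m)) m := by
      rw [← sub_eq_zero, ← Finsupp.sub_apply, ← map_sub]
      by_contra hc
      obtain ⟨p', hp', -, h2⟩ := mem_support_lop_pow a (Finsupp.mem_support_iff.mpr hc)
      have h3 := mem_lowerSpan.mp hy p' (Finsupp.mem_support_iff.mp hp')
      exact h3.2 (eq_shift_of_lengthening h3.1 h2)
    rw [h1, uTil, map_smul, lmul_pow_eq_smul v i a (d := dimVec (shift i m)), Finsupp.smul_apply,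
      Finsupp.smul_apply, lop_pow_leading, bfact, ← ha, smul_eq_mul, smul_eq_mul]
    · rw [← mul_assoc, mul_right_comm _ (qfact _ _)]
      congr 1
      obtain ⟨h2, h3⟩ := endDim_shift hi
      have h4 := totalDim_shift i m
      have h5 := dimVec_shift i m
      have h6 := DFunLike.congr_fun h5 i
      have h7 := DFunLike.congr_fun h5 (i + 1)
      simp only [Finsupp.add_apply, Finsupp.single_apply] at h6 h7
      simp at h6 h7
      rw [← Units.val_pow_eq_pow_val, ← Units.val_mul, ← Units.val_mul, tcoef, tcoef, inv_pow,
        ← zpow_natCast, ← zpow_neg, ← zpow_add, ← zpow_add]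
      congr 2
      rw [h3, ← h4]
      have h8 := Nat.choose_two_right a
      have h9 := Nat.even_mul_pred_self a
      have h10 : a.choose 2 * 2 = a * (a - 1) := by
        rw [h8, Nat.div_mul_cancel h9.two_dvd]
      have h11 : (a.choose 2 : ℤ) * 2 = a * (a - 1) := by
        rcases Nat.eq_zero_or_pos a with h0 | h0
        · simp [h0]
        · have := congrArg (Nat.cast : ℕ → ℤ) h10
          push_cast [Nat.cast_sub (show 1 ≤ a by omega)] at this
          exact this
      push_cast [Nat.cast_sub h2]
      rw [← h6, ← h7, ← ha]
      push_cast
      linear_combination h11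
    · intro p hp
      have := Finsupp.support_single_subset hp
      rw [Finset.mem_singleton] at this
      rw [this]
  rw [mem_lowerSpan]
  intro p hp
  have hne : p ≠ m := by
    rintro rfl
    refine hp ?_
    rw [Finsupp.sub_apply, hval, uTil, uBasis, Finsupp.smul_apply, Finsupp.smul_apply,
      Finsupp.single_eq_same]
    simp
  refine ⟨?_, hne⟩
  have hpy : p ∈ ((lmul v i ^ a) y).support := by
    rw [Finsupp.mem_support_iff]
    rwa [Finsupp.sub_apply, uTil, uBasis, Finsupp.smul_apply, Finsupp.smul_apply,
      Finsupp.single_eq_of_ne hne, smul_zero, smul_zero, sub_zero] at hp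
  obtain ⟨p', hp', h1, h2⟩ := mem_support_lop_pow a hpy
  exact rkLE_of_lengthening hi (hsupp p' hp') h1 h2

theorem rk_smul_seg_one (i : ℤ) (a : ℕ) {j l : ℤ} (h : j < l) : rk (a • seg i 1) j l = 0 := by
  induction a with
  | zero => simp [rk]
  | succ a ih =>
    rw [succ_nsmul, rk_add, ih, zero_add, ← segN_one, rk_segN i 1 h.le, if_neg]
    push_cast
    omega

/-- Semisimple representations are minimal for the degeneration order. -/
theorem eq_of_rkLE_of_rk_eq_zero {p m : Multisegment} (h : RkLE p m)
    (hm : ∀ j l, j < l → rk m j l = 0) : p = m := by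
  refine eq_of_rk_eq fun i j hij => ?_
  rcases hij.eq_or_lt with rfl | hlt
  · rw [← dimVec_apply, ← dimVec_apply, h.1]
  · have := h.2 i j hij
    have := hm i j hlt
    omega

theorem mem_of_sub_mem_lowerSpan {m : Multisegment} (hm : ∀ j l, j < l → rk m j l = 0)
    {y z : Hall R} (h : y - z ∈ lowerSpan R m) : y = z := by
  rw [← sub_eq_zero]
  ext p
  by_contra hc
  have := mem_lowerSpan.mp h p hc
  exact this.2 (eq_of_rkLE_of_rk_eq_zero this.1 hm)

theorem uTil_zero (v : Rˣ) : uTil v 0 = uBasis R 0 := by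
  simp [uTil, tcoef, endDim, totalDim]

theorem cg_smul_seg_one (i : ℤ) (a : ℕ) (j : ℤ) : cg (a • seg i 1) j 0 = if i = j then a else 0 := by
  induction a with
  | zero => simp [cg]
  | succ a ih =>
    rw [succ_nsmul, cg_add, ih, ← segN_one, cg_segN]
    split_ifs <;> simp_all

theorem shift_smul_seg_one (i : ℤ) (a : ℕ) : shift i (a • seg i 1) = 0 := by
  rw [map_nsmul, ← segN_one, shift_segN_self, segN_zero, smul_zero]

/-- The power `u_i^a` is a multiple of the divided power `ũ_{a S_i}`. -/
theorem lmul_pow_uBasis_zero (v : Rˣ) (i : ℤ) (a : ℕ) :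
    (lmul v i ^ a) (uBasis R 0) = bfact v a • uTil v (a • seg i 1) := by
  have h1 := lmul_pow_sub_mem (R := R) v (m := a • seg i 1) (i := i) (y := uBasis R 0)
    (by rw [cg_smul_seg_one, if_neg (by omega)])
    (by rw [shift_smul_seg_one, uTil_zero, sub_self]; exact Submodule.zero_mem _)
  rw [cg_smul_seg_one, if_pos rfl] at h1
  exact mem_of_sub_mem_lowerSpan (fun j l h => rk_smul_seg_one i a h) h1

/-- Left multiplication by the divided power `ũ_{a S_i}`. -/
abbrev divMul (v : Rˣ) (i : ℤ) (a : ℕ) : Hall R →ₗ[R] Hall R :=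
  hallMul R v (uTil v (a • seg i 1))

theorem bfact_smul_divMul (v : Rˣ) (i : ℤ) (a : ℕ) (y : Hall R) :
    bfact v a • divMul v i a y = (lmul v i ^ a) y := by
  rw [lmul_pow, lmul_pow_uBasis_zero, map_smul, LinearMap.smul_apply]

theorem ne_zero_of_mem_qProducts [IsDomain R] {t : R} (hq : ∀ n, qn t (n + 1) ≠ 0) {D : R}
    (h : D ∈ qProducts t) : D ≠ 0 := by
  induction h using Submonoid.closure_induction with
  | mem x hx => obtain ⟨n, rfl⟩ := hx; exact hq n
  | one => exact one_ne_zero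
  | mul x y _ _ hx hy => exact mul_ne_zero hx hy

theorem bfact_ne_zero [IsDomain R] (v : Rˣ) (hq : ∀ n, qn ((v : R) ^ 2) (n + 1) ≠ 0) (a : ℕ) :
    bfact v a ≠ 0 :=
  mul_ne_zero (pow_ne_zero _ (Units.ne_zero _)) (ne_zero_of_mem_qProducts hq (qfact_mem _ _))

/-- Multiplication by a divided power is unitriangular. -/
theorem divMul_sub_mem [IsDomain R] (v : Rˣ) (hq : ∀ n, qn ((v : R) ^ 2) (n + 1) ≠ 0)
    {m : Multisegment} {i : ℤ} (hi : cg m (i + 1) 0 = 0) {y : Hall R}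
    (hy : y - uTil v (shift i m) ∈ lowerSpan R (shift i m)) :
    divMul v i (cg m i 0) y - uTil v m ∈ lowerSpan R m := by
  have h1 := lmul_pow_sub_mem v hi hy
  rw [← bfact_smul_divMul, ← smul_sub] at h1
  rw [mem_lowerSpan] at h1 ⊢
  exact fun p hp => h1 p (by
    rw [Finsupp.smul_apply]
    exact smul_ne_zero (bfact_ne_zero v hq _) hp)

/-- A set which is closed under multiplication by divided powers contains an element with leading
term `ũ_m`: a monomial in the divided powers. -/
theorem exists_mem_sub_mem_lowerSpan [IsDomain R] (v : Rˣ)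
    (hq : ∀ n, qn ((v : R) ^ 2) (n + 1) ≠ 0) (B : Set (Hall R)) (h0 : uBasis R 0 ∈ B)
    (hB : ∀ i a, ∀ y ∈ B, divMul v i a y ∈ B) (m : Multisegment) :
    ∃ y ∈ B, y - uTil v m ∈ lowerSpan R m := by
  induction m using multisegment_induction with
  | h0 => exact ⟨_, h0, by rw [uTil_zero, sub_self]; exact Submodule.zero_mem _⟩
  | h1 m i hi hmax ih1 _ =>
    obtain ⟨y, hy, hym⟩ := ih1
    exact ⟨_, hB i _ y hy, divMul_sub_mem v hq (hmax _ (by omega)) hym⟩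

theorem eq_sum_smul_uBasis (y : Hall R) : y = ∑ p ∈ y.support, y p • uBasis R p := by
  conv_lhs => rw [← y.sum_single, Finsupp.sum]
  exact Finset.sum_congr rfl fun p _ => by simp [uBasis]

/-- The Hall algebra is generated by the divided powers, without denominators. -/
theorem eq_top_of_divMul_mem [IsDomain R] (v : Rˣ) (hq : ∀ n, qn ((v : R) ^ 2) (n + 1) ≠ 0)
    (W : Submodule R (Hall R)) (h0 : uBasis R 0 ∈ W)
    (hW : ∀ i a, ∀ y ∈ W, divMul v i a y ∈ W) (y : Hall R) : y ∈ W := by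
  have h1 : ∀ m, uBasis R m ∈ W := by
    intro m
    induction m using multisegment_induction with
    | h0 => exact h0
    | h1 m i _ _ _ ih2 =>
      obtain ⟨y, hy, hym⟩ := exists_mem_sub_mem_lowerSpan v hq (W : Set (Hall R)) h0 hW m
      have h2 : y - uTil v m ∈ W := by
        rw [eq_sum_smul_uBasis (y - uTil v m)]
        refine W.sum_mem fun p hp => W.smul_mem _ ?_
        have := mem_lowerSpan.mp hym p (Finsupp.mem_support_iff.mp hp)
        exact ih2 p this.1 this.2
      have h3 := W.sub_mem hy h2
      rw [sub_sub_cancel, uTil] at h3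
      have := W.smul_mem ((tcoef v m)⁻¹ : Rˣ) h3
      rwa [smul_smul, Units.inv_mul, one_smul] at this
  rw [eq_sum_smul_uBasis y]
  exact W.sum_mem fun p _ => W.smul_mem _ (h1 p)

theorem rk_semisimple (d : ℤ →₀ ℕ) {j l : ℤ} (h : j < l) : rk (semisimple d) j l = 0 := by
  unfold semisimple Finsupp.sum rk
  rw [wt_finsetSum]
  exact Finset.sum_eq_zero fun i _ => rk_smul_seg_one i (d i) h

theorem semisimple_single (i : ℤ) (a : ℕ) : semisimple (Finsupp.single i a) = a • seg i 1 := by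
  rw [semisimple, Finsupp.sum_single_index (by simp)]

theorem uTil_semisimple_mem [IsDomain R] (v : Rˣ) (hq : ∀ n, qn ((v : R) ^ 2) (n + 1) ≠ 0)
    (B : Set (Hall R)) (h0 : uBasis R 0 ∈ B) (hB : ∀ i a, ∀ y ∈ B, divMul v i a y ∈ B)
    (d : ℤ →₀ ℕ) : uTil v (semisimple d) ∈ B := by
  obtain ⟨y, hy, hyd⟩ := exists_mem_sub_mem_lowerSpan v hq B h0 hB (semisimple d)
  rwa [← mem_of_sub_mem_lowerSpan (fun j l h => rk_semisimple d h) hyd]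

/-- Torsion-free form of the generation by simple representations. -/
theorem eq_top_of_lmul_mem [IsDomain R] (v : Rˣ) (hq : ∀ n, qn ((v : R) ^ 2) (n + 1) ≠ 0)
    (W : Submodule R (Hall R)) (h0 : uBasis R 0 ∈ W) (hW : ∀ i, ∀ y ∈ W, lmul v i y ∈ W)
    (htors : ∀ (a : R) y, a ≠ 0 → a • y ∈ W → y ∈ W) (y : Hall R) : y ∈ W := by
  rw [eq_sum_smul_uBasis y]
  refine W.sum_mem fun p _ => W.smul_mem _ ?_
  obtain ⟨D, hD, hDW⟩ := exists_smul_uBasis_mem ((v : R) ^ 2) (fun i => gcoef v i)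
    (fun i d => isUnit_gcoef v i d) W h0 hW p
  exact htors D _ (ne_zero_of_mem_qProducts hq hD) hDW

end Ring

/-! ### Words in the generators -/

section Words

variable {R : Type} [CommRing R]

/-- Prefix a letter to words. -/
def wordCons (R : Type) [CommRing R] (j : ℤ) : (List ℤ →₀ R) →ₗ[R] (List ℤ →₀ R) :=
  Finsupp.lmapDomain R R (List.cons j)

theorem wordCons_single (j : ℤ) (w : List ℤ) (a : R) :
    wordCons R j (Finsupp.single w a) = Finsupp.single (j :: w) a := by
  simp [wordCons]

/-- Induction on linear combinations of words. -/
theorem word_induction {P : (List ℤ →₀ R) → Prop} (hadd : ∀ x y, P x → P y → P (x + y))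
    (hsmul : ∀ (a : R) x, P x → P (a • x)) (hnil : P (Finsupp.single [] 1))
    (hcons : ∀ j x, P x → P (wordCons R j x)) (x : List ℤ →₀ R) : P x := by
  have h1 : ∀ w, P (Finsupp.single w 1) := by
    intro w
    induction w with
    | nil => exact hnil
    | cons j w ih => rw [← wordCons_single]; exact hcons j _ ih
  induction x using Finsupp.induction_linear with
  | zero => rw [← zero_smul R (Finsupp.single [] 1)]; exact hsmul _ _ hnil
  | add x y hx hy => exact hadd x y hx hy
  | single w a => rw [← mul_one a, ← smul_eq_mul, ← Finsupp.smul_single]; exact hsmul _ _ (h1 w)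

/-- The element of the Hall algebra given by a word. -/
def wordHall (v : Rˣ) : (List ℤ →₀ R) →ₗ[R] Hall R :=
  Finsupp.linearCombination R fun w => w.foldr (fun j y => lmul v j y) (uBasis R 0)

theorem wordHall_nil (v : Rˣ) : wordHall v (Finsupp.single [] 1) = uBasis R 0 := by
  rw [wordHall, Finsupp.linearCombination_single, one_smul]
  rfl

theorem wordHall_cons (v : Rˣ) (j : ℤ) (x : List ℤ →₀ R) :
    wordHall v (wordCons R j x) = lmul v j (wordHall v x) := by
  induction x using Finsupp.induction_linear with
  | zero => simp
  | add x y hx hy => simp only [map_add, hx, hy]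
  | single w a =>
    rw [wordCons_single, wordHall, Finsupp.linearCombination_single,
      Finsupp.linearCombination_single, map_smul]
    rfl

/-- The twisted derivation `e_i` on words. -/
def wordDer (v : Rˣ) (i : ℤ) : (List ℤ →₀ R) →ₗ[R] (List ℤ →₀ R) :=
  Finsupp.linearCombination R fun w => w.rec 0 fun j w y =>
    (if i = j then Finsupp.single w 1 else 0) + ((v ^ cartan i j : Rˣ) : R) • wordCons R j y

theorem wordDer_nil (v : Rˣ) (i : ℤ) : wordDer v i (Finsupp.single [] 1) = 0 := by
  rw [wordDer, Finsupp.linearCombination_single, one_smul]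

theorem wordDer_cons (v : Rˣ) (i j : ℤ) (x : List ℤ →₀ R) : wordDer v i (wordCons R j x) =
    (if i = j then x else 0) + ((v ^ cartan i j : Rˣ) : R) • wordCons R j (wordDer v i x) := by
  induction x using Finsupp.induction_linear with
  | zero => simp
  | add x y hx hy =>
    simp only [map_add, hx, hy, smul_add]
    split_ifs <;> abel
  | single w a =>
    rw [wordCons_single, wordDer, Finsupp.linearCombination_single,
      Finsupp.linearCombination_single, map_smul, smul_add, smul_comm a]
    congr 1
    split_ifs <;> simp

theorem wordHall_der (v : Rˣ) (i : ℤ) (x : List ℤ →₀ R) :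
    wordHall v (wordDer v i x) = eop v i (wordHall v x) := by
  induction x using word_induction with
  | hadd x y hx hy => simp only [map_add, hx, hy]
  | hsmul a x hx => simp only [map_smul, hx]
  | hnil => rw [wordDer_nil, map_zero, wordHall_nil, eop_zero]
  | hcons j x hx =>
    rw [wordDer_cons, wordHall_cons, eop_lmul, map_add, map_smul, wordHall_cons, hx]
    split_ifs <;> simp

theorem wordCons_apply_nil (j : ℤ) (x : List ℤ →₀ R) : wordCons R j x [] = 0 := by
  induction x using Finsupp.induction_linear with
  | zero => simp
  | add x y hx hy => rw [map_add, Finsupp.add_apply, hx, hy, add_zero]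
  | single w a => rw [wordCons_single, Finsupp.single_eq_of_ne (by simp)]

theorem wordHall_apply_zero (v : Rˣ) (x : List ℤ →₀ R) : wordHall v x 0 = x [] := by
  induction x using word_induction with
  | hadd x y hx hy => simp only [map_add, Finsupp.add_apply, hx, hy]
  | hsmul a x hx => simp only [map_smul, Finsupp.smul_apply, hx]
  | hnil => rw [wordHall_nil]; simp [uBasis]
  | hcons j x _ =>
    rw [wordHall_cons, wordCons_apply_nil, lmul, lop_apply]
    simp [totalDim]

theorem cartan_comm (i j : ℤ) : cartan i j = cartan j i := by
  unfold cartan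
  split_ifs <;> omega

/-- The twisted derivations for `v` and for `v⁻¹` commute up to a power of `v`. -/
theorem wordDer_comm (v : Rˣ) (i j : ℤ) (x : List ℤ →₀ R) : wordDer v i (wordDer v⁻¹ j x) =
    ((v ^ (-cartan i j) : Rˣ) : R) • wordDer v⁻¹ j (wordDer v i x) := by
  induction x using word_induction with
  | hadd x y hx hy => simp only [map_add, hx, hy, smul_add]
  | hsmul a x hx => simp only [map_smul, hx, smul_comm a]
  | hnil => rw [wordDer_nil, wordDer_nil]; simp
  | hcons l x hx =>
    simp only [wordDer_cons, map_add, map_smul, hx, smul_add, smul_smul]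
    by_cases hi : i = l <;> by_cases hj : j = l
    · subst hi; subst hj
      simp only [if_true, ← Units.val_mul, inv_zpow', ← zpow_add, neg_add_cancel, zpow_zero,
        Units.val_one, one_smul]
      rw [add_comm (-cartan j j)]
      simp [add_left_comm]
    · subst hi
      simp only [if_true, if_neg hj, map_zero, smul_zero, zero_add, ← Units.val_mul,
        inv_zpow', ← zpow_add, cartan_comm j i]
    · subst hj
      simp only [if_true, if_neg hi, map_zero, smul_zero, zero_add, ← Units.val_mul,
        inv_zpow', ← zpow_add, neg_add_cancel, zpow_zero, Units.val_one, one_smul]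
      congr 3
      ring_nf
    · simp only [if_neg hi, if_neg hj, map_zero, smul_zero, zero_add, ← Units.val_mul]
      rw [show v⁻¹ ^ cartan j l * (v ^ cartan i l * v ^ (-cartan i j)) =
        v ^ (-cartan i j) * (v ^ cartan i l * v⁻¹ ^ cartan j l) by ac_rfl]

theorem wordDer_inv_apply_nil (v : Rˣ) (i : ℤ) (x : List ℤ →₀ R) :
    wordDer v⁻¹ i x [] = wordDer v i x [] := by
  induction x using word_induction with
  | hadd x y hx hy => simp only [map_add, Finsupp.add_apply, hx, hy]
  | hsmul a x hx => simp only [map_smul, Finsupp.smul_apply, hx]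
  | hnil => rw [wordDer_nil, wordDer_nil]
  | hcons j x _ =>
    rw [wordDer_cons, wordDer_cons, Finsupp.add_apply, Finsupp.add_apply, Finsupp.smul_apply,
      Finsupp.smul_apply, wordCons_apply_nil, wordCons_apply_nil, smul_zero, smul_zero]

/-- The radical on words, that is, the space of the combinations of words whose images under all
composites of the derivations have no component in degree `0`, is the same for `v` and for `v⁻¹`:
both families of derivations end in the same component, and they commute up to powers of `v`. -/
theorem radical_inv (v : Rˣ) (l : List ℤ) : ∀ x : List ℤ →₀ R,
    (∀ l : List ℤ, l.foldr (fun i x => wordDer v i x) x [] = 0) →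
    l.foldr (fun i x => wordDer v⁻¹ i x) x [] = 0 := by
  induction l with
  | nil =>
    intro x hx
    have := hx []
    rw [List.foldr_nil] at this ⊢
    exact this
  | cons i l ih =>
    intro x hx
    have hcomm : ∀ l : List ℤ, ∃ c : R, wordDer v i (l.foldr (fun i x => wordDer v⁻¹ i x) x) =
        c • l.foldr (fun i x => wordDer v⁻¹ i x) (wordDer v i x) := by
      intro l
      induction l with
      | nil => exact ⟨1, by simp⟩
      | cons j l ihl =>
        obtain ⟨c, hc⟩ := ihl
        exact ⟨_, by rw [List.foldr_cons, wordDer_comm, hc, map_smul, smul_smul, List.foldr_cons]⟩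
    obtain ⟨c, hc⟩ := hcomm l
    rw [List.foldr_cons, wordDer_inv_apply_nil, hc, Finsupp.smul_apply, ih, smul_zero]
    intro l'
    have := hx (l' ++ [i])
    rwa [List.foldr_append] at this

theorem totalDim_of_mem_support_eop (v : Rˣ) (i : ℤ) {y : Hall R} {p : Multisegment}
    (h : p ∈ (eop v i y).support) : ∃ m ∈ y.support, totalDim p + 1 = totalDim m := by
  classical
  by_contra hc
  push Not at hc
  refine Finsupp.mem_support_iff.mp h ?_
  conv_lhs => rw [eq_sum_smul_uBasis y, map_sum, Finsupp.finsetSum_apply]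
  refine Finset.sum_eq_zero fun m hm => ?_
  rw [map_smul, eop_uBasis v i m _ le_rfl, Finsupp.smul_apply, Finsupp.finsetSum_apply,
    Finset.sum_eq_zero, smul_zero]
  intro n _
  split_ifs with hn
  · have : red m i n ≠ p := fun he => hc m hm (by rw [← he, totalDim_red hn])
    simp [uBasis, this]
  · rfl

/-- The kernel of the map from words to the Hall algebra is the radical, as the Hall algebra itself
has no radical by `eq_zero_of_eop_eq_zero`. -/
theorem wordHall_eq_zero_iff [IsDomain R] (v : Rˣ) (hq : ∀ n, qn ((v : R) ^ 2) (n + 1) ≠ 0)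
    (h1 : (v : R) ^ 2 ≠ 1) (x : List ℤ →₀ R) :
    wordHall v x = 0 ↔ ∀ l : List ℤ, l.foldr (fun i x => wordDer v i x) x [] = 0 := by
  have hl : ∀ l : List ℤ, wordHall v (l.foldr (fun i x => wordDer v i x) x) =
      l.foldr (fun i y => eop v i y) (wordHall v x) := by
    intro l
    induction l with
    | nil => rfl
    | cons i l ih => rw [List.foldr_cons, wordHall_der, ih, List.foldr_cons]
  simp only [← wordHall_apply_zero v, hl]
  generalize wordHall v x = y
  constructor
  · rintro rfl l
    have : l.foldr (fun i y => eop v i y) (0 : Hall R) = 0 := by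
      induction l with
      | nil => rfl
      | cons i l ih => rw [List.foldr_cons, ih, map_zero]
    rw [this, Finsupp.zero_apply]
  · have key : ∀ N, ∀ y : Hall R, (∀ p ∈ y.support, totalDim p ≤ N) →
        (∀ l : List ℤ, l.foldr (fun i y => eop v i y) y 0 = 0) → y = 0 := by
      intro N
      induction N with
      | zero =>
        intro y hN hy
        ext p
        by_cases hp : p = 0
        · rw [hp]; exact hy []
        · by_contra hc
          have h2 := hN p (Finsupp.mem_support_iff.mpr hc)
          refine hp ?_
          have h3 := (wt_eq_zero_iff (fun p => (p.2 : ℕ)) p).mp (Nat.le_zero.mp h2)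
          ext q
          by_contra hq'
          exact q.2.ne_zero (h3 q hq')
      | succ N ih =>
        intro y hN hy
        have h2 : ∀ i, eop v i y = 0 := fun i => by
          refine ih _ (fun p hp => ?_) fun l => ?_
          · obtain ⟨m, hm, h3⟩ := totalDim_of_mem_support_eop v i hp
            have := hN m hm
            omega
          · have := hy (l ++ [i])
            rwa [List.foldr_append] at this
        ext p
        by_cases hp : p = 0
        · rw [hp]; exact hy []
        · exact eq_zero_of_eop_eq_zero v hq h1 h2 p hp
    exact key (y.support.sup totalDim) y fun p hp => Finset.le_sup hp

end Words

/-! ### The bar involution -/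

theorem qn_vZ_ne_zero (n : ℕ) : qn ((vZ : Z) ^ 2) (n + 1) ≠ 0 := by
  intro h
  have h1 := congrArg (LaurentPolynomial.eval₂ (RingHom.id ℤ) (1 : ℤˣ)) h
  rw [map_qn, map_zero, map_pow] at h1
  have h2 : LaurentPolynomial.eval₂ (RingHom.id ℤ) (1 : ℤˣ) (vZ : Z) = 1 := by
    change LaurentPolynomial.eval₂ (RingHom.id ℤ) (1 : ℤˣ) (LaurentPolynomial.T 1) = 1
    rw [LaurentPolynomial.eval₂_T]
    simp
  rw [h2] at h1
  simp [qn] at h1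
  omega

theorem vZ_sq_ne_one : (vZ : Z) ^ 2 ≠ 1 := by
  intro h
  let two : ℚˣ := Units.mk0 2 two_ne_zero
  have h1 := congrArg (LaurentPolynomial.eval₂ (Int.castRingHom ℚ) two) h
  have h2 : LaurentPolynomial.eval₂ (Int.castRingHom ℚ) two (vZ : Z) = 2 := by
    change LaurentPolynomial.eval₂ (Int.castRingHom ℚ) two (LaurentPolynomial.T 1) = 2
    rw [LaurentPolynomial.eval₂_T]
    simp [two]
  rw [map_pow, h2, map_one] at h1
  norm_num at h1

/-- The bar involution of the ring of scalars. -/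
abbrev barZ : Z ≃ₐ[ℤ] Z := LaurentPolynomial.invert

theorem barZ_barZ (a : Z) : barZ (barZ a) = a := LaurentPolynomial.involutive_invert a

theorem map_vZ : Units.map (barZ : Z →* Z) vZ = vZ⁻¹ := by
  refine Units.ext ?_
  change barZ (LaurentPolynomial.T 1) = LaurentPolynomial.T (-1)
  rw [LaurentPolynomial.invert_T]

theorem barZ_vZ_zpow (n : ℤ) : barZ ((vZ ^ n : Zˣ) : Z) = ((vZ⁻¹ ^ n : Zˣ) : Z) := by
  rw [← map_vZ, ← map_zpow, Units.coe_map]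
  rfl

theorem barZ_vZ : barZ (vZ : Z) = ((vZ⁻¹ : Zˣ) : Z) := by
  have := barZ_vZ_zpow 1
  rwa [zpow_one, zpow_one] at this

theorem barZ_bfact (a : ℕ) : barZ (bfact vZ a) = bfact vZ a := by
  have hb : ∀ n, bfact (R := Z) vZ (n + 1) = ((vZ⁻¹ : Zˣ) : Z) ^ n * qn ((vZ : Z) ^ 2) (n + 1) *
      bfact vZ n := fun n => by
    rw [bfact, bfact, qfact, Nat.choose_succ_succ, pow_add, Nat.choose_one_right]
    ring
  induction a with
  | zero => simp [bfact, qfact]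
  | succ n ih =>
    rw [hb, map_mul, ih]
    congr 1
    have hinv : barZ ((vZ⁻¹ : Zˣ) : Z) = (vZ : Z) := by rw [← barZ_vZ, barZ_barZ]
    have hv : (vZ : Z) * ((vZ⁻¹ : Zˣ) : Z) = 1 := Units.mul_inv _
    have hvk : ∀ k, (vZ : Z) ^ k * ((vZ⁻¹ : Zˣ) : Z) ^ k = 1 := fun k => by
      rw [← mul_pow, hv, one_pow]
    have h1 : barZ (qn ((vZ : Z) ^ 2) (n + 1)) = qn (((vZ⁻¹ : Zˣ) : Z) ^ 2) (n + 1) := by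
      have := map_qn (barZ : Z →+* Z) ((vZ : Z) ^ 2) (n + 1)
      rw [map_pow] at this
      change barZ (qn _ _) = qn (barZ (vZ : Z) ^ 2) _ at this
      rw [this, barZ_vZ]
    rw [map_mul, map_pow, hinv, h1, qn, qn, ← Finset.sum_range_reflect, Finset.mul_sum,
      Finset.mul_sum]
    refine Finset.sum_congr rfl fun k hk => ?_
    rw [Finset.mem_range] at hk
    obtain ⟨l, rfl⟩ : ∃ l, n = k + l := ⟨n - k, by omega⟩
    rw [show k + l + 1 - 1 - k = l by omega, ← pow_mul, ← pow_mul, mul_comm 2 l, mul_comm 2 k,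
      pow_mul, pow_mul, sq, sq, pow_add, pow_add]
    linear_combination ((vZ : Z) ^ k * ((vZ⁻¹ : Zˣ) : Z) ^ l) * (hvk l - hvk k)

/-- The bar involution on words. -/
def wordBar : (List ℤ →₀ Z) →+ (List ℤ →₀ Z) := Finsupp.mapRange.addMonoidHom (barZ : Z →+ Z)

theorem wordBar_single (w : List ℤ) (a : Z) :
    wordBar (Finsupp.single w a) = Finsupp.single w (barZ a) := by
  rw [wordBar, Finsupp.mapRange.addMonoidHom_apply, Finsupp.mapRange_single]
  rfl

theorem wordBar_apply (x : List ℤ →₀ Z) (w : List ℤ) : wordBar x w = barZ (x w) := rfl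

theorem wordBar_smul (a : Z) (x : List ℤ →₀ Z) : wordBar (a • x) = barZ a • wordBar x := by
  ext w : 1
  rw [wordBar_apply, Finsupp.smul_apply, Finsupp.smul_apply, wordBar_apply, smul_eq_mul, map_mul,
    smul_eq_mul]

theorem wordBar_wordBar (x : List ℤ →₀ Z) : wordBar (wordBar x) = x := by
  ext w : 1
  rw [wordBar_apply, wordBar_apply, barZ_barZ]

theorem wordBar_cons (j : ℤ) (x : List ℤ →₀ Z) :
    wordBar (wordCons Z j x) = wordCons Z j (wordBar x) := by
  induction x using Finsupp.induction_linear with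
  | zero => simp
  | add x y hx hy => simp only [map_add, hx, hy]
  | single w a => rw [wordCons_single, wordBar_single, wordBar_single, wordCons_single]

theorem wordBar_der (i : ℤ) (x : List ℤ →₀ Z) :
    wordBar (wordDer vZ i x) = wordDer vZ⁻¹ i (wordBar x) := by
  induction x using word_induction with
  | hadd x y hx hy => simp only [map_add, hx, hy]
  | hsmul a x hx => rw [map_smul, wordBar_smul, hx, wordBar_smul, map_smul]
  | hnil => rw [wordDer_nil, wordBar_single, map_one, wordDer_nil, map_zero]
  | hcons j x hx =>
    rw [wordDer_cons, wordBar_cons, wordDer_cons, map_add, wordBar_smul, wordBar_cons, hx,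
      barZ_vZ_zpow]
    split_ifs <;> simp

/-- The kernel of the map from words to the Hall algebra is stable under the bar involution. -/
theorem wordHall_bar {x : List ℤ →₀ Z} (h : wordHall vZ x = 0) : wordHall vZ (wordBar x) = 0 := by
  rw [wordHall_eq_zero_iff vZ qn_vZ_ne_zero vZ_sq_ne_one] at h ⊢
  intro l
  have h1 : ∀ l : List ℤ, l.foldr (fun i x => wordDer vZ i x) (wordBar x) =
      wordBar (l.foldr (fun i x => wordDer vZ⁻¹ i x) x) := by
    intro l
    induction l with
    | nil => rfl
    | cons i l ih =>
      rw [List.foldr_cons, List.foldr_cons, ih, ← wordBar_wordBar (wordDer vZ i _), wordBar_der,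
        wordBar_wordBar]
  rw [h1, wordBar_apply, radical_inv vZ l x h, map_zero]

theorem hall_smul_cancel {a : Z} (ha : a ≠ 0) {x y : Hall Z} (h : a • x = a • y) : x = y := by
  ext p : 1
  have := DFunLike.congr_fun h p
  rw [Finsupp.smul_apply, Finsupp.smul_apply] at this
  exact mul_left_cancel₀ ha this

/-- The graph of the bar involution: `y` and `y'` are, after multiplication with conjugate scalars,
given by conjugate words in the generators. -/
def BarRel (y y' : Hall Z) : Prop :=
  ∃ D : Z, D ≠ 0 ∧ ∃ w, D • y = wordHall vZ w ∧ barZ D • y' = wordHall vZ (wordBar w)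

theorem barZ_ne_zero {a : Z} (h : a ≠ 0) : barZ a ≠ 0 := by
  rwa [Ne, map_eq_zero_iff _ barZ.injective]

theorem BarRel.unique {y y' y'' : Hall Z} (h : BarRel y y') (h' : BarRel y y'') : y' = y'' := by
  obtain ⟨D, hD, w, h1, h2⟩ := h
  obtain ⟨E, hE, z, h3, h4⟩ := h'
  have h5 : wordHall vZ (E • w - D • z) = 0 := by
    rw [map_sub, map_smul, map_smul, ← h1, ← h3, smul_comm, sub_self]
  have h6 := wordHall_bar h5
  rw [map_sub, wordBar_smul, wordBar_smul, map_sub, map_smul, map_smul, ← h2, ← h4, sub_eq_zero,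
    smul_comm] at h6
  exact hall_smul_cancel (barZ_ne_zero hE) (hall_smul_cancel (barZ_ne_zero hD) h6)

theorem BarRel.symm {y y' : Hall Z} (h : BarRel y y') : BarRel y' y := by
  obtain ⟨D, hD, w, h1, h2⟩ := h
  exact ⟨barZ D, barZ_ne_zero hD, wordBar w, h2, by rw [barZ_barZ, wordBar_wordBar, h1]⟩

theorem BarRel.add {y y' z z' : Hall Z} (h : BarRel y y') (h' : BarRel z z') :
    BarRel (y + z) (y' + z') := by
  obtain ⟨D, hD, w, h1, h2⟩ := h
  obtain ⟨E, hE, x, h3, h4⟩ := h'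
  refine ⟨D * E, mul_ne_zero hD hE, E • w + D • x, ?_, ?_⟩
  · rw [map_add, map_smul, map_smul, ← h1, ← h3]
    module
  · rw [map_add, wordBar_smul, wordBar_smul, map_add, map_smul, map_smul, ← h2, ← h4, map_mul]
    module

theorem BarRel.smul (a : Z) {y y' : Hall Z} (h : BarRel y y') : BarRel (a • y) (barZ a • y') := by
  obtain ⟨D, hD, w, h1, h2⟩ := h
  refine ⟨D, hD, a • w, ?_, ?_⟩
  · rw [map_smul, ← h1, smul_comm]
  · rw [wordBar_smul, map_smul, ← h2, smul_comm]

theorem BarRel.one : BarRel (uBasis Z 0) (uBasis Z 0) :=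
  ⟨1, one_ne_zero, Finsupp.single [] 1, by rw [one_smul, wordHall_nil], by
    rw [map_one, one_smul, wordBar_single, map_one, wordHall_nil]⟩

theorem BarRel.lmul (i : ℤ) {y y' : Hall Z} (h : BarRel y y') :
    BarRel (lmul vZ i y) (lmul vZ i y') := by
  obtain ⟨D, hD, w, h1, h2⟩ := h
  exact ⟨D, hD, wordCons Z i w, by rw [wordHall_cons, ← h1, map_smul], by
    rw [wordBar_cons, wordHall_cons, ← h2, map_smul]⟩

theorem BarRel.divMul (i : ℤ) (a : ℕ) {y y' : Hall Z} (h : BarRel y y') :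
    BarRel (divMul vZ i a y) (divMul vZ i a y') := by
  have h1 : ∀ a, BarRel ((FockHall.lmul vZ i ^ a) y) ((FockHall.lmul vZ i ^ a) y') := by
    intro a
    induction a with
    | zero => exact h
    | succ a ih => rw [pow_succ']; exact ih.lmul i
  obtain ⟨D, hD, w, h2, h3⟩ := h1 a
  rw [← bfact_smul_divMul, smul_smul] at h2 h3
  exact ⟨D * bfact vZ a, mul_ne_zero hD (bfact_ne_zero vZ qn_vZ_ne_zero a), w, h2, by
    rw [map_mul, barZ_bfact, h3]⟩

theorem exists_barRel (y : Hall Z) : ∃ y', BarRel y y' := by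
  let W : Submodule Z (Hall Z) :=
    { carrier := {y | ∃ y', BarRel y y'}
      add_mem' := fun ⟨_, h⟩ ⟨_, h'⟩ => ⟨_, h.add h'⟩
      zero_mem' := ⟨0, 1, one_ne_zero, 0, by simp, by simp⟩
      smul_mem' := fun a _ ⟨_, h⟩ => ⟨_, h.smul a⟩ }
  exact eq_top_of_divMul_mem vZ qn_vZ_ne_zero W ⟨_, BarRel.one⟩
    (fun i a _ ⟨_, h⟩ => ⟨_, h.divMul i a⟩) y

theorem uTilde_eq (k : Type u) [Field k] (m : Multisegment) : uTilde k m = uTil vZ m := by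
  rw [uTilde, uTil, tcoef, finrank_end_repOf]
  rfl

/-- Existence of the bar involution. The relation `BarRel` is total because the divided powers
generate the Hall algebra, and it is functional because the kernel of the map from words is stable
under conjugation. -/
theorem exists_isBarInvolution (k : Type u) [Field k] : ∃ bar, IsBarInvolution k bar := by
  choose f hf using exists_barRel
  let bar : Hall Z →+ Hall Z := AddMonoidHom.mk' f fun x y => (hf (x + y)).unique ((hf x).add (hf y))
  have hbar : ∀ y, BarRel y (bar y) := hf
  have hsmul : ∀ (a : Z) x, bar (a • x) = barZ a • bar x := fun a x =>
    (hbar _).unique ((hbar x).smul a)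
  have hone : bar (uBasis Z 0) = uBasis Z 0 := (hbar _).unique BarRel.one
  have hl : ∀ i y, bar (lmul vZ i y) = lmul vZ i (bar y) := fun i y =>
    (hbar _).unique ((hbar y).lmul i)
  refine ⟨bar, hsmul, fun x y => ?_, fun x => (hbar _).unique (hbar x).symm, fun d => ?_⟩
  · let W : Submodule Z (Hall Z) :=
      { carrier := {x | bar (hallMul Z vZ x y) = hallMul Z vZ (bar x) (bar y)}
        add_mem' := fun {a b} ha hb => by
          simp only [Set.mem_ofPred_eq] at ha hb ⊢
          rw [map_add, LinearMap.add_apply, map_add, ha, hb, map_add, map_add, LinearMap.add_apply]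
        zero_mem' := by simp
        smul_mem' := fun a x hx => by
          simp only [Set.mem_ofPred_eq] at hx ⊢
          rw [map_smul, LinearMap.smul_apply, hsmul, hx, hsmul, map_smul, LinearMap.smul_apply] }
    refine eq_top_of_lmul_mem vZ qn_vZ_ne_zero W ?_ (fun i x hx => ?_) (fun a x ha hx => ?_) x
    · change bar (hallMul Z vZ (uBasis Z 0) y) = hallMul Z vZ (bar (uBasis Z 0)) (bar y)
      rw [hone, hallMul_zero_left]
      rfl
    · change bar (hallMul Z vZ (lmul vZ i x) y) = hallMul Z vZ (bar (lmul vZ i x)) (bar y)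
      have hx' : bar (hallMul Z vZ x y) = hallMul Z vZ (bar x) (bar y) := hx
      rw [hallMul_lmul, hl, hl, hallMul_lmul, hx']
    · have hx' : bar (hallMul Z vZ (a • x) y) = hallMul Z vZ (bar (a • x)) (bar y) := hx
      rw [map_smul, LinearMap.smul_apply, hsmul, hsmul, map_smul, LinearMap.smul_apply] at hx'
      exact hall_smul_cancel (barZ_ne_zero ha) hx'
  · rw [uTilde_eq]
    exact uTil_semisimple_mem vZ qn_vZ_ne_zero {y | bar y = y} hone
      (fun i a y hy => ((hbar _).unique ((hbar y).divMul i a)).trans (by rw [hy])) d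

theorem isBarInvolution_barInvolution (k : Type u) [Field k] :
    IsBarInvolution k (barInvolution k) := by
  have h := exists_isBarInvolution k
  rw [barInvolution, dif_pos h]
  exact h.choose_spec

/-! ### The canonical basis -/

theorem negPart_add {a b : Z} (ha : a ∈ negPart) (hb : b ∈ negPart) : a + b ∈ negPart := by
  obtain ⟨P, rfl⟩ := ha
  obtain ⟨Q, rfl⟩ := hb
  exact ⟨P + Q, by rw [map_add, mul_add]⟩

theorem negPart_neg {a : Z} (ha : a ∈ negPart) : -a ∈ negPart := by
  obtain ⟨P, rfl⟩ := ha
  exact ⟨-P, by rw [map_neg, mul_neg]⟩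

theorem negPart_zero : (0 : Z) ∈ negPart := ⟨0, by simp⟩

/-- Every Laurent polynomial is the sum of a bar invariant one and of one in `v⁻¹ ℤ[v⁻¹]`. -/
theorem exists_sub_mem_negPart (a : Z) : ∃ s, barZ s = s ∧ a - s ∈ negPart := by
  induction a using LaurentPolynomial.induction_on' with
  | add a b ha hb =>
    obtain ⟨s, h1, h2⟩ := ha
    obtain ⟨t, h3, h4⟩ := hb
    exact ⟨s + t, by rw [map_add, h1, h3], by rw [add_sub_add_comm]; exact negPart_add h2 h4⟩
  | C_mul_T n c =>
    have hC : ∀ c : ℤ, barZ (LaurentPolynomial.C c) = LaurentPolynomial.C c :=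
      fun c => LaurentPolynomial.invert_C c
    have hT : ∀ n : ℤ, barZ (LaurentPolynomial.T n) = LaurentPolynomial.T (-n) :=
      fun n => LaurentPolynomial.invert_T n
    have hneg : ∀ (n : ℕ) (c : ℤ), LaurentPolynomial.C c * LaurentPolynomial.T (-((n : ℤ) + 1)) ∈
        negPart := fun n c => by
      refine ⟨Polynomial.C c * Polynomial.X ^ n, ?_⟩
      rw [map_mul, Polynomial.aeval_C, map_pow, Polynomial.aeval_X, LaurentPolynomial.T_pow,
        mul_left_comm, ← LaurentPolynomial.T_add]
      congr 2
      ring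
    rcases lt_trichotomy n 0 with h | h | h
    · refine ⟨0, map_zero _, ?_⟩
      obtain ⟨l, rfl⟩ : ∃ l : ℕ, n = -((l : ℤ) + 1) := ⟨(-n - 1).toNat, by omega⟩
      rw [sub_zero]
      exact hneg l c
    · subst h
      refine ⟨LaurentPolynomial.C c * LaurentPolynomial.T 0, ?_, ?_⟩
      · rw [map_mul, hC, hT, neg_zero]
      · rw [sub_self]; exact negPart_zero
    · obtain ⟨l, rfl⟩ : ∃ l : ℕ, n = (l : ℤ) + 1 := ⟨(n - 1).toNat, by omega⟩
      refine ⟨LaurentPolynomial.C c * LaurentPolynomial.T ((l : ℤ) + 1) +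
        LaurentPolynomial.C c * LaurentPolynomial.T (-((l : ℤ) + 1)), ?_, ?_⟩
      · rw [map_add, map_mul, map_mul, hC, hT, hT, neg_neg, add_comm]
      · rw [sub_add_cancel_left]
        exact negPart_neg (hneg l c)

/-- The span of the `ũ_p`, `p ≤ m`, with coefficients in `v⁻¹ ℤ[v⁻¹]`; the scalar `(tcoef vZ p)⁻¹`
converts coordinates with respect to `u_p` into those with respect to `ũ_p`. -/
def negSpan (m : Multisegment) : AddSubgroup (Hall Z) where
  carrier := {y | ∀ p, (y p ≠ 0 → RkLE p m) ∧ (((tcoef vZ p)⁻¹ : Zˣ) : Z) * y p ∈ negPart}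
  add_mem' := fun {x y} hx hy p => by
    refine ⟨fun h => ?_, ?_⟩
    · by_cases h1 : x p = 0
      · refine (hy p).1 fun h2 => h ?_
        rw [Finsupp.add_apply, h1, h2, add_zero]
      · exact (hx p).1 h1
    · rw [Finsupp.add_apply, mul_add]
      exact negPart_add (hx p).2 (hy p).2
  zero_mem' := fun p => ⟨fun h => absurd rfl h, by
    rw [Finsupp.zero_apply, mul_zero]; exact negPart_zero⟩
  neg_mem' := fun {x} hx p => ⟨fun h => (hx p).1 fun h1 => h (by rw [Finsupp.neg_apply, h1, neg_zero]),
    by rw [Finsupp.neg_apply, mul_neg]; exact negPart_neg (hx p).2⟩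

theorem negSpan_mono {p m : Multisegment} (h : RkLE p m) : negSpan p ≤ negSpan m :=
  fun _ hy q => ⟨fun hq => ((hy q).1 hq).trans h, (hy q).2⟩

theorem smul_uTil_mem_negSpan {a : Z} (ha : a ∈ negPart) (m : Multisegment) :
    a • uTil vZ m ∈ negSpan m := by
  intro p
  by_cases h : p = m
  · subst h
    refine ⟨fun _ => RkLE.refl p, ?_⟩
    have h1 : (((tcoef vZ p)⁻¹ : Zˣ) : Z) * (a • uTil vZ p) p = a := by
      rw [uTil, uBasis, Finsupp.smul_apply, Finsupp.smul_apply, Finsupp.single_eq_same, smul_eq_mul,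
        smul_eq_mul, mul_one, mul_left_comm, Units.inv_mul, mul_one]
    rw [h1]
    exact ha
  · have h1 : (a • uTil vZ m) p = 0 := by
      rw [uTil, uBasis, Finsupp.smul_apply, Finsupp.smul_apply, Finsupp.single_eq_of_ne h,
        smul_zero, smul_zero]
    exact ⟨fun hc => absurd h1 hc, by rw [h1, mul_zero]; exact negPart_zero⟩

theorem eq_sum_smul_uTil (y : Hall Z) :
    y = ∑ p ∈ y.support, ((((tcoef vZ p)⁻¹ : Zˣ) : Z) * y p) • uTil vZ p := by
  conv_lhs => rw [eq_sum_smul_uBasis y]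
  refine Finset.sum_congr rfl fun p _ => ?_
  rw [uTil, smul_smul, mul_right_comm, Units.inv_mul, one_mul]

section Canonical

variable {k : Type u} [Field k] {bar : Hall Z →+ Hall Z}

/-- A bar invariant element with leading term `ũ_m`: a monomial in the divided powers. -/
theorem IsBarInvolution.exists_monomial (hbar : IsBarInvolution k bar) (m : Multisegment) :
    ∃ y, bar y = y ∧ y - uTil vZ m ∈ lowerSpan Z m := by
  refine exists_mem_sub_mem_lowerSpan vZ qn_vZ_ne_zero {y | bar y = y} ?_ (fun i a y hy => ?_) m
  · have := hbar.map_semisimple 0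
    rwa [show semisimple 0 = 0 from Finsupp.sum_zero_index, uTilde_eq, uTil_zero] at this
  · have := hbar.map_semisimple (Finsupp.single i a)
    rw [semisimple_single, uTilde_eq] at this
    have hy' : bar y = y := hy
    change bar (hallMul Z vZ _ y) = hallMul Z vZ _ y
    rw [hbar.map_mul, this, hy']

theorem negSpan_le_lowerSpan {p m : Multisegment} (h : RkLE p m) (hne : p ≠ m) :
    negSpan p ≤ (lowerSpan Z m).toAddSubgroup := fun y hy => by
  rw [Submodule.mem_toAddSubgroup, mem_lowerSpan]
  intro q hq
  have h1 := (hy q).1 hq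
  refine ⟨h1.trans h, ?_⟩
  rintro rfl
  exact hne (h.antisymm h1)

/-- Lower terms are approximated by bar invariant elements, if this holds for the multiples of each
`ũ_p`. -/
theorem exists_approx_lower {m : Multisegment}
    (h : ∀ p, RkLE p m → p ≠ m → ∀ a : Z, ∃ z, bar z = z ∧ a • uTil vZ p - z ∈ negSpan p)
    {y : Hall Z} (hy : y ∈ lowerSpan Z m) :
    ∃ z, bar z = z ∧ y - z ∈ negSpan m ∧ y - z ∈ lowerSpan Z m := by
  have hlt : ∀ p ∈ y.support, RkLE p m ∧ p ≠ m := fun p hp =>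
    mem_lowerSpan.mp hy p (Finsupp.mem_support_iff.mp hp)
  have h1 : ∀ p ∈ y.support, ∃ z, bar z = z ∧
      ((((tcoef vZ p)⁻¹ : Zˣ) : Z) * y p) • uTil vZ p - z ∈ negSpan p := fun p hp =>
    h p (hlt p hp).1 (hlt p hp).2 _
  choose! z hz using h1
  have h2 : y - ∑ p ∈ y.support, z p =
      ∑ p ∈ y.support, (((((tcoef vZ p)⁻¹ : Zˣ) : Z) * y p) • uTil vZ p - z p) := by
    rw [Finset.sum_sub_distrib, ← eq_sum_smul_uTil]
  refine ⟨∑ p ∈ y.support, z p, ?_, ?_, ?_⟩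
  · rw [map_sum]
    exact Finset.sum_congr rfl fun p hp => (hz p hp).1
  · rw [h2]
    exact AddSubgroup.sum_mem _ fun p hp => negSpan_mono (hlt p hp).1 (hz p hp).2
  · rw [h2]
    exact Submodule.sum_mem _ fun p hp =>
      negSpan_le_lowerSpan (hlt p hp).1 (hlt p hp).2 (hz p hp).2

/-- Multiples of `ũ_m` are approximated by bar invariant elements. -/
theorem IsBarInvolution.exists_approx (hbar : IsBarInvolution k bar) (m : Multisegment) :
    ∀ a : Z, ∃ z, bar z = z ∧ a • uTil vZ m - z ∈ negSpan m := by
  induction m using multisegment_induction with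
  | h0 =>
    intro a
    obtain ⟨s, hs, hn⟩ := exists_sub_mem_negPart a
    obtain ⟨y, hy, hy0⟩ := hbar.exists_monomial 0
    have h1 : y = uTil vZ 0 := mem_of_sub_mem_lowerSpan (fun _ _ _ => by simp [rk]) hy0
    refine ⟨s • y, by rw [hbar.map_smul, hy, hs], ?_⟩
    rw [h1, ← sub_smul]
    exact smul_uTil_mem_negSpan hn 0
  | h1 m i _ _ _ ih =>
    intro a
    obtain ⟨s, hs, hn⟩ := exists_sub_mem_negPart a
    obtain ⟨y, hy, hym⟩ := hbar.exists_monomial m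
    obtain ⟨z, hz, hz1, -⟩ := exists_approx_lower ih (Submodule.smul_mem _ s hym)
    refine ⟨s • y - z, by rw [map_sub, hbar.map_smul, hy, hs, hz], ?_⟩
    have h1 : a • uTil vZ m - (s • y - z) =
        (a - s) • uTil vZ m - (s • (y - uTil vZ m) - z) := by module
    rw [h1]
    exact sub_mem (smul_uTil_mem_negSpan hn m) hz1

/-- The canonical basis element is a bar invariant monomial, corrected in lower terms. -/
theorem IsBarInvolution.exists_canonical (hbar : IsBarInvolution k bar) (m : Multisegment) :
    ∃ b, bar b = b ∧ ∃ c : Multisegment →₀ Z, (∀ p ∈ c.support, DegLT k p m ∧ c p ∈ negPart) ∧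
      b = uTilde k m + c.sum fun p a => a • uTilde k p := by
  obtain ⟨y, hy, hym⟩ := hbar.exists_monomial m
  obtain ⟨z, hz, hz1, hz2⟩ := exists_approx_lower (fun p _ _ => hbar.exists_approx p) hym
  set x := y - uTil vZ m - z with hx
  have hcoef : ∀ p, (((tcoef vZ p)⁻¹ : Zˣ) : Z) * x p ≠ 0 → x p ≠ 0 := fun p h =>
    right_ne_zero_of_mul h
  refine ⟨y - z, by rw [map_sub, hy, hz], Finsupp.onFinset x.support
    (fun p => (((tcoef vZ p)⁻¹ : Zˣ) : Z) * x p)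
    (fun p hp => Finsupp.mem_support_iff.mpr (hcoef p hp)), fun p hp => ?_, ?_⟩
  · have h1 := mem_lowerSpan.mp hz2 p (hcoef p (Finsupp.mem_support_iff.mp hp))
    exact ⟨⟨(degLE_iff_rkLE k).mpr h1.1, h1.2⟩, (hz1 p).2⟩
  · have h1 := eq_sum_smul_uTil x
    rw [Finsupp.onFinset_sum _ (fun p => by rw [zero_smul])]
    simp only [uTilde_eq]
    rw [← h1, hx]
    abel

end Canonical

theorem isCanonical_canonicalBasis (k : Type u) [Field k] (m : Multisegment) :
    IsCanonical k m (canonicalBasis k m) := by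
  have h : ∃ b, IsCanonical k m b := (isBarInvolution_barInvolution k).exists_canonical m
  rw [canonicalBasis, dif_pos h]
  exact h.choose_spec

/-! ### Beads and semi-infinite wedges -/

/-- The positions `λ_r - r` of the beads of a partition. -/
def bead (lam : YoungDiagram) (r : ℕ) : ℤ := (lam.rowLen r : ℤ) - r

theorem bead_strictAnti (lam : YoungDiagram) : StrictAnti (bead lam) := by
  intro r s h
  have := lam.rowLen_anti r s h.le
  unfold bead
  omega

theorem rowLen_eq_zero {lam : YoungDiagram} {r : ℕ} (h : lam.colLen 0 ≤ r) : lam.rowLen r = 0 := by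
  by_contra hc
  have h1 : (r, 0) ∈ lam := YoungDiagram.mem_iff_lt_rowLen.mpr (Nat.pos_of_ne_zero hc)
  have h2 := YoungDiagram.mem_iff_lt_colLen.mp h1
  omega

theorem rowLen_pos {lam : YoungDiagram} {r : ℕ} (h : r < lam.colLen 0) : 0 < lam.rowLen r :=
  YoungDiagram.mem_iff_lt_rowLen.mp (YoungDiagram.mem_iff_lt_colLen.mpr h)

theorem bead_of_le {lam : YoungDiagram} {r : ℕ} (h : lam.colLen 0 ≤ r) : bead lam r = -(r : ℤ) := by
  rw [bead, rowLen_eq_zero h]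
  simp

theorem bead_bot (r : ℕ) : bead ⊥ r = -(r : ℤ) := by
  have : (⊥ : YoungDiagram).rowLen r = 0 := by
    by_contra hc
    have h1 : (r, 0) ∈ (⊥ : YoungDiagram) :=
      YoungDiagram.mem_iff_lt_rowLen.mpr (Nat.pos_of_ne_zero hc)
    exact YoungDiagram.notMem_bot _ h1
  rw [bead, this]
  simp

theorem eq_of_bead_eq {lam mu : YoungDiagram} (h : bead lam = bead mu) : lam = mu := by
  have h1 : ∀ r, lam.rowLen r = mu.rowLen r := fun r => by
    have := congrFun h r
    unfold bead at this
    omega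
  refine SetLike.ext fun c => ?_
  obtain ⟨r, s⟩ := c
  rw [YoungDiagram.mem_iff_lt_rowLen, YoungDiagram.mem_iff_lt_rowLen, h1]

theorem eq_of_range_bead_eq {lam mu : YoungDiagram}
    (h : Set.range (bead lam) = Set.range (bead mu)) : lam = mu := by
  refine eq_of_bead_eq ?_
  have h1 : StrictMono (OrderDual.toDual ∘ bead lam) := fun a b hab => bead_strictAnti lam hab
  have h2 : StrictMono (OrderDual.toDual ∘ bead mu) := fun a b hab => bead_strictAnti mu hab
  have h3 := (StrictMono.range_inj h1 h2).mp (by rw [Set.range_comp, Set.range_comp, h])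
  exact h3

/-- The inversions of a sequence, relative to the decreasing order. -/
def inversions (f : ℕ → ℤ) : Set (ℕ × ℕ) := {p | p.1 < p.2 ∧ f p.1 < f p.2}

/-- The sequence agrees with the vacuum `0, -1, -2, …` from some point on. -/
def EventuallyVacuum (f : ℕ → ℤ) : Prop := ∃ N : ℕ, ∀ r, N ≤ r → f r = -(r : ℤ)

theorem eventuallyVacuum_bead (lam : YoungDiagram) : EventuallyVacuum (bead lam) :=
  ⟨lam.colLen 0, fun _ h => bead_of_le h⟩

theorem finite_inversions {f : ℕ → ℤ} (h : EventuallyVacuum f) : (inversions f).Finite := by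
  obtain ⟨N, hN⟩ := h
  obtain ⟨B, hB⟩ : ∃ B : ℕ, ∀ r, r < N → -(B : ℤ) ≤ f r := by
    refine ⟨(Finset.range N).sup fun r => (f r).natAbs, fun r hr => ?_⟩
    have : (f r).natAbs ≤ (Finset.range N).sup fun r => (f r).natAbs :=
      Finset.le_sup (f := fun r => (f r).natAbs) (Finset.mem_range.mpr hr)
    omega
  refine ((Set.finite_Iio (N + B + 1)).prod (Set.finite_Iio (N + B + 1))).subset ?_
  rintro ⟨r, s⟩ ⟨h1, h2⟩
  simp only at h1 h2
  simp only [Set.mem_prod, Set.mem_Iio]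
  by_cases hs : s < N
  · omega
  · rw [hN s (by omega)] at h2
    by_cases hr : r < N
    · have := hB r hr
      omega
    · rw [hN r (by omega)] at h2
      omega

/-- The sign of a sequence of pairwise different integers. -/
def seqSign (f : ℕ → ℤ) : ℤ := (-1) ^ (inversions f).ncard

theorem seqSign_bead (lam : YoungDiagram) : seqSign (bead lam) = 1 := by
  have : inversions (bead lam) = ∅ := by
    rw [Set.eq_empty_iff_forall_notMem]
    rintro ⟨r, s⟩ ⟨h1, h2⟩
    exact absurd (bead_strictAnti lam h1) h2.not_gt
  rw [seqSign, this, Set.ncard_empty, pow_zero]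

theorem eventuallyVacuum_swap {f : ℕ → ℤ} (h : EventuallyVacuum f) (r : ℕ) :
    EventuallyVacuum (f ∘ Equiv.swap r (r + 1)) := by
  obtain ⟨N, hN⟩ := h
  refine ⟨N + r + 2, fun s hs => ?_⟩
  rw [Function.comp_apply, Equiv.swap_apply_of_ne_of_ne (by omega) (by omega), hN s (by omega)]

theorem seqSign_swap {f : ℕ → ℤ} (hf : EventuallyVacuum f) (hinj : Function.Injective f) (r : ℕ) :
    seqSign (f ∘ Equiv.swap r (r + 1)) = -seqSign f := by
  wlog hlt : f (r + 1) < f r generalizing f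
  · have hne : f r ≠ f (r + 1) := fun h => by have := hinj h; omega
    have h1 := this (f := f ∘ Equiv.swap r (r + 1)) (eventuallyVacuum_swap hf r)
      (hinj.comp (Equiv.injective _)) (by simp; omega)
    have h2 : (f ∘ Equiv.swap r (r + 1)) ∘ Equiv.swap r (r + 1) = f := by
      ext s
      simp
    rw [h2] at h1
    rw [h1, neg_neg]
  set g := f ∘ Equiv.swap r (r + 1) with hg
  have hgr : g r = f (r + 1) := by simp [hg]
  have hgr1 : g (r + 1) = f r := by simp [hg]
  have hgs : ∀ s, s ≠ r → s ≠ r + 1 → g s = f s := fun s h1 h2 => by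
    rw [hg, Function.comp_apply, Equiv.swap_apply_of_ne_of_ne h1 h2]
  -- the inversions of `g` are those of `f`, transported by the transposition, and `(r, r + 1)`
  let φ : ℕ × ℕ → ℕ × ℕ := Prod.map (Equiv.swap r (r + 1)) (Equiv.swap r (r + 1))
  have hφ : Function.Injective φ := (Equiv.injective _).prodMap (Equiv.injective _)
  have hswap : ∀ a b : ℕ, a < b → (a, b) ≠ (r, r + 1) →
      Equiv.swap r (r + 1) a < Equiv.swap r (r + 1) b := by
    intro a b hab hne
    have hne' : ¬ (a = r ∧ b = r + 1) := fun h => hne (by rw [h.1, h.2])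
    simp only [Equiv.swap_apply_def]
    split_ifs <;> omega
  have hset : inversions g = insert (r, r + 1) (φ '' inversions f) := by
    ext ⟨a, b⟩
    constructor
    · rintro ⟨h1, h2⟩
      simp only at h1 h2
      by_cases hab : (a, b) = (r, r + 1)
      · exact Or.inl hab
      · refine Or.inr ⟨(Equiv.swap r (r + 1) a, Equiv.swap r (r + 1) b), ⟨hswap a b h1 hab, h2⟩, ?_⟩
        simp [φ]
    · rintro (h | ⟨⟨c, d⟩, ⟨h1, h2⟩, h3⟩)
      · rw [h]
        exact ⟨Nat.lt_succ_self r, by rw [hgr, hgr1]; exact hlt⟩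
      · simp only at h1 h2
        have hcd : (c, d) ≠ (r, r + 1) := fun h => by
          rw [Prod.mk.injEq] at h
          rw [h.1, h.2] at h2
          omega
        obtain ⟨rfl, rfl⟩ := Prod.mk.inj h3
        exact ⟨hswap c d h1 hcd, by simpa [hg] using h2⟩
  have hnot : (r, r + 1) ∉ φ '' inversions f := by
    rintro ⟨⟨c, d⟩, ⟨h1, h2⟩, h3⟩
    simp only at h1
    have h4 : Equiv.swap r (r + 1) c = r := congrArg Prod.fst h3
    have h5 : Equiv.swap r (r + 1) d = r + 1 := congrArg Prod.snd h3
    rw [Equiv.swap_apply_eq_iff, Equiv.swap_apply_left] at h4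
    rw [Equiv.swap_apply_eq_iff, Equiv.swap_apply_right] at h5
    omega
  rw [seqSign, seqSign, hset, Set.ncard_insert_of_notMem hnot ((finite_inversions hf).image _),
    Set.ncard_image_of_injective _ hφ, pow_succ]
  ring

open Classical in
/-- The semi-infinite wedge `f 0 ∧ f 1 ∧ ⋯` as an element of the Fock space. -/
def wedge (f : ℕ → ℤ) : Fock :=
  if h : Function.Injective f ∧ ∃ lam, Set.range f = Set.range (bead lam) then
    seqSign f • ket h.2.choose else 0

theorem wedge_of_range {f : ℕ → ℤ} (hf : Function.Injective f) {lam : YoungDiagram}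
    (h : Set.range f = Set.range (bead lam)) : wedge f = seqSign f • ket lam := by
  have h1 : Function.Injective f ∧ ∃ lam, Set.range f = Set.range (bead lam) := ⟨hf, lam, h⟩
  rw [wedge, dif_pos h1, eq_of_range_bead_eq (h1.2.choose_spec.symm.trans h)]

theorem wedge_bead (lam : YoungDiagram) : wedge (bead lam) = ket lam := by
  rw [wedge_of_range (bead_strictAnti lam).injective rfl, seqSign_bead, one_smul]

theorem wedge_eq_zero {f : ℕ → ℤ} {r s : ℕ} (hrs : r ≠ s) (h : f r = f s) : wedge f = 0 := by
  rw [wedge, dif_neg fun hc => hrs (hc.1 h)]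

theorem wedge_swap {f : ℕ → ℤ} (hf : EventuallyVacuum f) (r : ℕ) :
    wedge (f ∘ Equiv.swap r (r + 1)) = -wedge f := by
  by_cases h : Function.Injective f ∧ ∃ lam, Set.range f = Set.range (bead lam)
  · obtain ⟨h1, lam, h2⟩ := h
    rw [wedge_of_range h1 h2, wedge_of_range (h1.comp (Equiv.injective _)) (lam := lam)
      (by rw [EquivLike.range_comp, h2]), seqSign_swap hf h1, neg_smul]
  · rw [wedge, wedge, dif_neg h, dif_neg, neg_zero]
    rintro ⟨h1, lam, h2⟩
    refine h ⟨?_, lam, by rwa [EquivLike.range_comp] at h2⟩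
    exact (Equiv.injective_comp _ f).mp h1

/-! ### Adding a box -/

theorem AddsBox.bead_eq {i : ℤ} {lam mu : YoungDiagram} (h : AddsBox i lam mu) :
    ∃ r, bead lam r = i ∧ bead mu = Function.update (bead lam) r (i + 1) := by
  obtain ⟨hle, ⟨r, s⟩, hc, hi⟩ := h
  have hmem : ∀ x, x ∈ mu ↔ x ∈ lam ∨ x = (r, s) := by
    intro x
    have h1 := Finset.ext_iff.mp hc x
    rw [Finset.mem_sdiff, Finset.mem_singleton, YoungDiagram.mem_cells,
      YoungDiagram.mem_cells] at h1
    have h2 : x ∈ lam → x ∈ mu := fun h => hle h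
    tauto
  have hnot : (r, s) ∉ lam := by
    have h1 := Finset.ext_iff.mp hc (r, s)
    rw [Finset.mem_sdiff, Finset.mem_singleton, YoungDiagram.mem_cells,
      YoungDiagram.mem_cells] at h1
    tauto
  have hr : lam.rowLen r = s := by
    refine le_antisymm (not_lt.mp fun h => hnot (YoungDiagram.mem_iff_lt_rowLen.mpr h)) ?_
    by_contra hlt
    push Not at hlt
    have h1 : (r, lam.rowLen r) ∈ mu := mu.up_left_mem le_rfl hlt.le ((hmem _).mpr (Or.inr rfl))
    rcases (hmem _).mp h1 with h2 | h2
    · exact lt_irrefl _ (YoungDiagram.mem_iff_lt_rowLen.mp h2)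
    · rw [Prod.mk.injEq] at h2
      omega
  have hrow : ∀ r' l, l < mu.rowLen r' ↔ l < lam.rowLen r' ∨ (r' = r ∧ l = s) := fun r' l => by
    rw [← YoungDiagram.mem_iff_lt_rowLen, ← YoungDiagram.mem_iff_lt_rowLen, hmem, Prod.mk.injEq]
  refine ⟨r, by rw [bead, hr]; exact hi, ?_⟩
  funext r'
  by_cases h1 : r' = r
  · subst h1
    rw [Function.update_self, bead]
    have h2 := hrow r' s
    have h3 := hrow r' (s + 1)
    simp only at hi
    omega
  · rw [Function.update_of_ne h1, bead, bead]
    have h2 := hrow r' (lam.rowLen r')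
    have h3 := hrow r' (mu.rowLen r')
    omega

theorem exists_addsBox {lam : YoungDiagram} {r : ℕ} (h : bead lam r + 1 ∉ Set.range (bead lam)) :
    ∃ mu, AddsBox (bead lam r) lam mu := by
  have hprev : ∀ r', r' < r → lam.rowLen r < lam.rowLen r' := by
    intro r' hr'
    obtain ⟨q, rfl⟩ : ∃ q, r = q + 1 := ⟨r - 1, by omega⟩
    have h1 : lam.rowLen (q + 1) < lam.rowLen q := by
      have h2 := lam.rowLen_anti q (q + 1) (by omega)
      rcases h2.lt_or_eq with h3 | h3
      · exact h3
      · exact absurd ⟨q, by unfold bead; rw [h3]; push_cast; ring⟩ h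
    exact h1.trans_le (lam.rowLen_anti r' q (by omega))
  have hnot : (r, lam.rowLen r) ∉ lam := fun hc =>
    lt_irrefl _ (YoungDiagram.mem_iff_lt_rowLen.mp hc)
  refine ⟨⟨insert (r, lam.rowLen r) lam.cells, ?_⟩, ?_, (r, lam.rowLen r), ?_, rfl⟩
  · rintro ⟨a, b⟩ ⟨c, d⟩ hle hab
    obtain ⟨h1, h2⟩ := Prod.mk_le_mk.mp hle
    rw [Finset.coe_insert, Set.mem_insert_iff, Finset.mem_coe, YoungDiagram.mem_cells] at hab ⊢
    rcases hab with hab | hab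
    · rw [Prod.mk.injEq] at hab
      obtain ⟨rfl, rfl⟩ := hab
      rw [YoungDiagram.mem_iff_lt_rowLen, Prod.mk.injEq]
      rcases h1.lt_or_eq with h3 | h3
      · exact Or.inr (h2.trans_lt (hprev c h3))
      · subst h3
        omega
    · exact Or.inr (lam.up_left_mem h1 h2 hab)
  · intro x hx
    exact Finset.mem_insert_of_mem hx
  · change insert (r, lam.rowLen r) lam.cells \ lam.cells = _
    rw [Finset.insert_sdiff_of_notMem _ (by rwa [YoungDiagram.mem_cells]), Finset.sdiff_self]
    rfl

theorem fockF_ket (i : ℤ) (lam : YoungDiagram) :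
    open Classical in fockF i (ket lam) = if h : ∃ mu, AddsBox i lam mu then ket h.choose else 0 := by
  rw [fockF, ket, Finsupp.linearCombination_single, one_smul]

theorem fockF_ket_of_hop {lam : YoungDiagram} {r : ℕ}
    (h : bead lam r + 1 ∉ Set.range (bead lam)) :
    ∃ mu, fockF (bead lam r) (ket lam) = ket mu ∧
      bead mu = Function.update (bead lam) r (bead lam r + 1) := by
  have h1 := exists_addsBox h
  obtain ⟨r', h2, h3⟩ := h1.choose_spec.bead_eq
  rw [(bead_strictAnti lam).injective h2] at h3
  exact ⟨h1.choose, by rw [fockF_ket, dif_pos h1], h3⟩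

theorem fockF_ket_eq_zero {i : ℤ} {lam : YoungDiagram}
    (h : i ∉ Set.range (bead lam) ∨ i + 1 ∈ Set.range (bead lam)) : fockF i (ket lam) = 0 := by
  rw [fockF_ket, dif_neg]
  rintro ⟨mu, hmu⟩
  obtain ⟨r, h1, h2⟩ := hmu.bead_eq
  rcases h with h | ⟨s, hs⟩
  · exact h ⟨r, h1⟩
  · have hsr : s ≠ r := by
      rintro rfl
      omega
    refine hsr ((bead_strictAnti mu).injective ?_)
    rw [h2, Function.update_of_ne hsr, Function.update_self, hs]

/-! ### The action of the Hall algebra on the Fock space -/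

/-- The total length of the segments starting at `a`. -/
def segLen (m : Multisegment) (a : ℤ) : ℕ := wt (fun q => if q.1 = a then (q.2 : ℕ) else 0) m

theorem segLen_add (m m' : Multisegment) (a : ℤ) : segLen (m + m') a = segLen m a + segLen m' a :=
  wt_add _ _ _

theorem segLen_segN (i : ℤ) (n : ℕ) (a : ℤ) : segLen (segN i n) a = if i = a then n else 0 :=
  wt_segN _ i n (fun i n => if i = a then n else 0) (fun _ _ => rfl) (by simp)

theorem segLen_eq_zero {m : Multisegment} {a : ℤ} (h : cg m a 0 = 0) : segLen m a = 0 := by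
  unfold cg at h
  unfold segLen
  rw [wt_eq_zero_iff] at h ⊢
  intro p hp
  have := h p hp
  simp only [p.2.pos, and_true] at this
  split_ifs at this ⊢
  · rfl

theorem exists_eq_add_segN {m : Multisegment} {a : ℤ} {c : ℕ} (h : cg m a 0 = c + 1) :
    ∃ m' n, m = m' + segN a (n + 1) ∧ cg m' a 0 = c := by
  obtain ⟨n, hn⟩ := exists_mu_ne_zero (p := m) (i := a) (n := 0) (by omega)
  obtain ⟨m', rfl⟩ := exists_add_of_le hn
  rw [cg_add, cg_segN] at h
  simp at h
  exact ⟨m', n, add_comm _ _, by omega⟩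

theorem exists_eq_add_segN_of_le_one {m : Multisegment} {a : ℤ} (h : cg m a 0 ≤ 1) :
    ∃ m' n, m = m' + segN a n ∧ cg m' a 0 = 0 := by
  rcases Nat.le_one_iff_eq_zero_or_eq_one.mp h with h | h
  · exact ⟨m, 0, by simp, h⟩
  · obtain ⟨m', n, h1, h2⟩ := exists_eq_add_segN h
    exact ⟨m', n + 1, h1, h2⟩

theorem exists_eq_add_segN_of_le_two {m : Multisegment} {a : ℤ} (h : cg m a 0 ≤ 2) :
    ∃ m' p q, m = m' + segN a p + segN a q ∧ cg m' a 0 = 0 := by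
  by_cases h1 : cg m a 0 ≤ 1
  · obtain ⟨m', n, h2, h3⟩ := exists_eq_add_segN_of_le_one h1
    exact ⟨m', n, 0, by simpa using h2, h3⟩
  · obtain ⟨m', n, h2, h3⟩ := exists_eq_add_segN (c := 1) (show cg m a 0 = 1 + 1 by omega)
    obtain ⟨m'', n', h4, h5⟩ := exists_eq_add_segN_of_le_one h3.le
    exact ⟨m'', n', n + 1, by rw [h2, h4], h5⟩

/-- The sequence obtained from `f` by moving each term `f r` along the segment starting there. -/
def move (m : Multisegment) (f : ℕ → ℤ) (r : ℕ) : ℤ := f r + segLen m (f r)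

/-- The segments of `m` start at pairwise different elements of `A`. -/
def Movable (m : Multisegment) (A : Set ℤ) : Prop :=
  ∀ a, cg m a 0 ≤ 1 ∧ (cg m a 0 ≠ 0 → a ∈ A)

open Classical in
/-- The number of elements outside of `A` strictly between the ends of the hops along the segments
of `m`. -/
def holes (A : Set ℤ) (m : Multisegment) : ℕ :=
  wt (fun q => ((Finset.Ioo q.1 (q.1 + (q.2 : ℕ))).filter fun x => x ∉ A).card) m

theorem holes_add (A : Set ℤ) (m m' : Multisegment) :
    holes A (m + m') = holes A m + holes A m' := wt_add _ _ _

open Classical in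
theorem holes_segN (A : Set ℤ) (i : ℤ) (n : ℕ) :
    holes A (segN i n) = ((Finset.Ioo i (i + n)).filter fun x => x ∉ A).card :=
  wt_segN _ i n (fun i n => ((Finset.Ioo i (i + n)).filter fun x => x ∉ A).card)
    (fun _ _ => rfl) (by simp)

open Classical in
/-- The action of `u_m⁻` on `|λ⟩`: each segment of `m` moves the bead at its start along its whole
length, and every vacant position which a bead jumps over contributes a factor `v`. Occupied
positions contribute a sign, which is part of `wedge`. The result is zero unless every segment finds
a bead of its own. -/
def segAct (m : Multisegment) (lam : YoungDiagram) : Fock :=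
  if Movable m (Set.range (bead lam)) then
    ((vK : K) ^ holes (Set.range (bead lam)) m) • wedge (move m (bead lam)) else 0

/-- The action of the Hall algebra on the Fock space, as a linear map. It reverses products. -/
def fockRep : Hall K →ₗ[K] Module.End K Fock :=
  Finsupp.linearCombination K fun m => Finsupp.linearCombination K (segAct m)

theorem fockRep_apply (m : Multisegment) (lam : YoungDiagram) :
    fockRep (uBasis K m) (ket lam) = segAct m lam := by
  rw [fockRep, uBasis, ket, Finsupp.linearCombination_single, one_smul,
    Finsupp.linearCombination_single, one_smul]

theorem segAct_eq_zero {m : Multisegment} {lam : YoungDiagram} {a : ℤ}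
    (h : 2 ≤ cg m a 0 ∨ (cg m a 0 ≠ 0 ∧ a ∉ Set.range (bead lam))) : segAct m lam = 0 := by
  rw [segAct, if_neg]
  intro hc
  have := hc a
  rcases h with h | h
  · omega
  · exact h.2 (this.2 h.1)

theorem cg_ext_self {m : Multisegment} {i : ℤ} {n : ℕ} (h : segN (i + 1) n ≤ m) :
    cg (ext m i n) i 0 = cg m i 0 + 1 := by
  have := cg_ext h i 0
  simpa using this

theorem cg_ext_succ {m : Multisegment} {i : ℤ} {n : ℕ} (h : segN (i + 1) n ≤ m) :
    cg (ext m i n) (i + 1) 0 + (if 0 < n then 1 else 0) = cg m (i + 1) 0 := by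
  have := cg_ext h (i + 1) 0
  simpa using this

theorem eventuallyVacuum_move {f : ℕ → ℤ} (h : EventuallyVacuum f) (m : Multisegment) :
    EventuallyVacuum (move m f) := by
  obtain ⟨N, hN⟩ := h
  obtain ⟨B, hB⟩ : ∃ B : ℕ, ∀ a, segLen m a ≠ 0 → -(B : ℤ) ≤ a := by
    refine ⟨m.support.sup fun q => q.1.natAbs, fun a ha => ?_⟩
    by_contra hc
    refine ha ((wt_eq_zero_iff _ _).mpr fun q hq => if_neg ?_)
    rintro rfl
    have : q.1.natAbs ≤ m.support.sup fun q => q.1.natAbs :=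
      Finset.le_sup (f := fun q : ℤ × ℕ+ => q.1.natAbs) (Finsupp.mem_support_iff.mpr hq)
    omega
  refine ⟨N + B + 1, fun r hr => ?_⟩
  rw [move, hN r (by omega)]
  have : segLen m (-(r : ℤ)) = 0 := by
    by_contra hc
    have := hB _ hc
    omega
  rw [this]
  simp

theorem eq_or_eq_of_segN_le {c : Multisegment} {a : ℤ} (hc : cg c a 0 = 0) {p q n : ℕ}
    (hn : n ≠ 0) (h : segN a n ≤ c + segN a p + segN a q) : n = p ∨ n = q := by
  obtain ⟨k, rfl⟩ : ∃ k, n = k + 1 := ⟨n - 1, by omega⟩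
  rw [segN_le_iff, mu_add, mu_add, mu_segN, mu_segN] at h
  have h1 := cg_succ c a k
  have h2 := cg_antitone c a (Nat.zero_le k)
  by_contra hcon
  push Not at hcon
  rw [if_neg fun h => hcon.1 h.2.symm, if_neg fun h => hcon.2 h.2.symm] at h
  omega

/-- A bead at `i` and a bead at `i + 1`: the terms of `u_i u_m` cancel. A nonzero term
moves these beads to some `i + 1 + p` and `i + 1 + q`, and there is a second term which moves them to
the same positions in the opposite order. -/
theorem sum_segAct_of_mem {m : Multisegment} {lam : YoungDiagram} {i : ℤ} {r r' : ℕ}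
    (hr : bead lam r = i) (hr' : bead lam r' = i + 1) (hi : cg m i 0 = 0) (N : ℕ)
    (hN : totalDim m < N) :
    open Classical in
    ∑ n ∈ Finset.range N, (if segN (i + 1) n ≤ m then segAct (ext m i n) lam else 0) = 0 := by
  classical
  have hanti := bead_strictAnti lam
  have hrr' : r = r' + 1 := by
    have h1 : r' < r := by
      by_contra hc
      have := hanti.antitone (not_lt.mp hc)
      omega
    by_contra hc
    have h2 : r' + 1 < r := by omega
    have h3 := hanti h2
    have h4 := hanti (show r' < r' + 1 by omega)
    omega
  subst hrr'
  by_cases h2 : cg m (i + 1) 0 ≤ 2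
  swap
  · refine Finset.sum_eq_zero fun n _ => ?_
    split_ifs with h
    · have := cg_ext_succ h
      refine segAct_eq_zero (a := i + 1) (Or.inl ?_)
      split_ifs at this <;> omega
    · rfl
  obtain ⟨c, p, q, rfl, hc⟩ := exists_eq_add_segN_of_le_two h2
  have hci : cg c i 0 = 0 := by
    rw [cg_add, cg_add] at hi
    omega
  have hp : segN (i + 1) p ≤ c + segN (i + 1) p + segN (i + 1) q :=
    le_add_self.trans le_self_add
  have hq : segN (i + 1) q ≤ c + segN (i + 1) p + segN (i + 1) q := le_add_self
  have hpN : p ∈ Finset.range N := by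
    have := wt_mono (fun p => (p.2 : ℕ)) hp
    change totalDim _ ≤ totalDim _ at this
    rw [totalDim_segN] at this
    exact Finset.mem_range.mpr (by omega)
  have hqN : q ∈ Finset.range N := by
    have := wt_mono (fun p => (p.2 : ℕ)) hq
    change totalDim _ ≤ totalDim _ at this
    rw [totalDim_segN] at this
    exact Finset.mem_range.mpr (by omega)
  have hep : ext (c + segN (i + 1) p + segN (i + 1) q) i p = c + segN i (p + 1) + segN (i + 1) q := by
    rw [add_right_comm, ext_add_segN, add_right_comm]
  have heq : ext (c + segN (i + 1) p + segN (i + 1) q) i q = c + segN i (q + 1) + segN (i + 1) p := by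
    rw [ext_add_segN, add_right_comm]
  have hzero : ∀ n ∈ Finset.range N, n ≠ p → n ≠ q →
      (if segN (i + 1) n ≤ c + segN (i + 1) p + segN (i + 1) q then
        segAct (ext (c + segN (i + 1) p + segN (i + 1) q) i n) lam else 0) = 0 := by
    intro n _ h3 h4
    split_ifs with h
    · by_cases h0 : n = 0
      · have := cg_ext_succ h
        rw [cg_add, cg_add, cg_segN, cg_segN] at this
        subst h0
        simp [show 0 < p by omega, show 0 < q by omega] at this
        exact segAct_eq_zero (a := i + 1) (Or.inl (by omega))
      · rcases eq_or_eq_of_segN_le hc h0 h with h5 | h5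
        · exact absurd h5 h3
        · exact absurd h5 h4
    · rfl
  have hmove : ∀ p q s, move (c + segN i (p + 1) + segN (i + 1) q) (bead lam) s =
      if s = r' + 1 then i + 1 + p else if s = r' then i + 1 + q else
        bead lam s + segLen c (bead lam s) := by
    intro p q s
    rw [move, segLen_add, segLen_add, segLen_segN, segLen_segN]
    by_cases h3 : s = r' + 1
    · subst h3
      rw [hr, segLen_eq_zero hci]
      simp
      ring
    · by_cases h4 : s = r'
      · subst h4
        rw [hr', segLen_eq_zero hc]
        simp
      · have h5 : bead lam s ≠ i := fun h => h3 (hanti.injective (h.trans hr.symm))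
        have h6 : bead lam s ≠ i + 1 := fun h => h4 (hanti.injective (h.trans hr'.symm))
        simp [h3, h4, Ne.symm h5, Ne.symm h6]
  by_cases hpq : p = q
  · subst hpq
    rw [Finset.sum_eq_single_of_mem p hpN fun n hn hne => hzero n hn hne hne, if_pos hp, hep, segAct]
    have : wedge (move (c + segN i (p + 1) + segN (i + 1) p) (bead lam)) = 0 := by
      refine wedge_eq_zero (r := r') (s := r' + 1) (by omega) ?_
      rw [hmove, hmove]
      simp
    rw [this]
    simp
  · rw [Finset.sum_eq_add_of_mem p q hpN hqN hpq fun n hn hne => hzero n hn hne.1 hne.2, if_pos hp,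
      if_pos hq, hep, heq, segAct, segAct]
    have hmov : ∀ p q, Movable (c + segN i (p + 1) + segN (i + 1) q) (Set.range (bead lam)) →
        Movable (c + segN i (q + 1) + segN (i + 1) p) (Set.range (bead lam)) := by
      intro p q h a
      have h3 := h a
      simp only [cg_add, cg_segN] at h3 ⊢
      by_cases ha : a = i
      · subst ha
        simp [hci]
        exact ⟨_, hr⟩
      · by_cases ha' : a = i + 1
        · subst ha'
          simp [hc]
          exact ⟨by split_ifs <;> omega, fun _ => ⟨_, hr'⟩⟩
        · simpa [Ne.symm ha, Ne.symm ha'] using h3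
    have hholes : ∀ p q, holes (Set.range (bead lam)) (c + segN i (p + 1) + segN (i + 1) q) =
        holes (Set.range (bead lam)) (c + segN (i + 1) p + segN (i + 1) q) := by
      intro p q
      rw [holes_add, holes_add, holes_add, holes_add, holes_segN, holes_segN, holes_segN]
      congr 3
      ext x
      simp only [Finset.mem_filter, Finset.mem_Ioo]
      constructor
      · rintro ⟨h3, h4⟩
        have : x ≠ i + 1 := fun h => h4 ⟨r', by rw [hr', h]⟩
        refine ⟨⟨by omega, by push_cast at h3; omega⟩, h4⟩
      · rintro ⟨h3, h4⟩
        exact ⟨⟨by omega, by push_cast; omega⟩, h4⟩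
    have hswap : move (c + segN i (q + 1) + segN (i + 1) p) (bead lam) =
        move (c + segN i (p + 1) + segN (i + 1) q) (bead lam) ∘ Equiv.swap r' (r' + 1) := by
      ext s
      rw [Function.comp_apply, hmove, hmove]
      by_cases h3 : s = r' + 1
      · subst h3; simp
      · by_cases h4 : s = r'
        · subst h4; simp
        · rw [Equiv.swap_apply_of_ne_of_ne h4 h3]
          simp [h3, h4]
    have hh : holes (Set.range (bead lam)) (c + segN i (q + 1) + segN (i + 1) p) =
        holes (Set.range (bead lam)) (c + segN i (p + 1) + segN (i + 1) q) := by
      rw [hholes, hholes, add_right_comm]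
    rw [hh, hswap, wedge_swap (eventuallyVacuum_move (eventuallyVacuum_bead lam) _)]
    by_cases h3 : Movable (c + segN i (p + 1) + segN (i + 1) q) (Set.range (bead lam))
    · rw [if_pos h3, if_pos (hmov _ _ h3), smul_neg, add_neg_cancel]
    · rw [if_neg h3, if_neg fun h => h3 (hmov _ _ h), add_zero]

/-- Moving a bead from `i` to `i + 1` changes the number of holes of the hops along the segments of
`c` by the difference of the dimensions of `M(c)` at `i + 1` and `i`. -/
theorem holes_add_dimVec {A A' : Set ℤ} {i : ℤ} (hi : i ∈ A) (hi1 : i + 1 ∉ A)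
    (hA' : ∀ a, a ∈ A' ↔ (a ∈ A ∧ a ≠ i) ∨ a = i + 1) {c : Multisegment} (h0 : cg c i 0 = 0)
    (h1 : cg c (i + 1) 0 = 0) :
    holes A c + dimVec c i = holes A' c + dimVec c (i + 1) := by
  classical
  rw [dimVec_apply, dimVec_apply, holes, holes, rk, rk, ← wt_fun_add, ← wt_fun_add]
  refine wt_congr fun q hq => ?_
  have hq0 : q.1 ≠ i := fun h => by
    have := (wt_eq_zero_iff _ _).mp h0 q hq
    simp [h] at this
  have hq1 : q.1 ≠ i + 1 := fun h => by
    have := (wt_eq_zero_iff _ _).mp h1 q hq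
    simp [h] at this
  have hcount : ∀ I : Finset ℤ, (I.filter fun x => x ∉ A).card + (if i ∈ I then 1 else 0) =
      (I.filter fun x => x ∉ A').card + (if i + 1 ∈ I then 1 else 0) := by
    intro I
    rw [Finset.card_filter, Finset.card_filter, ← Finset.sum_ite_eq I i fun _ => 1,
      ← Finset.sum_ite_eq I (i + 1) fun _ => 1, ← Finset.sum_add_distrib, ← Finset.sum_add_distrib]
    refine Finset.sum_congr rfl fun x _ => ?_
    have h2 := hA' x
    by_cases hx : x = i
    · subst hx
      simp [hi, h2]
    · by_cases hx1 : x = i + 1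
      · subst hx1
        simp [hi1, h2]
      · simp [h2, hx, hx1, Ne.symm hx, Ne.symm hx1]
  have h2 := hcount (Finset.Ioo q.1 (q.1 + (q.2 : ℕ)))
  simp only [Finset.mem_Ioo] at h2
  have e1 : (q.1 < i ∧ i < q.1 + (q.2 : ℕ)) ↔ (q.1 ≤ i ∧ i < q.1 + (q.2 : ℕ)) := by omega
  have e2 : (q.1 < i + 1 ∧ i + 1 < q.1 + (q.2 : ℕ)) ↔ (q.1 ≤ i + 1 ∧ i + 1 < q.1 + (q.2 : ℕ)) := by
    omega
  simp only [e1, e2] at h2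
  exact h2

/-- A bead at `i` and no bead at `i + 1`: at most one term of `u_i u_m` acts nontrivially. -/
theorem sum_segAct_of_hop {m : Multisegment} {lam mu : YoungDiagram} {r : ℕ} {i : ℤ}
    (hr : bead lam r = i) (hi1 : i + 1 ∉ Set.range (bead lam))
    (hmu : bead mu = Function.update (bead lam) r (i + 1)) (hi : cg m i 0 = 0) (N : ℕ)
    (hN : totalDim m < N) :
    open Classical in
    gcoef vK i (dimVec m + Finsupp.single i 1) •
      ∑ n ∈ Finset.range N, (if segN (i + 1) n ≤ m then segAct (ext m i n) lam else 0) =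
    segAct m mu := by
  classical
  have hinj := (bead_strictAnti lam).injective
  set A := Set.range (bead lam) with hA
  set A' := Set.range (bead mu) with hA'
  have hiA : i ∈ A := ⟨r, hr⟩
  have hmem : ∀ a, a ∈ A' ↔ (a ∈ A ∧ a ≠ i) ∨ a = i + 1 := by
    intro a
    rw [hA', hmu]
    constructor
    · rintro ⟨s, hs⟩
      by_cases h : s = r
      · subst h
        rw [Function.update_self] at hs
        exact Or.inr hs.symm
      · rw [Function.update_of_ne h] at hs
        refine Or.inl ⟨⟨s, hs⟩, ?_⟩
        rintro rfl
        exact h (hinj (hs.trans hr.symm))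
    · rintro (⟨⟨s, hs⟩, ha⟩ | rfl)
      · refine ⟨s, ?_⟩
        rw [Function.update_of_ne, hs]
        rintro rfl
        exact ha (hs.symm.trans hr)
      · exact ⟨r, Function.update_self _ _ _⟩
  by_cases h1 : cg m (i + 1) 0 ≤ 1
  swap
  · rw [segAct_eq_zero (a := i + 1) (m := m) (Or.inl (by omega)), Finset.sum_eq_zero, smul_zero]
    intro n _
    split_ifs with h
    · have := cg_ext_succ h
      refine segAct_eq_zero (a := i + 1) (Or.inr ⟨?_, hi1⟩)
      split_ifs at this <;> omega
    · rfl
  obtain ⟨c, p, rfl, hc⟩ := exists_eq_add_segN_of_le_one h1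
  have hci : cg c i 0 = 0 := by
    rw [cg_add] at hi
    omega
  have hp : segN (i + 1) p ≤ c + segN (i + 1) p := le_add_self
  have hpN : p ∈ Finset.range N := by
    have := wt_mono (fun p => (p.2 : ℕ)) hp
    change totalDim _ ≤ totalDim _ at this
    rw [totalDim_segN] at this
    exact Finset.mem_range.mpr (by omega)
  rw [Finset.sum_eq_single_of_mem p hpN, if_pos hp, ext_add_segN]
  swap
  · intro n _ hne
    split_ifs with h
    · by_cases h0 : n = 0
      · have := cg_ext_succ h
        rw [cg_add, cg_segN] at this
        subst h0
        simp [show 0 < p by omega] at this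
        exact segAct_eq_zero (a := i + 1) (Or.inr ⟨by omega, hi1⟩)
      · have h2 : segN (i + 1) n ≤ c + segN (i + 1) p + segN (i + 1) 0 := by
          rwa [segN_zero, add_zero]
        rcases eq_or_eq_of_segN_le hc h0 h2 with h5 | h5
        · exact absurd h5 hne
        · exact absurd h5 h0
    · rfl
  have hmov : Movable (c + segN i (p + 1)) A ↔ Movable (c + segN (i + 1) p) A' := by
    refine forall_congr' fun a => ?_
    simp only [cg_add, cg_segN, hmem]
    by_cases ha : a = i
    · subst ha
      simp [hci, hiA]
    · by_cases ha' : a = i + 1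
      · subst ha'
        simp [hc]
        split_ifs <;> omega
      · simp [ha, ha', Ne.symm ha, Ne.symm ha']
  have hmove : move (c + segN i (p + 1)) (bead lam) = move (c + segN (i + 1) p) (bead mu) := by
    ext s
    rw [move, move, segLen_add, segLen_add, segLen_segN, segLen_segN, hmu]
    by_cases h : s = r
    · subst h
      rw [Function.update_self, hr, segLen_eq_zero hci, segLen_eq_zero hc]
      simp
      ring
    · rw [Function.update_of_ne h]
      have h5 : bead lam s ≠ i := fun h' => h (hinj (h'.trans hr.symm))
      have h6 : bead lam s ≠ i + 1 := fun h' => hi1 ⟨s, h'⟩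
      simp [Ne.symm h5, Ne.symm h6]
  have hpow : (gcoef vK i (dimVec (c + segN (i + 1) p) + Finsupp.single i 1) : K) *
      (vK : K) ^ holes A (c + segN i (p + 1)) = (vK : K) ^ holes A' (c + segN (i + 1) p) := by
    have h2 := holes_add_dimVec hiA hi1 hmem hci hc
    have h3 : holes A (segN i (p + 1)) = holes A' (segN (i + 1) p) + (if 0 < p then 1 else 0) := by
      have e1 : ∀ x, x ∈ Finset.Ioo i (i + ((p + 1 : ℕ) : ℤ)) ↔
          x ∈ Finset.Ioo (i + 1) (i + 1 + (p : ℤ)) ∨ (x = i + 1 ∧ 0 < p) := by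
        intro x
        simp only [Finset.mem_Ioo]
        push_cast
        omega
      rw [holes_segN, holes_segN]
      split_ifs with h0
      · rw [← Finset.card_insert_of_notMem (a := i + 1) (by simp)]
        congr 1
        ext x
        rw [Finset.mem_filter, e1, Finset.mem_insert, Finset.mem_filter, hmem, Finset.mem_Ioo]
        constructor
        · rintro ⟨h4 | h4, h5⟩
          · exact Or.inr ⟨h4, by rintro (h6 | h6); exacts [h5 h6.1, by omega]⟩
          · exact Or.inl h4.1
        · rintro (rfl | ⟨h4, h5⟩)
          · exact ⟨Or.inr ⟨rfl, h0⟩, hi1⟩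
          · exact ⟨Or.inl h4, fun h6 => h5 (Or.inl ⟨h6, by omega⟩)⟩
      · rw [add_zero]
        have : p = 0 := by omega
        subst this
        have e2 : Finset.Ioo i (i + 1) = ∅ := by
          ext x
          simp
        simp [e2]
    have h4 : dimVec (segN (i + 1) p) i = 0 := by
      rw [dimVec_apply, rk_segN _ _ le_rfl, if_neg (by omega)]
    have h5 : dimVec (segN (i + 1) p) (i + 1) = if 0 < p then 1 else 0 := by
      rw [dimVec_apply, rk_segN _ _ le_rfl]
      congr 1
      simp
    rw [gcoef, ← Units.val_pow_eq_pow_val, ← Units.val_pow_eq_pow_val, ← Units.val_mul,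
      ← zpow_natCast, ← zpow_natCast, ← zpow_add]
    congr 2
    rw [holes_add, holes_add, h3, dimVec_add]
    simp only [Finsupp.add_apply, h4, h5, Finsupp.single_apply]
    rw [if_true, if_neg (show ¬ i = i + 1 by omega)]
    push_cast
    have h6 : (holes A c : ℤ) + dimVec c i = holes A' c + dimVec c (i + 1) := by exact_mod_cast h2
    linarith
  rw [segAct, segAct, ← hA, ← hA', hmove]
  by_cases h : Movable (c + segN i (p + 1)) A
  · rw [if_pos h, if_pos (hmov.mp h), smul_smul, hpow]
  · rw [if_neg h, if_neg fun h' => h (hmov.mpr h'), smul_zero]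

/-- The action is compatible with left multiplication by `u_i`; this depends on
whether `i` and `i + 1` are occupied, and both sides vanish if `m` has a segment starting at `i`. -/
theorem fockRep_lmul_uBasis (i : ℤ) (m : Multisegment) (lam : YoungDiagram) :
    fockRep (lmul vK i (uBasis K m)) (ket lam) = fockRep (uBasis K m) (fockF i (ket lam)) := by
  classical
  have hL : fockRep (lmul vK i (uBasis K m)) (ket lam) =
      ∑ n ∈ Finset.range (totalDim m + 1), if segN (i + 1) n ≤ m then
        (gcoef vK i (dimVec m + Finsupp.single i 1) * extCoeff ((vK : K) ^ 2) m i n) •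
          segAct (ext m i n) lam else 0 := by
    rw [lmul, lop_uBasis _ _ _ _ _ (Nat.lt_succ_self _), map_sum, LinearMap.sum_apply]
    refine Finset.sum_congr rfl fun n _ => ?_
    split_ifs
    · rw [map_smul, LinearMap.smul_apply, fockRep_apply]
    · simp
  by_cases hiA : i ∈ Set.range (bead lam)
  swap
  · rw [fockF_ket_eq_zero (Or.inl hiA), map_zero, hL, Finset.sum_eq_zero]
    intro n _
    split_ifs with h
    · rw [segAct_eq_zero (a := i) (Or.inr ⟨by rw [cg_ext_self h]; omega, hiA⟩), smul_zero]
    · rfl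
  obtain ⟨r, rfl⟩ := hiA
  by_cases hi : cg m (bead lam r) 0 = 0
  · have hcg : ∀ n, cg m (bead lam r) n = 0 := fun n => by
      have := cg_antitone m (bead lam r) (Nat.zero_le n)
      omega
    have hext : ∀ n, extCoeff ((vK : K) ^ 2) m (bead lam r) n = 1 := fun n => by
      have h1 := cg_succ m (bead lam r) n
      rw [hcg, hcg] at h1
      rw [extCoeff, hcg, show mu m (bead lam r) n = 0 by omega]
      simp
    have hL' : fockRep (lmul vK (bead lam r) (uBasis K m)) (ket lam) =
        gcoef vK (bead lam r) (dimVec m + Finsupp.single (bead lam r) 1) •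
        ∑ n ∈ Finset.range (totalDim m + 1), if segN (bead lam r + 1) n ≤ m then
          segAct (ext m (bead lam r) n) lam else 0 := by
      rw [hL, Finset.smul_sum]
      refine Finset.sum_congr rfl fun n _ => ?_
      rw [hext, mul_one]
      split_ifs
      · rfl
      · rw [smul_zero]
    rw [hL']
    by_cases h1 : bead lam r + 1 ∈ Set.range (bead lam)
    · rw [fockF_ket_eq_zero (Or.inr h1), map_zero]
      obtain ⟨r', hr'⟩ := h1
      rw [sum_segAct_of_mem rfl hr' hi _ (Nat.lt_succ_self _), smul_zero]
    · obtain ⟨mu, h2, h3⟩ := fockF_ket_of_hop h1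
      rw [h2, fockRep_apply, sum_segAct_of_hop rfl h1 h3 hi _ (Nat.lt_succ_self _)]
  · have h0 : fockRep (lmul vK (bead lam r) (uBasis K m)) (ket lam) = 0 := by
      rw [hL, Finset.sum_eq_zero]
      intro n _
      split_ifs with h
      · rw [segAct_eq_zero (a := bead lam r) (Or.inl (by rw [cg_ext_self h]; omega)), smul_zero]
      · rfl
    rw [h0]
    by_cases h1 : bead lam r + 1 ∈ Set.range (bead lam)
    · rw [fockF_ket_eq_zero (Or.inr h1), map_zero]
    · obtain ⟨mu, h2, h3⟩ := fockF_ket_of_hop h1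
      rw [h2, fockRep_apply, segAct_eq_zero (a := bead lam r) (Or.inr ⟨hi, ?_⟩)]
      rintro ⟨s, hs⟩
      rw [h3] at hs
      by_cases hsr : s = r
      · subst hsr
        rw [Function.update_self] at hs
        omega
      · rw [Function.update_of_ne hsr] at hs
        exact hsr ((bead_strictAnti lam).injective hs)

theorem fock_ext {f g : Module.End K Fock} (h : ∀ lam, f (ket lam) = g (ket lam)) : f = g :=
  Finsupp.lhom_ext' fun lam => LinearMap.ext_ring (h lam)

theorem fockRep_lmul (i : ℤ) (y : Hall K) : fockRep (lmul vK i y) = fockRep y * fockF i := by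
  have : fockRep ∘ₗ lmul vK i = (LinearMap.mulRight K (fockF i)) ∘ₗ fockRep :=
    hall_ext fun m => fock_ext fun lam => by
      rw [LinearMap.comp_apply, fockRep_lmul_uBasis]
      rfl
  exact LinearMap.congr_fun this y

theorem fockRep_one : fockRep (uBasis K 0) = 1 := by
  refine fock_ext fun lam => ?_
  have h1 : Movable 0 (Set.range (bead lam)) := fun a => by simp [cg]
  have h2 : move 0 (bead lam) = bead lam := by
    ext r
    simp [move, segLen]
  rw [fockRep_apply, segAct, if_pos h1, h2, wedge_bead]
  simp [holes]

theorem toK_injective : Function.Injective toK := by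
  rw [injective_iff_map_eq_zero]
  intro a
  induction a using LaurentPolynomial.induction_on_mul_T with
  | _ p n =>
  intro h
  rw [map_mul, toK, LaurentPolynomial.eval₂_toLaurent, LaurentPolynomial.eval₂_T] at h
  have h1 : Polynomial.eval₂ (Int.castRingHom K) (vK : K) p = 0 :=
    (mul_eq_zero.mp h).resolve_right (Units.ne_zero _)
  have h2 : (algebraMap (Polynomial ℚ) K) (p.map (Int.castRingHom ℚ)) = 0 := by
    have h3 : (algebraMap (Polynomial ℚ) K).comp (Polynomial.mapRingHom (Int.castRingHom ℚ)) =
        Polynomial.eval₂RingHom (Int.castRingHom K) (vK : K) := by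
      refine Polynomial.ringHom_ext' (RingHom.ext_int _ _) ?_
      simp [vK, RatFunc.algebraMap_X]
    rw [← h1]
    exact RingHom.congr_fun h3 p
  have h3 : p.map (Int.castRingHom ℚ) = 0 :=
    (map_eq_zero_iff _ (RatFunc.algebraMap_injective ℚ)).mp h2
  have h4 : p = 0 := Polynomial.map_injective _ Int.cast_injective (by rw [h3, Polynomial.map_zero])
  rw [h4, map_zero, zero_mul]

theorem map_toK_vZ : Units.map (toK : Z →* K) vZ = vK := by
  refine Units.ext ?_
  change toK (LaurentPolynomial.T 1) = vK
  rw [toK, LaurentPolynomial.eval₂_T, zpow_one]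

theorem toK_vZ : toK (vZ : Z) = (vK : K) := by
  rw [← map_toK_vZ]
  rfl

theorem qn_vK_ne_zero (n : ℕ) : qn ((vK : K) ^ 2) (n + 1) ≠ 0 := by
  rw [← toK_vZ, ← map_pow, ← map_qn, Ne, map_eq_zero_iff _ toK_injective]
  exact qn_vZ_ne_zero n

theorem lmul_uBasis_zero {R : Type} [CommRing R] (v : Rˣ) (i : ℤ) :
    lmul v i (uBasis R 0) = uBasis R (seg i 1) := by
  rw [lmul, lop_uBasis _ _ _ _ 1 (by simp [totalDim]), Finset.sum_range_one, if_pos (by simp)]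
  simp [ext, segN_one, gcoef, dimVec_zero, extCoeff, cg, mu]

theorem isFockAction_fockRep : IsFockAction fockRep where
  map_one := fockRep_one
  map_gen i := by rw [← lmul_uBasis_zero vK, fockRep_lmul, fockRep_one, one_mul]
  map_mul x y := by
    let W : Submodule K (Hall K) :=
      { carrier := {y | fockRep (hallMul K vK y x) = fockRep x * fockRep y}
        add_mem' := fun {a b} ha hb => by
          simp only [Set.mem_ofPred_eq] at ha hb ⊢
          rw [map_add, LinearMap.add_apply, map_add, ha, hb, map_add, mul_add]
        zero_mem' := by simp
        smul_mem' := fun a z hz => by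
          simp only [Set.mem_ofPred_eq] at hz ⊢
          rw [map_smul, LinearMap.smul_apply, map_smul, hz, map_smul, mul_smul_comm] }
    refine eq_top_of_lmul_mem vK qn_vK_ne_zero W ?_ (fun i z hz => ?_) (fun a z ha hz => ?_) y
    · change fockRep (hallMul K vK (uBasis K 0) x) = fockRep x * fockRep (uBasis K 0)
      rw [hallMul_zero_left, fockRep_one, mul_one]
      rfl
    · change fockRep (hallMul K vK (lmul vK i z) x) = fockRep x * fockRep (lmul vK i z)
      have hz' : fockRep (hallMul K vK z x) = fockRep x * fockRep z := hz
      rw [hallMul_lmul, fockRep_lmul, hz', fockRep_lmul, mul_assoc]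
    · have h1 := W.smul_mem a⁻¹ hz
      rwa [smul_smul, inv_mul_cancel₀ ha, one_smul] at h1

/-- Uniqueness of the action: the elements `u_i` generate the Hall algebra over `ℚ(v)`. -/
theorem IsFockAction.eq_fockRep {ρ : Hall K →ₗ[K] Module.End K Fock} (h : IsFockAction ρ) :
    ρ = fockRep := by
  refine LinearMap.ext fun y => ?_
  let W : Submodule K (Hall K) := LinearMap.eqLocus ρ fockRep
  refine eq_top_of_lmul_mem vK qn_vK_ne_zero W ?_ (fun i z hz => ?_) (fun a z ha hz => ?_) y
  · change ρ (uBasis K 0) = fockRep (uBasis K 0)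
    rw [h.map_one, fockRep_one]
  · change ρ (lmul vK i z) = fockRep (lmul vK i z)
    have hz' : ρ z = fockRep z := hz
    rw [fockRep_lmul, ← hz', ← h.map_gen i, ← h.map_mul, minusMul, hallMul_seg]
  · have h1 := W.smul_mem a⁻¹ hz
    rwa [smul_smul, inv_mul_cancel₀ ha, one_smul] at h1

theorem fockAction_eq : fockAction = fockRep := by
  have h : ∃ ρ, IsFockAction ρ := ⟨_, isFockAction_fockRep⟩
  rw [fockAction, dif_pos h]
  exact h.choose_spec.eq_fockRep

theorem minus_add (x y : Hall Z) : minus (x + y) = minus x + minus y :=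
  Finsupp.mapRange_add (map_add toK) x y

theorem minus_smul (a : Z) (x : Hall Z) : minus (a • x) = toK a • minus x := by
  ext p
  simp [minus]

theorem toK_tcoef (m : Multisegment) : toK (tcoef vZ m : Z) = (tcoef vK m : K) := by
  rw [tcoef, tcoef, ← map_toK_vZ, ← map_zpow]
  rfl

theorem minus_uTil (m : Multisegment) : minus (uTil vZ m) = uTil vK m := by
  rw [uTil, minus_smul, toK_tcoef, uTil]
  congr 1
  simp [minus, uBasis]

theorem fockAction_uTilde (k : Type u) [Field k] (m : Multisegment) (lam : YoungDiagram) :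
    fockAction (minus (uTilde k m)) (ket lam) = (tcoef vK m : K) • segAct m lam := by
  rw [fockAction_eq, uTilde_eq, minus_uTil, uTil, map_smul, LinearMap.smul_apply, fockRep_apply]

/-! ### The vacuum vector -/

theorem segLen_bot_eq_zero (m : Multisegment) : ∃ N : ℕ, ∀ s : ℕ, N ≤ s → segLen m (-(s : ℤ)) = 0 := by
  obtain ⟨N, hN⟩ := eventuallyVacuum_move (eventuallyVacuum_bead ⊥) m
  refine ⟨N, fun s hs => ?_⟩
  have := hN s hs
  rw [move, bead_bot] at this
  omega

theorem mu_eq_of_cg_le_one {m : Multisegment} {a : ℤ} (h : cg m a 0 ≤ 1) (n : ℕ) :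
    mu m a n = if segLen m a = n + 1 then 1 else 0 := by
  obtain ⟨m', k, rfl, h1⟩ := exists_eq_add_segN_of_le_one h
  have h2 := cg_succ m' a n
  have h3 := cg_antitone m' a (Nat.zero_le n)
  rw [segLen_add, segLen_eq_zero h1, segLen_segN, mu_add, mu_segN, show mu m' a n = 0 by omega]
  simp

theorem eq_sum_segN {m : Multisegment} (hm : Movable m (Set.range (bead ⊥))) {N : ℕ}
    (hN : ∀ s : ℕ, N ≤ s → segLen m (-(s : ℤ)) = 0) :
    m = ∑ s ∈ Finset.range N, segN (-(s : ℤ)) (segLen m (-(s : ℤ))) := by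
  classical
  ext ⟨a, l⟩
  obtain ⟨n, rfl⟩ : ∃ n : ℕ, l = n.succPNat := ⟨l.natPred, (PNat.succPNat_natPred l).symm⟩
  rw [Finsupp.finsetSum_apply]
  change mu m a n = ∑ s ∈ Finset.range N, mu (segN (-(s : ℤ)) (segLen m (-(s : ℤ)))) a n
  simp only [mu_segN]
  rw [mu_eq_of_cg_le_one (hm a).1]
  by_cases h : segLen m a = n + 1
  · rw [if_pos h]
    have h1 : cg m a 0 ≠ 0 := fun hc => by
      rw [segLen_eq_zero hc] at h
      omega
    obtain ⟨s, rfl⟩ := (hm a).2 h1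
    rw [bead_bot] at h ⊢
    have hs : s < N := by
      by_contra hc
      rw [hN s (by omega)] at h
      omega
    rw [Finset.sum_eq_single_of_mem s (Finset.mem_range.mpr hs), if_pos ⟨rfl, h⟩]
    intro s' _ hne
    rw [if_neg fun hc => hne (by have := hc.1; omega)]
  · rw [if_neg h, Finset.sum_eq_zero]
    intro s _
    rw [if_neg]
    rintro ⟨rfl, h2⟩
    exact h h2

theorem rk_sum_segN (N : ℕ) (l : ℕ → ℕ) {i j : ℤ} (hij : i ≤ j) :
    rk (∑ s ∈ Finset.range N, segN (-(s : ℤ)) (l s)) i j =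
      ∑ s ∈ Finset.range N, if -(s : ℤ) ≤ i ∧ j < -(s : ℤ) + l s then 1 else 0 := by
  rw [rk, wt_finsetSum]
  exact Finset.sum_congr rfl fun s _ => rk_segN _ _ hij

theorem partSeg_eq (lam : YoungDiagram) {N : ℕ} (hN : lam.colLen 0 ≤ N) :
    partSeg lam = ∑ s ∈ Finset.range N, segN (-(s : ℤ)) (lam.rowLen s) := by
  rw [partSeg, ← Finset.sum_subset (Finset.range_subset_range.mpr hN)]
  · refine Finset.sum_congr rfl fun s hs => ?_
    have h1 := rowLen_pos (Finset.mem_range.mp hs)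
    obtain ⟨n, hn⟩ : ∃ n, lam.rowLen s = n + 1 := ⟨lam.rowLen s - 1, by omega⟩
    rw [hn]
    rfl
  · intro s _ hs
    rw [rowLen_eq_zero (by simpa using hs), segN_zero]

theorem rk_partSeg (lam : YoungDiagram) {N : ℕ} (hN : lam.colLen 0 ≤ N) {i j : ℤ} (hij : i ≤ j) :
    rk (partSeg lam) i j =
      ∑ s ∈ Finset.range N, if -(s : ℤ) ≤ i ∧ j < bead lam s then 1 else 0 := by
  rw [partSeg_eq lam hN, rk_sum_segN _ _ hij]
  refine Finset.sum_congr rfl fun s _ => ?_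
  rw [bead]
  congr 1
  rw [neg_add_eq_sub]

/-- The beads beyond `j` are counted by splitting off those starting beyond `i`. -/
theorem sum_lt_eq_add (f : ℕ → ℤ) (N : ℕ) (i j : ℤ) :
    (∑ s ∈ Finset.range N, if j < f s then 1 else 0) =
      (∑ s ∈ Finset.range N, if -(s : ℤ) ≤ i ∧ j < f s then 1 else 0) +
      ∑ s ∈ Finset.range N, if i < -(s : ℤ) ∧ j < f s then 1 else 0 := by
  rw [← Finset.sum_add_distrib]
  refine Finset.sum_congr rfl fun s _ => ?_
  split_ifs <;> omega

theorem sum_and_eq {f : ℕ → ℤ} (hf : ∀ s : ℕ, -(s : ℤ) ≤ f s) (N : ℕ) (i : ℤ) :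
    (∑ s ∈ Finset.range N, if i < -(s : ℤ) ∧ i < f s then 1 else 0) =
      ∑ s ∈ Finset.range N, if i < -(s : ℤ) then 1 else 0 := by
  refine Finset.sum_congr rfl fun s _ => ?_
  have := hf s
  congr 1
  exact propext ⟨fun h => h.1, fun h => ⟨h, by omega⟩⟩

/-- If the beads of the vacuum are moved, along the segments of `m`, to the beads of `λ`, then
`m_λ ≤ m`. -/
theorem rkLE_partSeg {m : Multisegment} {lam : YoungDiagram}
    (hm : Movable m (Set.range (bead ⊥))) (hinj : Function.Injective (move m (bead ⊥)))
    (hrange : Set.range (move m (bead ⊥)) = Set.range (bead lam)) : RkLE (partSeg lam) m := by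
  classical
  set τ := move m (bead ⊥) with hτ
  obtain ⟨N₀, hN₀⟩ := segLen_bot_eq_zero m
  set N := max N₀ (lam.colLen 0) with hN
  have hNle : lam.colLen 0 ≤ N := le_max_right _ _
  have hτs : ∀ s : ℕ, τ s = -(s : ℤ) + segLen m (-(s : ℤ)) := fun s => by
    rw [hτ, move, bead_bot]
  have hτN : ∀ s, N ≤ s → τ s = -(s : ℤ) := fun s hs => by
    rw [hτs, hN₀ s (by omega)]
    simp
  have hβN : ∀ s, N ≤ s → bead lam s = -(s : ℤ) := fun s hs => bead_of_le (by omega)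
  have hβ := bead_strictAnti lam
  have himage : (Finset.range N).image τ = (Finset.range N).image (bead lam) := by
    ext x
    simp only [Finset.mem_image, Finset.mem_range]
    constructor
    · rintro ⟨s, hs, rfl⟩
      obtain ⟨s', hs'⟩ : τ s ∈ Set.range (bead lam) := hrange ▸ ⟨s, rfl⟩
      refine ⟨s', ?_, hs'⟩
      by_contra hc
      have : s' = s := hinj (by rw [← hs', hτN s' (by omega), hβN s' (by omega)])
      omega
    · rintro ⟨s, hs, rfl⟩
      obtain ⟨s', hs'⟩ : bead lam s ∈ Set.range τ := hrange.symm ▸ ⟨s, rfl⟩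
      refine ⟨s', ?_, hs'⟩
      by_contra hc
      have : s' = s := hβ.injective (by rw [← hs', hτN s' (by omega), hβN s' (by omega)])
      omega
  have hT : ∀ j : ℤ, (∑ s ∈ Finset.range N, if j < bead lam s then 1 else 0) =
      ∑ s ∈ Finset.range N, if j < τ s then 1 else 0 := fun j => by
    rw [← Finset.sum_image (f := fun x => if j < x then 1 else 0) (hβ.injective.injOn), ← himage,
      Finset.sum_image hinj.injOn]
  have hrk : ∀ i j : ℤ, i ≤ j → rk m i j =
      ∑ s ∈ Finset.range N, if -(s : ℤ) ≤ i ∧ j < τ s then 1 else 0 := fun i j hij => by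
    have h1 := eq_sum_segN hm (N := N) fun s hs => hN₀ s (by omega)
    conv_lhs => rw [h1]
    rw [rk_sum_segN _ _ hij]
    simp only [hτs]
  have hle : ∀ i j, i ≤ j → rk (partSeg lam) i j ≤ rk m i j := by
    intro i j hij
    rw [rk_partSeg lam hNle hij, hrk i j hij]
    by_cases h : ∃ s : ℕ, i < -(s : ℤ) ∧ bead lam s ≤ j
    · obtain ⟨s₀, h1, h2⟩ := h
      rw [Finset.sum_eq_zero]
      · exact Nat.zero_le _
      · intro s _
        rw [if_neg]
        rintro ⟨h3, h4⟩
        have := hβ (show s₀ < s by omega)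
        omega
    · push Not at h
      have h1 := sum_lt_eq_add (bead lam) N i j
      have h2 := sum_lt_eq_add τ N i j
      have h3 : (∑ s ∈ Finset.range N, if i < -(s : ℤ) ∧ j < τ s then 1 else 0) ≤
          ∑ s ∈ Finset.range N, if i < -(s : ℤ) ∧ j < bead lam s then 1 else 0 := by
        refine Finset.sum_le_sum fun s _ => ?_
        by_cases h4 : i < -(s : ℤ)
        · rw [if_pos (show i < -(s : ℤ) ∧ j < bead lam s from ⟨h4, h s h4⟩)]
          split_ifs <;> omega
        · rw [if_neg fun hc => h4 hc.1]
          exact Nat.zero_le _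
      have h4 := hT j
      omega
  refine ⟨?_, hle⟩
  ext i
  rw [dimVec_apply, dimVec_apply, rk_partSeg lam hNle le_rfl, hrk i i le_rfl]
  have h1 := sum_lt_eq_add (bead lam) N i i
  have h2 := sum_lt_eq_add τ N i i
  rw [sum_and_eq (fun s => by rw [bead]; omega)] at h1
  rw [sum_and_eq (fun s => by rw [hτs]; omega)] at h2
  have h3 := hT i
  omega

/-- A partition is determined by the number of its boxes of each color. -/
theorem eq_of_dimVec_partSeg {lam mu : YoungDiagram} (h : dimVec (partSeg lam) = dimVec (partSeg mu)) :
    lam = mu := by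
  classical
  have key : ∀ lam mu : YoungDiagram, dimVec (partSeg lam) = dimVec (partSeg mu) →
      Set.range (bead lam) ⊆ Set.range (bead mu) := by
    intro lam mu h
    rintro _ ⟨s, rfl⟩
    set N := max (max (lam.colLen 0) (mu.colLen 0)) (s + 1) with hN
    have hT : ∀ i : ℤ, (∑ s ∈ Finset.range N, if i < bead lam s then 1 else 0) =
        ∑ s ∈ Finset.range N, if i < bead mu s then 1 else 0 := fun i => by
      have h1 := sum_lt_eq_add (bead lam) N i i
      have h2 := sum_lt_eq_add (bead mu) N i i
      rw [sum_and_eq (fun s => by rw [bead]; omega),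
        ← rk_partSeg lam (by omega) le_rfl, ← dimVec_apply] at h1
      rw [sum_and_eq (fun s => by rw [bead]; omega),
        ← rk_partSeg mu (by omega) le_rfl, ← dimVec_apply] at h2
      rw [h1, h2, h]
    by_contra hc
    have h1 : ∀ f : ℕ → ℤ, (∑ t ∈ Finset.range N, if bead lam s - 1 < f t then 1 else 0) =
        (∑ t ∈ Finset.range N, if bead lam s < f t then 1 else 0) +
        ∑ t ∈ Finset.range N, if f t = bead lam s then 1 else 0 := fun f => by
      rw [← Finset.sum_add_distrib]
      refine Finset.sum_congr rfl fun t _ => ?_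
      split_ifs <;> omega
    have h2 := h1 (bead lam)
    have h3 := h1 (bead mu)
    have h4 : (∑ t ∈ Finset.range N, if bead mu t = bead lam s then 1 else 0) = 0 :=
      Finset.sum_eq_zero fun t _ => if_neg fun h => hc ⟨t, h⟩
    have h5 : 1 ≤ ∑ t ∈ Finset.range N, if bead lam t = bead lam s then 1 else 0 := by
      have := Finset.single_le_sum (f := fun t => if bead lam t = bead lam s then 1 else 0)
        (fun _ _ => Nat.zero_le _) (Finset.mem_range.mpr (show s < N by omega))
      simpa using this
    have h6 := hT (bead lam s - 1)
    have h7 := hT (bead lam s)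
    omega
  exact eq_of_range_bead_eq ((key lam mu h).antisymm (key mu lam h.symm))

theorem cg_partSeg (lam : YoungDiagram) (a : ℤ) :
    cg (partSeg lam) a 0 = ((Finset.range (lam.colLen 0)).filter fun s : ℕ =>
      -(s : ℤ) = a ∧ 0 < lam.rowLen s).card := by
  rw [partSeg_eq lam le_rfl, cg, wt_finsetSum, Finset.card_filter]
  exact Finset.sum_congr rfl fun s _ => cg_segN _ _ _ _

theorem movable_partSeg (lam : YoungDiagram) : Movable (partSeg lam) (Set.range (bead ⊥)) := by
  intro a
  rw [cg_partSeg]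
  constructor
  · rw [Finset.card_le_one]
    intro s hs t ht
    have h1 := (Finset.mem_filter.mp hs).2.1
    have h2 := (Finset.mem_filter.mp ht).2.1
    omega
  · intro h
    obtain ⟨s, hs⟩ := Finset.card_ne_zero.mp h
    exact ⟨s, by rw [bead_bot]; exact (Finset.mem_filter.mp hs).2.1⟩

theorem move_partSeg (lam : YoungDiagram) : move (partSeg lam) (bead ⊥) = bead lam := by
  ext s
  have h1 : segLen (partSeg lam) (-(s : ℤ)) = lam.rowLen s := by
    rw [partSeg_eq lam (le_max_left _ (s + 1)), segLen, wt_finsetSum,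
      Finset.sum_eq_single_of_mem s (Finset.mem_range.mpr (by omega))]
    · exact (segLen_segN _ _ _).trans (if_pos rfl)
    · intro t _ hne
      exact (segLen_segN _ _ _).trans (if_neg (by omega))
  rw [move, bead_bot, h1, bead]
  ring

/-- The powers of `v` cancel: in each row the endomorphisms count the boxes with `j ≤ i`, and the
holes count the boxes with `j > i`, where `(i, j)` is the position of the box. -/
theorem endDim_add_holes_partSeg (lam : YoungDiagram) :
    endDim (partSeg lam) + holes (Set.range (bead ⊥)) (partSeg lam) = totalDim (partSeg lam) := by
  classical
  set t := lam.colLen 0 with ht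
  have hβ := bead_strictAnti lam
  have hpos : ∀ s ∈ Finset.range t, ((Nat.toPNat' (lam.rowLen s) : ℕ+) : ℕ) = lam.rowLen s :=
    fun s hs => by
      rw [Nat.toPNat'_coe, if_pos (rowLen_pos (Finset.mem_range.mp hs))]
  have hend : endDim (partSeg lam) = ∑ s ∈ Finset.range t, min (s + 1) (lam.rowLen s) := by
    have h1 : endDim (partSeg lam) = ∑ s ∈ Finset.range t, ∑ s' ∈ Finset.range t,
        if s ≤ s' ∧ s' < s + lam.rowLen s' then 1 else 0 := by
      unfold endDim
      conv_lhs => arg 2; rw [partSeg]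
      rw [wt_finsetSum]
      refine Finset.sum_congr rfl fun s hs => ?_
      rw [wt_seg, hpos s hs, rk_partSeg lam le_rfl le_rfl, rk_partSeg lam le_rfl (by omega),
        Finset.sum_eq_zero (s := Finset.range (lam.colLen 0)) (f := fun s' : ℕ =>
          if -(s' : ℤ) ≤ -(s : ℤ) ∧ -(s : ℤ) + (lam.rowLen s : ℕ) < bead lam s' then 1 else 0),
        Nat.sub_zero]
      · refine Finset.sum_congr rfl fun s' _ => ?_
        rw [bead]
        congr 1
        exact propext (by omega)
      · intro s' _
        rw [if_neg]
        rintro ⟨h2, h3⟩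
        have h4 := hβ.antitone (show s ≤ s' by omega)
        rw [bead, bead] at h4
        rw [bead] at h3
        omega
    rw [h1, Finset.sum_comm]
    refine Finset.sum_congr rfl fun s' hs' => ?_
    rw [← Finset.card_filter]
    have h2 : (Finset.range t).filter (fun s => s ≤ s' ∧ s' < s + lam.rowLen s') =
        Finset.Icc (s' + 1 - lam.rowLen s') s' := by
      ext s
      have := Finset.mem_range.mp hs'
      have := rowLen_pos (lam := lam) this
      simp only [Finset.mem_filter, Finset.mem_range, Finset.mem_Icc]
      omega
    rw [h2, Nat.card_Icc]
    omega
  have hholes : holes (Set.range (bead ⊥)) (partSeg lam) =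
      ∑ s ∈ Finset.range t, (lam.rowLen s - s - 1) := by
    rw [partSeg_eq lam le_rfl, holes, wt_finsetSum]
    refine Finset.sum_congr rfl fun s _ => (holes_segN _ _ _).trans ?_
    have h1 : (Finset.Ioo (-(s : ℤ)) (-(s : ℤ) + lam.rowLen s)).filter
        (fun x => x ∉ Set.range (bead ⊥)) = Finset.Ioo 0 (-(s : ℤ) + lam.rowLen s) := by
      ext x
      rw [Finset.mem_filter, Finset.mem_Ioo, Finset.mem_Ioo]
      have h2 : x ∉ Set.range (bead ⊥) ↔ 0 < x := by
        constructor
        · intro h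
          by_contra hc
          exact h ⟨(-x).toNat, by rw [bead_bot]; omega⟩
        · rintro h ⟨r, hr⟩
          rw [bead_bot] at hr
          omega
      rw [h2]
      omega
    rw [h1, Int.card_Ioo]
    omega
  have htot : totalDim (partSeg lam) = ∑ s ∈ Finset.range t, lam.rowLen s := by
    rw [partSeg_eq lam le_rfl, totalDim_eq_wt, wt_finsetSum]
    exact Finset.sum_congr rfl fun s _ => totalDim_segN _ _
  rw [hend, hholes, htot, ← Finset.sum_add_distrib]
  exact Finset.sum_congr rfl fun s _ => by omega

/-- The image of the vacuum vector under `u_m⁻` is zero or a scalar multiple of some `|λ⟩` with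
`m_λ ≤ m`. -/
theorem segAct_bot (m : Multisegment) : segAct m ⊥ = 0 ∨
    ∃ lam, RkLE (partSeg lam) m ∧ ∃ a : Z, segAct m ⊥ = toK a • ket lam := by
  by_cases h : Movable m (Set.range (bead ⊥))
  swap
  · exact Or.inl (by rw [segAct, if_neg h])
  by_cases h' : Function.Injective (move m (bead ⊥)) ∧
      ∃ lam, Set.range (move m (bead ⊥)) = Set.range (bead lam)
  · obtain ⟨hinj, lam, hrange⟩ := h'
    refine Or.inr ⟨lam, rkLE_partSeg h hinj hrange,
      (vZ : Z) ^ holes (Set.range (bead ⊥)) m * (seqSign (move m (bead ⊥)) : Z), ?_⟩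
    rw [segAct, if_pos h, wedge_of_range hinj hrange, map_mul, map_pow, toK_vZ, map_intCast,
      ← smul_smul, Int.cast_smul_eq_zsmul]
  · exact Or.inl (by rw [segAct, if_pos h, wedge, dif_neg h', smul_zero])

theorem tcoef_smul_segAct_partSeg (lam : YoungDiagram) :
    (tcoef vK (partSeg lam) : K) • segAct (partSeg lam) ⊥ = ket lam := by
  rw [segAct, if_pos (movable_partSeg lam), move_partSeg, wedge_bead, smul_smul, tcoef,
    ← endDim_add_holes_partSeg, ← Units.val_pow_eq_pow_val, ← Units.val_mul, ← zpow_natCast,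
    ← zpow_add]
  push_cast
  rw [show (endDim (partSeg lam) : ℤ) - (endDim (partSeg lam) +
    holes (Set.range (bead ⊥)) (partSeg lam)) + holes (Set.range (bead ⊥)) (partSeg lam) = 0 by ring,
    zpow_zero]
  exact one_smul _ _

/-- The elements `ũ_p` with `p < m_λ` annihilate the vacuum vector: otherwise the result is some
`|μ⟩` with `m_μ ≤ p < m_λ`, but `μ` and `λ` have the same dimension vector and so are equal. -/
theorem segAct_bot_eq_zero {p : Multisegment} {lam : YoungDiagram} (h : RkLE p (partSeg lam))
    (hne : p ≠ partSeg lam) : segAct p ⊥ = 0 := by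
  rcases segAct_bot p with h1 | ⟨mu, h1, -⟩
  · exact h1
  · have h2 : mu = lam := eq_of_dimVec_partSeg (h1.1.trans h.1)
    subst h2
    exact absurd (h.antisymm h1) hne

end

end FockHall

theorem proposition5p3 (k : Type*) [Field k] :
    (∀ m : FockHall.Multisegment,
      FockHall.fockAction (FockHall.minus (FockHall.uTilde k m)) (FockHall.ket ⊥) = 0 ∨
      ∃ lam : YoungDiagram, FockHall.DegLE k (FockHall.partSeg lam) m ∧
        ∃ a : FockHall.Z,
          FockHall.fockAction (FockHall.minus (FockHall.uTilde k m)) (FockHall.ket ⊥) =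
            FockHall.toK a • FockHall.ket lam) ∧
    (∀ lam : YoungDiagram,
      FockHall.fockAction (FockHall.minus (FockHall.uTilde k (FockHall.partSeg lam)))
        (FockHall.ket ⊥) = FockHall.ket lam) ∧
    (∀ lam : YoungDiagram,
      FockHall.fockAction (FockHall.minus (FockHall.canonicalBasis k (FockHall.partSeg lam)))
        (FockHall.ket ⊥) = FockHall.ket lam) := by
  have h2 : ∀ lam : YoungDiagram,
      FockHall.fockAction (FockHall.minus (FockHall.uTilde k (FockHall.partSeg lam)))
        (FockHall.ket ⊥) = FockHall.ket lam := fun lam => by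
    rw [FockHall.fockAction_uTilde, FockHall.tcoef_smul_segAct_partSeg]
  refine ⟨fun m => ?_, h2, fun lam => ?_⟩
  · rw [FockHall.fockAction_uTilde]
    rcases FockHall.segAct_bot m with h | ⟨lam, h, a, ha⟩
    · exact Or.inl (by rw [h, smul_zero])
    · refine Or.inr ⟨lam, (FockHall.degLE_iff_rkLE k).mpr h,
        (FockHall.tcoef FockHall.vZ m : FockHall.Z) * a, ?_⟩
      rw [ha, map_mul, FockHall.toK_tcoef, smul_smul]
  · obtain ⟨-, c, hc, hb⟩ := FockHall.isCanonical_canonicalBasis k (FockHall.partSeg lam)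
    let act : FockHall.Hall FockHall.Z →+ FockHall.Fock :=
      AddMonoidHom.mk' (fun y => FockHall.fockAction (FockHall.minus y) (FockHall.ket ⊥))
        fun x y => by rw [FockHall.minus_add, map_add, LinearMap.add_apply]
    have h3 : act (c.sum fun p a => a • FockHall.uTilde k p) = 0 := by
      rw [Finsupp.sum, map_sum]
      refine Finset.sum_eq_zero fun p hp => ?_
      have h4 := (hc p hp).1
      change FockHall.fockAction (FockHall.minus _) _ = 0
      rw [FockHall.minus_smul, map_smul, LinearMap.smul_apply, FockHall.fockAction_uTilde,
        FockHall.segAct_bot_eq_zero ((FockHall.degLE_iff_rkLE k).mp h4.1) h4.2, smul_zero, smul_zero]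
    change act (FockHall.canonicalBasis k (FockHall.partSeg lam)) = _
    rw [hb, map_add, h3, add_zero]
    exact h2 lam
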